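/- **Setting.** Let $N\ge 1$, let $\Lambda=(\mathbb Z/N)^4$ be the periodic hypercubic lattice, $\hat s=\hat1+\hat2+\hat3+\hat4$, and let $\tilde\Lambda=\Lambda+\frac12\hat s$ be the dual lattice, with $F:\Lambda\to\tilde\Lambda$, $F(x)=x+\frac12\hat s$. On either lattice, $r$-forms are antisymmetric functions $\alpha_{x,\mu_1\cdots\mu_r}$ on the $r$-cells, $\alpha\cdot\beta$ is their scalar product (sum over sites and over $\mu_1<\dots<\mu_r$), and $$(d\alpha)_{x,\mu_1\cdots\mu_{r}}=\sum_{j=1}^{r}(-1)^{j+1}\bigl[\alpha_{x+\hat\mu_j,\mu_1\cdots\mathring\mu_j\cdots\mu_r}-\alpha_{x,\mu_1\cdots\mathring\mu_j\cdots\mu_r}\bigr],\qquad (\partial\alpha)_{x,\mu_1\cdots\mu_r}=\sum_\nu\bigl[\alpha_{x,\mu_1\cdots\mu_r\nu}-\alpha_{x-\hat\nu,\mu_1\cdots\mu_r\nu}\bigr].$$ For a $p$-form $\alpha$ and a $q$-form $\beta$, the cup product is $$(\alpha\cup\beta)_{x,\mu_1\cdots\mu_{p+q}}=\tfrac1{p!\,q!}\sum_{\sigma\in\mathfrak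 S_{p+q}}\epsilon_\sigma\,\alpha_{x,\mu_{\sigma(1)}\cdots\mu_{\sigma(p)}}\,\beta_{x+\hat\mu_{\sigma(1)}+\cdots+\hat\mu_{\sigma(p)},\,\mu_{\sigma(p+1)}\cdots\mu_{\sigma(p+q)}},$$ and the higher cup product is $$(\alpha\cup_1\beta)_{x,\mu_1\cdots\mu_{p+q-1}}=(-1)^q\sum_a(-1)^a P_{\mu_a}(P_{\mu_a}\iota_{\mu_a}\alpha\cup P_{\mu_a}\iota_{\mu_a}\beta)_{x,\mu_1\cdots\mathring\mu_a\cdots\mu_{p+q-1}}.$$ Here $(\iota_\mu\alpha)_{x,\mu_1\cdots\mu_r}=\alpha_{x,\mu\mu_1\cdots\mu_r}$. The map $P_\mu$ reverses the sign of the coordinates with index $\ge\mu$, and on forms, for $\mu_1<\dots<\mu_r$ and $S'=\{i:\mu_i\ge\mu\}$, it acts by $(P_\mu\alpha)_{x,\mu_1\cdots\mu_r}=(-1)^{|S'|}\alpha_{P_\mu x-\sum_{i\in S'}\hat\mu_i,\,\mu_1\cdots\mu_r}$. Let $P_\partial$ be the orthogonal projection of real $2$-forms onto the image of $\partial$ on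 $3$-forms. For a real $1$-form $A^e$ and an integer $2$-form $n$ put $F^e=dA^e+2\pi n$ and $$Q_0=\tfrac1{8\pi^2}\sum_xF^e\cup F^e,\quad Q=\sum_x\Bigl(\tfrac1{8\pi^2}F^e\cup F^e+\tfrac1{4\pi}F^e\cup_1dn\Bigr),\quad \tilde Q=\sum_x\Bigl(\tfrac1{8\pi^2}F^e\cup F^e-\tfrac1{4\pi}F^e\cup_1dn\Bigr),$$ $$\mathfrak P(n)=\sum_x(n\cup n+n\cup_1dn).$$ For $\beta>0$ and $\theta\in\mathbb R$ let $$Z[\beta,\theta]=\int DA^eDA^m\sum_{n}\exp\Bigl(-\tfrac\beta2F^e\cdot F^e-i\theta Q_0+\tfrac i{2\pi}\partial A^m\cdot F^e\Bigr),$$ where $A^e$ is a $1$-form and $A^m$ a $3$-form with values in $[-\pi,\pi)$, each component is integrated with $\frac{dA}{2\pi}$, and $n$ runs over all integer $2$-forms. For a closed path $\gamma$ of oriented links, let $\dot\gamma_{x,\mu}$ be the number of times that $\gamma$ runs through $(x,\mu)$ minus the number of times that it runs through the reversed link. For $p,q_e,q_m\in\mathbb Z$ set $$\langle W_d^{(q_e,q_m)}(\gamma)\rangle_{\beta,\theta}^p=\frac1{Z[\beta,\theta]}\int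 DA^eDA^m\sum_n e^{-\frac\beta2F^e\cdot F^e-i\theta Q+\frac i{2\pi}\partial A^m\cdot F^e-ip\pi\mathfrak P(n)}\;e^{\,i\sum_x(q_e\dot\gamma A^e-q_m\dot\gamma\cup A^m)},$$ $$\langle\tilde W_d^{(q_e,q_m)}(\gamma)\rangle_{\beta,\theta}^p=\frac1{Z[\beta,\theta]}\int DA^eDA^m\sum_n e^{-\frac\beta2F^e\cdot F^e-i\theta\tilde Q+\frac i{2\pi}\partial A^m\cdot F^e-ip\pi\mathfrak P(n)}\;e^{\,i\sum_x(q_e\dot\gamma A^e+q_mA^m\cup\dot\gamma)}.$$ The same definitions are used on $\tilde\Lambda$; $F(\gamma)$ is the path $\gamma$ moved to $\tilde\Lambda$ by $F$. Finally put $$\tilde\beta=\frac{\beta}{(2\pi\beta)^2+(\theta/2\pi)^2},\qquad\tilde\theta=\frac{-\theta}{(2\pi\beta)^2+(\theta/2\pi)^2}.$$ **Lemma (Poisson summation).** Let $\beta>0$, $\theta\in\mathbb R$, $p,q_e,q_m\in\mathbb Z$, and let $\gamma$ be a closed path in $\Lambda$. The expectation values in (1) and (2) are well defined: all integrals and sums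 converge absolutely and the partition functions do not vanish. Moreover: 1. For every integer $2$-form $l$ on $\Lambda$ with $\epsilon_{\mu\nu\rho\sigma}(dl)_{x+\hat\mu,\nu\rho\sigma}=-\dot\gamma_{x,\mu}$ for all $x,\mu$ (where $\nu<\rho<\sigma$ are the directions other than $\mu$; no sum), with $u=\sum_xP_\partial l\cup_1dP_\partial l$ and $v=\mathfrak P(l)$, $$\langle W_d^{(q_e,q_m)}(\gamma)\rangle_{\beta,\theta}^p=\langle\tilde W_d^{(q_m,-q_e)}(F(\gamma))\rangle_{\tilde\beta,\tilde\theta}^p\;\exp\Bigl(-\tfrac{i}{2}\theta u\,q_m^2-\tfrac{i}{2}\tilde\theta u\,q_e^2-ip\pi v(q_m^2+q_e^2)\Bigr).$$ 2. $\langle W_d^{(q_e,q_m)}(\gamma)\rangle_{\beta,\theta}^p=\langle W_d^{(-q_e,-q_m)}(\gamma)\rangle_{\beta,\theta}^p.$ -/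

import Mathlib

open MeasureTheory

noncomputable section

namespace LatticeMaxwell

/-! ## The periodic hypercubic lattice and its dual -/

/-- The original lattice `Λ` (integer coordinates modulo `N`) or the dual lattice
`Λ̃ = Λ + ŝ/2` (half-odd-integer coordinates modulo `N`). -/
inductive LatticeKind
  | primal
  | dual

/-- A site is labelled by `k : Fin 4 → ZMod N`. On the original lattice its coordinates are `k`,
on the dual lattice they are `k + (1/2, 1/2, 1/2, 1/2)`. -/
abbrev Site (N : ℕ) (_Λ : LatticeKind) : Type := Fin 4 → ZMod N

/-- The map `F : Λ → Λ̃`, `F x = x + ŝ/2`; with the labelling of `Site` it keeps the label. -/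
def dualSite {N : ℕ} (x : Site N .primal) : Site N .dual := x

/-- The set of the directions of an `r`-cell, `μ₁ < ⋯ < μᵣ`. -/
abbrev Dirs (r : ℕ) : Type := {S : Finset (Fin 4) // S.card = r}

/-- An `r`-cell `(x, μ₁ ⋯ μᵣ)` with `μ₁ < ⋯ < μᵣ`. -/
abbrev Cell (N : ℕ) (Λ : LatticeKind) (r : ℕ) : Type := Site N Λ × Dirs r

/-- `R`-valued `r`-forms. An antisymmetric `α_{x, μ₁ ⋯ μᵣ}` is given by its values at ordered
indices `μ₁ < ⋯ < μᵣ`. -/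
abbrev Form (N : ℕ) (Λ : LatticeKind) (r : ℕ) (R : Type) : Type := Cell N Λ r → R

/-- The lattice vector `∑_{μ ∈ S} μ̂`. -/
def dirVec (N : ℕ) (S : Finset (Fin 4)) : Fin 4 → ZMod N := fun i => if i ∈ S then 1 else 0

/-- The sign of the permutation that sorts the increasing enumeration of `I` followed by that of
`J` (for disjoint `I`, `J`): `-1` to the number of inversions. For complementary `I`, `J` it is
the Levi-Civita symbol `ε_{I J}`. -/
def shuffleSign (I J : Finset (Fin 4)) : ℤ :=
  (-1) ^ ((I ×ˢ J).filter (fun q => q.2 < q.1)).card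

section Calculus

variable {N : ℕ} {Λ : LatticeKind} {R : Type} [CommRing R]

/-- The exterior derivative
`(dα)_{x, μ₁⋯μᵣ₊₁} = ∑ⱼ (-1)^{j+1} (α_{x + μ̂ⱼ, μ₁ ⋯ (no μⱼ) ⋯ μᵣ₊₁} - α_{x, μ₁ ⋯ (no μⱼ) ⋯ μᵣ₊₁})`. -/
def latD {r : ℕ} (α : Form N Λ r R) : Form N Λ (r + 1) R := fun c =>
  ∑ μ : Fin 4, ∑ T : Dirs r,
    if μ ∉ T.1 ∧ insert μ T.1 = c.2.1 then
      (shuffleSign {μ} T.1 : R) * (α (c.1 + dirVec N {μ}, T) - α (c.1, T))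
    else 0

/-- The boundary operator
`(∂α)_{x, μ₁⋯μᵣ} = ∑_ν (α_{x, μ₁⋯μᵣ ν} - α_{x - ν̂, μ₁⋯μᵣ ν})`. -/
def latBdry {r : ℕ} (α : Form N Λ (r + 1) R) : Form N Λ r R := fun c =>
  ∑ ν : Fin 4, ∑ T : Dirs (r + 1),
    if ν ∉ c.2.1 ∧ insert ν c.2.1 = T.1 then
      (shuffleSign c.2.1 {ν} : R) * (α (c.1, T) - α (c.1 - dirVec N {ν}, T))
    else 0

/-- The cup product
`(α ∪ β)_{x, K} = ∑_{I ⊔ J = K} ε_{I J} α_{x, I} β_{x + ∑_{i ∈ I} î, J}`, `|I| = p`, `|J| = q`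
(each splitting once, which is what the factor `1/(p! q!)` achieves in the sum over all
permutations). -/
def cup {p q : ℕ} (α : Form N Λ p R) (β : Form N Λ q R) : Form N Λ (p + q) R := fun c =>
  ∑ I : Dirs p, ∑ J : Dirs q,
    if Disjoint I.1 J.1 ∧ I.1 ∪ J.1 = c.2.1 then
      (shuffleSign I.1 J.1 : R) * α (c.1, I) * β (c.1 + dirVec N I.1, J)
    else 0

/-- The interior product `(ι_μ α)_{x, μ₁⋯μᵣ} = α_{x, μ μ₁⋯μᵣ}`. -/
def interior {r : ℕ} (μ : Fin 4) (α : Form N Λ (r + 1) R) : Form N Λ r R := fun c =>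
  ∑ T : Dirs (r + 1),
    if μ ∉ c.2.1 ∧ insert μ c.2.1 = T.1 then (shuffleSign {μ} c.2.1 : R) * α (c.1, T) else 0

/-- The reflection `P_μ` of the coordinates with index `≥ μ`. In terms of labels, `y ↦ -y` reads
`k ↦ -k` on the original lattice and `k ↦ -k - 1` on the dual one (`-(k + 1/2) = (-k - 1) + 1/2`). -/
def reflectSite (μ : Fin 4) (x : Site N Λ) : Site N Λ := fun i =>
  if i < μ then x i else
    match Λ with
    | .primal => -x i
    | .dual => -x i - 1

/-- The parity transformation of forms, `(P_μ α)_{x, S} = (-1)^{|S'|} α_{P_μ x - ∑_{i ∈ S'} î, S}`,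
where `S'` is the set of the `i ∈ S` with `μ ≤ i`. -/
def parity {r : ℕ} (μ : Fin 4) (α : Form N Λ r R) : Form N Λ r R := fun c =>
  (-1) ^ (c.2.1.filter (fun i => μ ≤ i)).card *
    α (reflectSite μ c.1 - dirVec N (c.2.1.filter (fun i => μ ≤ i)), c.2)

/-- The higher cup product of a `P`-form and a `Q`-form (`P = p + 1`, `Q = q + 1`),
`(α ∪₁ β)_{x, μ₁⋯μ_{P+Q-1}}
  = (-1)^Q ∑ₐ (-1)^a (P_{μₐ} (P_{μₐ} ι_{μₐ} α ∪ P_{μₐ} ι_{μₐ} β))_{x, μ₁ ⋯ (no μₐ) ⋯ μ_{P+Q-1}}`. -/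
def cupOne {p q : ℕ} (α : Form N Λ (p + 1) R) (β : Form N Λ (q + 1) R) :
    Form N Λ (p + q + 1) R := fun c =>
  (-1) ^ (q + 1) * ∑ μ : Fin 4, ∑ T : Dirs (p + q),
    if μ ∉ T.1 ∧ insert μ T.1 = c.2.1 then
      (-1) ^ ((T.1.filter (fun i => i < μ)).card + 1) *
        parity μ (cup (parity μ (interior μ α)) (parity μ (interior μ β))) (c.1, T)
    else 0

variable [NeZero N]

/-- The sum over the lattice of a `4`-form. -/
def latSum (ω : Form N Λ 4 R) : R := ∑ c, ω c

/-- The scalar product of `r`-forms. -/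
def dotForm {r : ℕ} (α β : Form N Λ r R) : R := ∑ c, α c * β c

/-- The Pontryagin square `𝔓(n) = ∑ₓ (n ∪ n + n ∪₁ dn)`. -/
def pontryagin (n : Form N Λ 2 R) : R := latSum (cup n n + cupOne n (latD n))

end Calculus

section Gauge

variable {N : ℕ} [NeZero N] {Λ : LatticeKind}

/-- An integer-valued form as a real-valued form. -/
def realForm {r : ℕ} (n : Form N Λ r ℤ) : Form N Λ r ℝ := fun c => (n c : ℝ)

/-- The orthogonal projection `P_∂` of real `2`-forms onto the image of `∂` on `3`-forms (the image
is a linear subspace, so it is its own span). -/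
def projBdry (α : Form N Λ 2 ℝ) : Form N Λ 2 ℝ :=
  ((Submodule.span ℝ (Set.range fun q : Form N Λ 3 ℝ =>
    (WithLp.toLp 2 (latBdry q) : EuclideanSpace ℝ (Cell N Λ 2)))).starProjection
      (WithLp.toLp 2 α)).ofLp

/-- The field strength `F = dA + 2πn`. -/
def fieldStrength (A : Form N Λ 1 ℝ) (n : Form N Λ 2 ℤ) : Form N Λ 2 ℝ :=
  latD A + (2 * Real.pi) • realForm n

/-- `Q₀[F] = (1/8π²) ∑ₓ F ∪ F`. -/
def topChargeZero (A : Form N Λ 1 ℝ) (n : Form N Λ 2 ℤ) : ℝ :=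
  1 / (8 * Real.pi ^ 2) * latSum (cup (fieldStrength A n) (fieldStrength A n))

/-- `Q[F] = ∑ₓ ((1/8π²) F ∪ F + (1/4π) F ∪₁ dn)`. -/
def topCharge (A : Form N Λ 1 ℝ) (n : Form N Λ 2 ℤ) : ℝ :=
  1 / (8 * Real.pi ^ 2) * latSum (cup (fieldStrength A n) (fieldStrength A n)) +
    1 / (4 * Real.pi) * latSum (cupOne (fieldStrength A n) (latD (realForm n)))

/-- `Q̃[F] = ∑ₓ ((1/8π²) F ∪ F - (1/4π) F ∪₁ dn)`. -/
def topChargeDual (A : Form N Λ 1 ℝ) (n : Form N Λ 2 ℤ) : ℝ :=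
  1 / (8 * Real.pi ^ 2) * latSum (cup (fieldStrength A n) (fieldStrength A n)) -
    1 / (4 * Real.pi) * latSum (cupOne (fieldStrength A n) (latD (realForm n)))

/-! ## Contours -/

/-- The oriented link from `base` to `base ± μ̂`, `μ = dir`. -/
structure Link (N : ℕ) (Λ : LatticeKind) where
  base : Site N Λ
  dir : Fin 4
  forward : Bool

/-- The end point of an oriented link. -/
def Link.target {N : ℕ} {Λ : LatticeKind} (e : Link N Λ) : Site N Λ :=
  if e.forward then e.base + dirVec N {e.dir} else e.base - dirVec N {e.dir}

/-- The same link on the dual lattice, moved by `ŝ/2`. -/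
def Link.toDual {N : ℕ} (e : Link N .primal) : Link N .dual where
  base := dualSite e.base
  dir := e.dir
  forward := e.forward

/-- A contour: a closed path of oriented links. -/
structure Contour (N : ℕ) (Λ : LatticeKind) where
  length : ℕ
  link : Fin length → Link N Λ
  closed : ∀ i, (link i).target = (link (finRotate length i)).base

/-- The contour `F(γ)` on the dual lattice. -/
def Contour.toDual {N : ℕ} (γ : Contour N .primal) : Contour N .dual where
  length := γ.length
  link i := (γ.link i).toDual
  closed i := γ.closed i

/-- The tangent `γ̇`: `γ̇_{x,μ}` is the number of times that `γ` runs through `(x, μ)` minus the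
number of times that it runs through `(x + μ̂, -μ)`. -/
def Contour.tangent {N : ℕ} {Λ : LatticeKind} (γ : Contour N Λ) : Form N Λ 1 ℤ := fun c =>
  ∑ i, ((if (γ.link i).forward = true ∧ (γ.link i).base = c.1 ∧ {(γ.link i).dir} = c.2.1
          then 1 else 0) -
        (if (γ.link i).forward = false ∧ (γ.link i).base = c.1 + dirVec N c.2.1 ∧
            {(γ.link i).dir} = c.2.1
          then 1 else 0))

/-- The integer `2`-form `l` satisfies `ε_{μνρσ} (dl)_{x + μ̂, νρσ} = -γ̇_{x, μ}`
(with `ν < ρ < σ` the three directions other than `μ`). -/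
def IsSurfaceForm (γ : Contour N Λ) (l : Form N Λ 2 ℤ) : Prop :=
  ∀ (x : Site N Λ) (I : Dirs 1) (J : Dirs 3), Disjoint I.1 J.1 →
    shuffleSign I.1 J.1 * latD l (x + dirVec N I.1, J) = -γ.tangent (x, I)

/-- `u = ∑ₓ P_∂ l ∪₁ d P_∂ l`. -/
def uNumber (l : Form N Λ 2 ℤ) : ℝ :=
  latSum (cupOne (projBdry (realForm l)) (latD (projBdry (realForm l))))

/-! ## Path integrals -/

/-- The measure `DA = ∏ dA_c / 2π` on `r`-forms with values in `[-π, π)`. -/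
def gaugeMeasure (N : ℕ) [NeZero N] (Λ : LatticeKind) (r : ℕ) : Measure (Form N Λ r ℝ) :=
  Measure.pi fun _ =>
    ENNReal.ofReal (1 / (2 * Real.pi)) • volume.restrict (Set.Ico (-Real.pi) Real.pi)

/-- `∫ DAᵉ DAᵐ ∑_{n} w(Aᵉ, Aᵐ, n)`. -/
def pathIntegral (w : Form N Λ 1 ℝ → Form N Λ 3 ℝ → Form N Λ 2 ℤ → ℂ) : ℂ :=
  ∫ Ae, ∫ Am, ∑' n, w Ae Am n ∂(gaugeMeasure N Λ 3) ∂(gaugeMeasure N Λ 1)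

/-- Absolute convergence of `∫ DAᵉ DAᵐ ∑_{n} w(Aᵉ, Aᵐ, n)`. -/
def PathIntegrable (w : Form N Λ 1 ℝ → Form N Λ 3 ℝ → Form N Λ 2 ℤ → ℂ) : Prop :=
  Integrable (fun q : (Form N Λ 1 ℝ × Form N Λ 3 ℝ) × Form N Λ 2 ℤ => w q.1.1 q.1.2 q.2)
    (((gaugeMeasure N Λ 1).prod (gaugeMeasure N Λ 3)).prod Measure.count)

/-- `exp(-(β/2) F² - iθ Q₀[F] + (i/2π) ∂Aᵐ·F)`. -/
def partitionWeight (β θ : ℝ) (Ae : Form N Λ 1 ℝ) (Am : Form N Λ 3 ℝ) (n : Form N Λ 2 ℤ) : ℂ :=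
  Complex.exp (-(β / 2 * dotForm (fieldStrength Ae n) (fieldStrength Ae n) : ℝ)
    - Complex.I * (θ * topChargeZero Ae n : ℝ)
    + Complex.I * (1 / (2 * Real.pi) * dotForm (latBdry Am) (fieldStrength Ae n) : ℝ))

/-- The partition function `Z[β, θ]`. -/
def partitionFunction (N : ℕ) [NeZero N] (Λ : LatticeKind) (β θ : ℝ) : ℂ :=
  pathIntegral (partitionWeight (N := N) (Λ := Λ) β θ)

/-- The integrand of the expectation value of the dyonic Wilson loop `W_d`,
`exp(-(β/2) F² - iθ Q[F] + (i/2π) ∂Aᵐ·F - ipπ 𝔓(n)) exp(i (q_e γ̇·Aᵉ - q_m ∑ₓ γ̇ ∪ Aᵐ))`. -/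
def dyonicWeight (β θ : ℝ) (p qe qm : ℤ) (γ : Contour N Λ)
    (Ae : Form N Λ 1 ℝ) (Am : Form N Λ 3 ℝ) (n : Form N Λ 2 ℤ) : ℂ :=
  Complex.exp (-(β / 2 * dotForm (fieldStrength Ae n) (fieldStrength Ae n) : ℝ)
    - Complex.I * (θ * topCharge Ae n : ℝ)
    + Complex.I * (1 / (2 * Real.pi) * dotForm (latBdry Am) (fieldStrength Ae n) : ℝ)
    - Complex.I * (p * Real.pi * pontryagin n : ℝ)) *
  Complex.exp (Complex.I * (qe * dotForm (realForm γ.tangent) Ae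
    - qm * latSum (cup (realForm γ.tangent) Am) : ℝ))

/-- The integrand of the expectation value of the dual dyonic Wilson loop `W̃_d`,
`exp(-(β/2) F² - iθ Q̃[F] + (i/2π) ∂Aᵐ·F - ipπ 𝔓(n)) exp(i (q_e γ̇·Aᵉ + q_m ∑ₓ Aᵐ ∪ γ̇))`. -/
def dualDyonicWeight (β θ : ℝ) (p qe qm : ℤ) (γ : Contour N Λ)
    (Ae : Form N Λ 1 ℝ) (Am : Form N Λ 3 ℝ) (n : Form N Λ 2 ℤ) : ℂ :=
  Complex.exp (-(β / 2 * dotForm (fieldStrength Ae n) (fieldStrength Ae n) : ℝ)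
    - Complex.I * (θ * topChargeDual Ae n : ℝ)
    + Complex.I * (1 / (2 * Real.pi) * dotForm (latBdry Am) (fieldStrength Ae n) : ℝ)
    - Complex.I * (p * Real.pi * pontryagin n : ℝ)) *
  Complex.exp (Complex.I * (qe * dotForm (realForm γ.tangent) Ae
    + qm * latSum (cup Am (realForm γ.tangent)) : ℝ))

/-- `⟨W_d^{(q_e, q_m)}(γ)⟩_{β, θ}^p`. -/
def dyonicEV (β θ : ℝ) (p qe qm : ℤ) (γ : Contour N Λ) : ℂ :=
  pathIntegral (dyonicWeight β θ p qe qm γ) / partitionFunction N Λ β θ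

/-- `⟨W̃_d^{(q_e, q_m)}(γ)⟩_{β, θ}^p`. -/
def dualDyonicEV (β θ : ℝ) (p qe qm : ℤ) (γ : Contour N Λ) : ℂ :=
  pathIntegral (dualDyonicWeight β θ p qe qm γ) / partitionFunction N Λ β θ

/-- The expectation value with integrand `w` at the couplings `β`, `θ` makes sense: the integrals
and sums in its numerator and denominator converge absolutely and the denominator is not `0`. -/
def EVDefined (β θ : ℝ) (w : Form N Λ 1 ℝ → Form N Λ 3 ℝ → Form N Λ 2 ℤ → ℂ) : Prop :=
  PathIntegrable w ∧ PathIntegrable (partitionWeight (N := N) (Λ := Λ) β θ) ∧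
    partitionFunction N Λ β θ ≠ 0

end Gauge

/-- `β̃ = β / ((2πβ)² + (θ/2π)²)`. -/
def betaDual (β θ : ℝ) : ℝ :=
  β / ((2 * Real.pi * β) ^ 2 + (θ / (2 * Real.pi)) ^ 2)

/-- `θ̃ = -θ / ((2πβ)² + (θ/2π)²)`. -/
def thetaDual (β θ : ℝ) : ℝ :=
  -θ / ((2 * Real.pi * β) ^ 2 + (θ / (2 * Real.pi)) ^ 2)

end LatticeMaxwell

end

open LatticeMaxwell

/-! Both expectation values are computed in closed form, and the two results are compared.

The field A^m enters only through a phase, so integrating it over the torus imposes dn = q dl, where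
q is the magnetic charge (`pathIntegral_magneticWeight`). Since dl is Poincaré dual to the loop, the
electric phase becomes a pairing of dA^e with l, in the order dA ∪ l for W and l ∪ dA for W̃
(`dyonicWeight_eq`, `dualDyonicWeight_eq`). The solutions of the constraint are n = q l + (flux form
with periods m) + (integer form exact over ℝ), by `fluxDecomposition`.

Split l into P_∂ l and a closed part with fluxes η. Then F = dA' + (constant form with fluxes x = m
+ qη) + 2πq P_∂ l, a sum of three orthogonal pieces. The product ∪₁ measures the noncommutativity of
∪ (`cupOne_latD_apply`), and its presence in Q and Q̃ makes the cross terms one-sided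
(`latSum_cup_add_cupOne`). The charge is therefore half the self-pairing of x, plus a linear
coupling of dA' to the dual of P_∂ l, plus or minus q²u/2 (`charge_eq`). The Pontryagin square
changes only by an even integer (`pontryagin_add`). So each weight factorizes
(`exists_coreWeight_eq`).

The integral over A^e together with the sum over exact integer forms is an integral against a
translation invariant measure on exact real 2-forms. The dual of P_∂ l is exact
(`starForm_latBdry`), so a Gaussian Fourier transform gives exp(-κ²|P_∂ l|²/(2β)) with κ = q_e +
θq/(2π) (`exists_tsum_integral_gaussPhase`).

The remaining sum over six fluxes is a product of three theta series in two variables. Poisson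
summation in both variables passes to the dual couplings and exchanges the charges, up to a phase
and a constant that does not depend on the charges (`exists_fluxSum_dual`); the constant cancels
against the partition functions. Poisson summation in only one variable of each pair, at zero
charge, gives a series of positive terms, so the partition function does not vanish
(`pairSum_zero_ne_zero`).

What remains is bookkeeping: `coupling_identity` matches the coefficients of |P_∂ l|², and
`pairing_closedPart_add` matches the phases up to integer multiples of 2πi. Absolute convergence
follows from a Gaussian bound uniform in A^e (`exists_weight_bound`). The second claim is invariance
under simultaneous negation of A^e, A^m and n. -/

noncomputable section
namespace LatticeMaxwell

/-! ### Enumeration of the cell directions in each dimension -/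

section Explicit

/-- The set of directions `{i}`. -/
abbrev dir1 (i : Fin 4) : Dirs 1 := ⟨{i}, Finset.card_singleton i⟩

abbrev dir01 : Dirs 2 := ⟨{0, 1}, rfl⟩
abbrev dir02 : Dirs 2 := ⟨{0, 2}, rfl⟩
abbrev dir03 : Dirs 2 := ⟨{0, 3}, rfl⟩
abbrev dir12 : Dirs 2 := ⟨{1, 2}, rfl⟩
abbrev dir13 : Dirs 2 := ⟨{1, 3}, rfl⟩
abbrev dir23 : Dirs 2 := ⟨{2, 3}, rfl⟩
abbrev dir012 : Dirs 3 := ⟨{0, 1, 2}, rfl⟩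
abbrev dir013 : Dirs 3 := ⟨{0, 1, 3}, rfl⟩
abbrev dir023 : Dirs 3 := ⟨{0, 2, 3}, rfl⟩
abbrev dir123 : Dirs 3 := ⟨{1, 2, 3}, rfl⟩
abbrev dir0123 : Dirs 4 := ⟨{0, 1, 2, 3}, rfl⟩

variable {M : Type*} [AddCommMonoid M]

theorem sum_dirs_one (f : Dirs 1 → M) :
    ∑ T, f T = f (dir1 0) + f (dir1 1) + f (dir1 2) + f (dir1 3) := by
  have h : (Finset.univ : Finset (Dirs 1)) = {dir1 0, dir1 1, dir1 2, dir1 3} := by decide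
  rw [h, Finset.sum_insert (by decide), Finset.sum_insert (by decide),
    Finset.sum_insert (by decide), Finset.sum_singleton]
  simp only [add_assoc]

theorem sum_dirs_two (f : Dirs 2 → M) :
    ∑ T, f T = f dir01 + f dir02 + f dir03 + f dir12 + f dir13 + f dir23 := by
  have h : (Finset.univ : Finset (Dirs 2)) = {dir01, dir02, dir03, dir12, dir13, dir23} := by
    decide
  rw [h, Finset.sum_insert (by decide), Finset.sum_insert (by decide),
    Finset.sum_insert (by decide), Finset.sum_insert (by decide), Finset.sum_insert (by decide),
    Finset.sum_singleton]
  simp only [add_assoc]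

theorem sum_dirs_three (f : Dirs 3 → M) :
    ∑ T, f T = f dir012 + f dir013 + f dir023 + f dir123 := by
  have h : (Finset.univ : Finset (Dirs 3)) = {dir012, dir013, dir023, dir123} := by decide
  rw [h, Finset.sum_insert (by decide), Finset.sum_insert (by decide),
    Finset.sum_insert (by decide), Finset.sum_singleton]
  simp only [add_assoc]

theorem sum_dirs_four (f : Dirs 4 → M) : ∑ T, f T = f dir0123 := by
  have h : (Finset.univ : Finset (Dirs 4)) = {dir0123} := by decide
  rw [h, Finset.sum_singleton]

end Explicit

/-! ### Explicit form of ∪₁ and its Leibniz rule -/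

section
variable {N : ℕ} {Λ : LatticeKind} {R : Type} [CommRing R]

theorem dirVec_add_of_disjoint (N : ℕ) {S T : Finset (Fin 4)} (h : Disjoint S T) :
    dirVec N S + dirVec N T = dirVec N (S ∪ T) := by
  funext i
  have : i ∈ S → i ∉ T := fun h1 h2 => Finset.disjoint_left.1 h h1 h2
  by_cases h1 : i ∈ S <;> by_cases h2 : i ∈ T <;> simp_all [dirVec]

/-- The reflection acts twice, so the offset of the dual lattice cancels and one formula serves both
lattices. The only trace left is in the shifts: directions of J with index at least μ displace α,
directions of I with index below μ displace β. -/
theorem parity_cup_parity {p q : ℕ} (μ : Fin 4) (α : Form N Λ p R) (β : Form N Λ q R)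
    (c : Cell N Λ (p + q)) :
    parity μ (cup (parity μ α) (parity μ β)) c = ∑ I : Dirs p, ∑ J : Dirs q,
      if Disjoint I.1 J.1 ∧ I.1 ∪ J.1 = c.2.1 then
        (shuffleSign I.1 J.1 : R) * α (c.1 + dirVec N (J.1.filter (fun i => μ ≤ i)), I) *
          β (c.1 + dirVec N (I.1.filter (fun i => i < μ)), J)
      else 0 := by
  obtain ⟨x, K⟩ := c
  simp only [parity, cup, Finset.mul_sum]
  refine Finset.sum_congr rfl fun I _ => Finset.sum_congr rfl fun J _ => ?_
  by_cases h : Disjoint I.1 J.1 ∧ I.1 ∪ J.1 = K.1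
  · rw [if_pos h, if_pos h]
    have hd : Disjoint (I.1.filter (fun i => μ ≤ i)) (J.1.filter (fun i => μ ≤ i)) :=
      Finset.disjoint_filter_filter h.1
    have hu : K.1.filter (fun i => μ ≤ i)
        = I.1.filter (fun i => μ ≤ i) ∪ J.1.filter (fun i => μ ≤ i) := by
      rw [← h.2, Finset.filter_union]
    have hI := Finset.disjoint_left.1 h.1
    have e1 : reflectSite μ (reflectSite μ x - dirVec N (K.1.filter (fun i => μ ≤ i)))
        - dirVec N (I.1.filter (fun i => μ ≤ i))
        = (x + dirVec N (J.1.filter (fun i => μ ≤ i)) : Site N Λ) := by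
      rw [hu]
      funext i
      rcases lt_or_ge i μ with hi | hi
      · have h4 := not_le.2 hi
        cases Λ <;> simp [reflectSite, dirVec, hi, h4]
      · have h4 := not_lt.2 hi
        by_cases h1 : i ∈ I.1
        · have h2 := hI h1
          cases Λ <;> simp [reflectSite, dirVec, hi, h4, h1, h2]
        · cases Λ <;> simp [reflectSite, dirVec, hi, h4, h1] <;> ring
    have e2 : reflectSite μ (reflectSite μ x - dirVec N (K.1.filter (fun i => μ ≤ i))
          + dirVec N I.1) - dirVec N (J.1.filter (fun i => μ ≤ i))
        = (x + dirVec N (I.1.filter (fun i => i < μ)) : Site N Λ) := by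
      rw [hu]
      funext i
      rcases lt_or_ge i μ with hi | hi
      · have h4 := not_le.2 hi
        cases Λ <;> simp [reflectSite, dirVec, hi, h4]
      · have h4 := not_lt.2 hi
        by_cases h1 : i ∈ I.1
        · have h2 := hI h1
          cases Λ <;> simp [reflectSite, dirVec, hi, h4, h1, h2]
        · cases Λ <;> simp [reflectSite, dirVec, hi, h4, h1] <;> ring
    rw [e1, e2, hu, Finset.card_union_of_disjoint hd, pow_add]
    set a := (I.1.filter (fun i => μ ≤ i)).card
    set b := (J.1.filter (fun i => μ ≤ i)).card
    have ha : ((-1 : R) ^ a) * (-1) ^ a = 1 := by rw [← mul_pow]; simp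
    have hb : ((-1 : R) ^ b) * (-1) ^ b = 1 := by rw [← mul_pow]; simp
    linear_combination ((-1) ^ b * (-1) ^ b * (shuffleSign I.1 J.1 : R)
        * α (x + dirVec N (J.1.filter (fun i => μ ≤ i)), I)
        * β (x + dirVec N (I.1.filter (fun i => i < μ)), J)) * ha
      + ((shuffleSign I.1 J.1 : R) * α (x + dirVec N (J.1.filter (fun i => μ ≤ i)), I)
        * β (x + dirVec N (I.1.filter (fun i => i < μ)), J)) * hb
  · rw [if_neg h, if_neg h, mul_zero]

theorem cupOne_apply {p q : ℕ} (α : Form N Λ (p + 1) R) (β : Form N Λ (q + 1) R)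
    (c : Cell N Λ (p + q + 1)) :
    cupOne α β c = (-1) ^ (q + 1) * ∑ μ : Fin 4, ∑ T : Dirs (p + q),
      if μ ∉ T.1 ∧ insert μ T.1 = c.2.1 then
        (-1) ^ ((T.1.filter (fun i => i < μ)).card + 1) *
          ∑ I : Dirs p, ∑ J : Dirs q,
            if Disjoint I.1 J.1 ∧ I.1 ∪ J.1 = T.1 then
              (shuffleSign I.1 J.1 : R) *
                interior μ α (c.1 + dirVec N (J.1.filter (fun i => μ ≤ i)), I) *
                interior μ β (c.1 + dirVec N (I.1.filter (fun i => i < μ)), J)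
            else 0
      else 0 := by
  simp only [cupOne, parity_cup_parity]

theorem latSum_apply [NeZero N] (ω : Form N Λ 4 R) : latSum ω = ∑ x, ω (x, dir0123) := by
  rw [latSum, Fintype.sum_prod_type]
  simp only [sum_dirs_four]


theorem dirVec_empty (N : ℕ) : dirVec N ∅ = 0 := by
  funext i; simp [dirVec]

theorem dirVec_insert (N : ℕ) {i : Fin 4} {S : Finset (Fin 4)} (h : i ∉ S) :
    dirVec N (insert i S) = dirVec N {i} + dirVec N S := by
  rw [dirVec_add_of_disjoint N (Finset.disjoint_singleton_left.2 h), ← Finset.insert_eq]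

/-- Rewriting rules that bring sums of unit vectors into a normal form. -/
theorem site_add_assoc (a b c : Fin 4 → ZMod N) : a + b + c = a + (b + c) := add_assoc a b c

/-- The inequality makes commutativity a terminating sorting rule, so that equal shifted sites
become identical atoms for `ring`. -/
theorem dirVec_sort {i j : Fin 4} (_ : j < i) :
    dirVec N {i} + dirVec N {j} = dirVec N {j} + dirVec N {i} := add_comm _ _

-- The product ∪₁ is a homotopy between the two orders of the cup product. The identity is local and
-- needed only on the top cell, so both sides are expanded into values at shifted sites and compared
-- as polynomials.
set_option maxHeartbeats 2000000 in
theorem cupOne_latD_apply (α β : Form N Λ 2 R) (x : Site N Λ) :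
    cupOne α (latD β) (x, dir0123) = cup α β (x, dir0123) - cup β α (x, dir0123)
      - cupOne (latD α) β (x, dir0123) + latD (cupOne α β) (x, dir0123) := by
  simp (decide := true) only [cup, cupOne_apply, latD, interior, sum_dirs_one, sum_dirs_two,
    sum_dirs_three, if_true, if_false, Fin.sum_univ_four, Finset.filter_singleton, Finset.filter_insert]
  simp (decide := true) [shuffleSign, dirVec_empty, dirVec_insert, site_add_assoc,
    dirVec_sort]
  ring
end

/-! ### The lattice operations as linear and bilinear maps -/

section Bilinear

variable {N : ℕ} {Λ : LatticeKind} {R : Type} [CommRing R]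

/-- The exterior derivative as a linear map. -/
def latDHom (N : ℕ) (Λ : LatticeKind) (r : ℕ) (R : Type) [CommRing R] :
    Form N Λ r R →ₗ[R] Form N Λ (r + 1) R where
  toFun := latD
  map_add' α β := by
    funext c
    simp only [latD, Pi.add_apply, ← Finset.sum_add_distrib]
    refine Finset.sum_congr rfl fun μ _ => Finset.sum_congr rfl fun T _ => ?_
    split_ifs <;> ring
  map_smul' a α := by
    funext c
    simp only [latD, Pi.smul_apply, smul_eq_mul, Finset.mul_sum, RingHom.id_apply]
    refine Finset.sum_congr rfl fun μ _ => Finset.sum_congr rfl fun T _ => ?_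
    split_ifs <;> ring

/-- The boundary operator as a linear map. -/
def latBdryHom (N : ℕ) (Λ : LatticeKind) (r : ℕ) (R : Type) [CommRing R] :
    Form N Λ (r + 1) R →ₗ[R] Form N Λ r R where
  toFun := latBdry
  map_add' α β := by
    funext c
    simp only [latBdry, Pi.add_apply, ← Finset.sum_add_distrib]
    refine Finset.sum_congr rfl fun μ _ => Finset.sum_congr rfl fun T _ => ?_
    split_ifs <;> ring
  map_smul' a α := by
    funext c
    simp only [latBdry, Pi.smul_apply, smul_eq_mul, Finset.mul_sum, RingHom.id_apply]
    refine Finset.sum_congr rfl fun μ _ => Finset.sum_congr rfl fun T _ => ?_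
    split_ifs <;> ring

/-- The cup product as a bilinear map. -/
def cupHom (N : ℕ) (Λ : LatticeKind) (p q : ℕ) (R : Type) [CommRing R] :
    Form N Λ p R →ₗ[R] Form N Λ q R →ₗ[R] Form N Λ (p + q) R :=
  LinearMap.mk₂ R cup
    (fun α α' β => by
      funext c
      simp only [cup, Pi.add_apply, ← Finset.sum_add_distrib]
      refine Finset.sum_congr rfl fun μ _ => Finset.sum_congr rfl fun T _ => ?_
      split_ifs <;> ring)
    (fun a α β => by
      funext c
      simp only [cup, Pi.smul_apply, smul_eq_mul, Finset.mul_sum]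
      refine Finset.sum_congr rfl fun μ _ => Finset.sum_congr rfl fun T _ => ?_
      split_ifs <;> ring)
    (fun α β β' => by
      funext c
      simp only [cup, Pi.add_apply, ← Finset.sum_add_distrib]
      refine Finset.sum_congr rfl fun μ _ => Finset.sum_congr rfl fun T _ => ?_
      split_ifs <;> ring)
    (fun a α β => by
      funext c
      simp only [cup, Pi.smul_apply, smul_eq_mul, Finset.mul_sum]
      refine Finset.sum_congr rfl fun μ _ => Finset.sum_congr rfl fun T _ => ?_
      split_ifs <;> ring)

theorem interior_add {r : ℕ} (μ : Fin 4) (α β : Form N Λ (r + 1) R) :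
    interior μ (α + β) = interior μ α + interior μ β := by
  funext c
  simp only [interior, Pi.add_apply, ← Finset.sum_add_distrib]
  refine Finset.sum_congr rfl fun T _ => ?_
  split_ifs <;> ring

theorem interior_smul {r : ℕ} (μ : Fin 4) (a : R) (α : Form N Λ (r + 1) R) :
    interior μ (a • α) = a • interior μ α := by
  funext c
  simp only [interior, Pi.smul_apply, smul_eq_mul, Finset.mul_sum]
  refine Finset.sum_congr rfl fun T _ => ?_
  split_ifs <;> ring

/-- Exposes the inner cup product as a bilinear map, so that `map_add` and `map_smul` apply under
the sums. -/
theorem cupOne_eq_cupHom {p q : ℕ} (α : Form N Λ (p + 1) R) (β : Form N Λ (q + 1) R)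
    (c : Cell N Λ (p + q + 1)) :
    cupOne α β c = (-1) ^ (q + 1) * ∑ μ : Fin 4, ∑ T : Dirs (p + q),
      if μ ∉ T.1 ∧ insert μ T.1 = c.2.1 then
        (-1) ^ ((T.1.filter (fun i => i < μ)).card + 1) *
          parity μ (cupHom N Λ p q R (parity μ (interior μ α)) (parity μ (interior μ β))) (c.1, T)
      else 0 := rfl

theorem parity_add {r : ℕ} (μ : Fin 4) (α β : Form N Λ r R) :
    parity μ (α + β) = parity μ α + parity μ β := by
  funext c
  simp [parity, mul_add]

theorem parity_smul {r : ℕ} (μ : Fin 4) (a : R) (α : Form N Λ r R) :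
    parity μ (a • α) = a • parity μ α := by
  funext c
  simp [parity, mul_left_comm]

/-- The higher cup product as a bilinear map. -/
def cupOneHom (N : ℕ) (Λ : LatticeKind) (p q : ℕ) (R : Type) [CommRing R] :
    Form N Λ (p + 1) R →ₗ[R] Form N Λ (q + 1) R →ₗ[R] Form N Λ (p + q + 1) R :=
  LinearMap.mk₂ R cupOne
    (fun α α' β => by
      funext c
      simp only [cupOne_eq_cupHom, Pi.add_apply, ← Finset.sum_add_distrib, interior_add,
        parity_add, map_add, LinearMap.add_apply, ← mul_add]
      congr 1
      refine Finset.sum_congr rfl fun μ _ => Finset.sum_congr rfl fun T _ => ?_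
      split_ifs <;> ring)
    (fun a α β => by
      funext c
      simp only [cupOne_eq_cupHom, Pi.smul_apply, smul_eq_mul, interior_smul,
        parity_smul, map_smul, LinearMap.smul_apply]
      rw [mul_left_comm, Finset.mul_sum]
      simp only [Finset.mul_sum]
      refine Finset.sum_congr rfl fun μ _ => Finset.sum_congr rfl fun T _ => ?_
      split_ifs <;> ring)
    (fun α β β' => by
      funext c
      simp only [cupOne_eq_cupHom, Pi.add_apply, ← Finset.sum_add_distrib, interior_add,
        parity_add, map_add, ← mul_add]
      congr 1
      refine Finset.sum_congr rfl fun μ _ => Finset.sum_congr rfl fun T _ => ?_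
      split_ifs <;> ring)
    (fun a α β => by
      funext c
      simp only [cupOne_eq_cupHom, Pi.smul_apply, smul_eq_mul, interior_smul,
        parity_smul, map_smul]
      rw [mul_left_comm, Finset.mul_sum]
      simp only [Finset.mul_sum]
      refine Finset.sum_congr rfl fun μ _ => Finset.sum_congr rfl fun T _ => ?_
      split_ifs <;> ring)

/-- The lattice sum as a linear map. -/
def latSumHom (N : ℕ) [NeZero N] (Λ : LatticeKind) (R : Type) [CommRing R] :
    Form N Λ 4 R →ₗ[R] R where
  toFun := latSum
  map_add' α β := by simp [latSum, Finset.sum_add_distrib]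
  map_smul' a α := by simp [latSum, Finset.mul_sum]

/-- `∑ₓ α ∪ β` for `2`-forms, as a bilinear map. -/
def cupPairing (N : ℕ) [NeZero N] (Λ : LatticeKind) (R : Type) [CommRing R] :
    Form N Λ 2 R →ₗ[R] Form N Λ 2 R →ₗ[R] R :=
  (cupHom N Λ 2 2 R).compr₂ (latSumHom N Λ R)

theorem cupPairing_apply [NeZero N] (α β : Form N Λ 2 R) :
    cupPairing N Λ R α β = latSum (cup α β) := rfl

/-- `∑ₓ α ∪₁ β` for a `2`-form and a `3`-form, as a bilinear map. -/
def cupOnePairing (N : ℕ) [NeZero N] (Λ : LatticeKind) (R : Type) [CommRing R] :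
    Form N Λ 2 R →ₗ[R] Form N Λ 3 R →ₗ[R] R :=
  (cupOneHom N Λ 1 2 R).compr₂ (latSumHom N Λ R)

theorem cupOnePairing_apply [NeZero N] (α : Form N Λ 2 R) (β : Form N Λ 3 R) :
    cupOnePairing N Λ R α β = latSum (cupOne α β) := rfl

/-- The scalar product as a bilinear map. -/
def dotHom (N : ℕ) [NeZero N] (Λ : LatticeKind) (r : ℕ) (R : Type) [CommRing R] :
    Form N Λ r R →ₗ[R] Form N Λ r R →ₗ[R] R :=
  LinearMap.mk₂ R dotForm
    (fun α α' β => by simp [dotForm, add_mul, Finset.sum_add_distrib])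
    (fun a α β => by simp [dotForm, Finset.mul_sum, mul_assoc])
    (fun α β β' => by simp [dotForm, mul_add, Finset.sum_add_distrib])
    (fun a α β => by simp [dotForm, Finset.mul_sum, mul_left_comm])

theorem dotHom_apply [NeZero N] {r : ℕ} (α β : Form N Λ r R) :
    dotHom N Λ r R α β = dotForm α β := rfl

theorem dotForm_comm [NeZero N] {r : ℕ} (α β : Form N Λ r R) : dotForm α β = dotForm β α := by
  simp [dotForm, mul_comm]

end Bilinear

/-! ### Integer forms inside real forms -/

section RealForm

variable {N : ℕ} {Λ : LatticeKind}

theorem realForm_latD {r : ℕ} (α : Form N Λ r ℤ) : latD (realForm α) = realForm (latD α) := by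
  funext c
  simp [latD, realForm, apply_ite (Int.cast : ℤ → ℝ)]

theorem realForm_cup {p q : ℕ} (α : Form N Λ p ℤ) (β : Form N Λ q ℤ) :
    cup (realForm α) (realForm β) = realForm (cup α β) := by
  funext c
  simp [cup, realForm, apply_ite (Int.cast : ℤ → ℝ)]

theorem latSum_realForm [NeZero N] (α : Form N Λ 4 ℤ) : latSum (realForm α) = ((latSum α : ℤ) : ℝ) := by
  simp [latSum, realForm]

theorem realForm_add {r : ℕ} (α β : Form N Λ r ℤ) :
    realForm (α + β) = realForm α + realForm β := by
  funext c; simp [realForm]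

theorem realForm_smul {r : ℕ} (a : ℤ) (α : Form N Λ r ℤ) :
    realForm (a • α) = (a : ℝ) • realForm α := by
  funext c; simp [realForm]

theorem realForm_neg {r : ℕ} (α : Form N Λ r ℤ) : realForm (-α) = -realForm α := by
  funext c; simp [realForm]

theorem realForm_injective {r : ℕ} :
    Function.Injective (realForm : Form N Λ r ℤ → Form N Λ r ℝ) := by
  intro α β h
  funext c
  have := congrFun h c
  simpa [realForm] using this

end RealForm

/-! ### Stokes, Leibniz rules, Cartan's formula and summation by parts -/

section Leibniz

variable {N : ℕ} {Λ : LatticeKind} {R : Type} [CommRing R]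

theorem sum_shift [NeZero N] (f : Site N Λ → R) (v : Fin 4 → ZMod N) : ∑ x, f (x + v) = ∑ x, f x :=
  Fintype.sum_equiv (Equiv.addRight v) _ _ fun _ => rfl

theorem latSum_latD [NeZero N] (ω : Form N Λ 3 R) : latSum (latD ω) = 0 := by
  rw [latSum_apply]
  simp only [latD]
  rw [Finset.sum_comm]
  refine Finset.sum_eq_zero fun μ _ => ?_
  rw [Finset.sum_comm]
  refine Finset.sum_eq_zero fun T _ => ?_
  split_ifs
  · rw [← Finset.mul_sum, Finset.sum_sub_distrib,
      sum_shift (fun x : Site N Λ => ω (x, T)), sub_self, mul_zero]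
  · simp

/-- In the summed Leibniz rule for ∪₁ the total derivative disappears by Stokes, and the term with
dα by closedness. -/
theorem latSum_cupOne_latD [NeZero N] {α : Form N Λ 2 R} (hα : latD α = 0) (β : Form N Λ 2 R) :
    latSum (cupOne α (latD β)) = latSum (cup α β) - latSum (cup β α) := by
  have h0 : cupOne (latD α) β = 0 := by
    rw [hα]
    exact LinearMap.map_zero₂ (cupOneHom N Λ 2 1 R) β
  have h := latSum_latD (cupOne α β)
  rw [latSum_apply] at h ⊢
  rw [latSum_apply, latSum_apply, ← Finset.sum_sub_distrib]
  rw [← sub_zero (∑ x, _), ← h, ← Finset.sum_sub_distrib]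
  refine Finset.sum_congr rfl fun x _ => ?_
  have := cupOne_latD_apply α β x
  rw [h0] at this
  rw [this]
  simp

theorem latD_cup_one_two_apply (A : Form N Λ 1 R) (β : Form N Λ 2 R) (x : Site N Λ) :
    latD (cup A β) (x, dir0123) =
      cup (latD A) β (x, dir0123) - cup A (latD β) (x, dir0123) := by
  simp (decide := true) only [cup, latD, sum_dirs_one, sum_dirs_two,
    sum_dirs_three, if_true, if_false, Fin.sum_univ_four]
  simp (decide := true) [shuffleSign, dirVec_insert, site_add_assoc, dirVec_sort]
  ring

theorem latD_cup_two_one_apply (A : Form N Λ 1 R) (β : Form N Λ 2 R) (x : Site N Λ) :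
    latD (cup β A) (x, dir0123) =
      cup (latD β) A (x, dir0123) + cup β (latD A) (x, dir0123) := by
  simp (decide := true) only [cup, latD, sum_dirs_one, sum_dirs_two,
    sum_dirs_three, if_true, if_false, Fin.sum_univ_four]
  simp (decide := true) [shuffleSign, dirVec_insert, site_add_assoc, dirVec_sort]
  ring_nf

theorem latSum_latD_cup [NeZero N] (A : Form N Λ 1 R) (β : Form N Λ 2 R) :
    latSum (cup (latD A) β) = latSum (cup A (latD β)) := by
  have h := latSum_latD (cup A β)
  rw [latSum_apply] at h
  simp only [latD_cup_one_two_apply] at h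
  rw [Finset.sum_sub_distrib, sub_eq_zero] at h
  rw [latSum_apply, h, ← latSum_apply]

theorem latSum_cup_latD [NeZero N] (A : Form N Λ 1 R) (β : Form N Λ 2 R) :
    latSum (cup β (latD A)) = -latSum (cup (latD β) A) := by
  have h := latSum_latD (cup β A)
  rw [latSum_apply] at h
  simp only [latD_cup_two_one_apply] at h
  rw [Finset.sum_add_distrib] at h
  rw [latSum_apply, eq_neg_of_add_eq_zero_right h, ← latSum_apply]

theorem latD_latD_one (A : Form N Λ 1 R) : latD (latD A) = 0 := by
  funext ⟨x, K⟩
  have : ∀ K : Dirs 3, latD (latD A) (x, K) = 0 := by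
    intro K
    have hK : K = dir012 ∨ K = dir013 ∨ K = dir023 ∨ K = dir123 := by
      revert K; decide
    rcases hK with rfl | rfl | rfl | rfl <;>
    · simp (decide := true) only [latD, sum_dirs_one, sum_dirs_two, if_true, if_false,
        Fin.sum_univ_four]
      simp (decide := true) [shuffleSign, site_add_assoc, dirVec_sort]
      try ring
  exact this K

theorem dirs_two_cases (K : Dirs 2) : K = dir01 ∨ K = dir02 ∨ K = dir03 ∨ K = dir12 ∨
    K = dir13 ∨ K = dir23 := by
  revert K; decide

set_option maxHeartbeats 1000000 in
/-- Cartan's formula for the translation by a lattice unit vector. -/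
theorem latD_interior_add (μ : Fin 4) (α : Form N Λ 2 R) (c : Cell N Λ 2) :
    latD (interior μ α) c + interior μ (latD α) c = α (c.1 + dirVec N {μ}, c.2) - α c := by
  obtain ⟨x, K⟩ := c
  rcases dirs_two_cases K with rfl | rfl | rfl | rfl | rfl | rfl <;> fin_cases μ <;>
  · simp (decide := true) only [latD, interior, sum_dirs_one, sum_dirs_two, sum_dirs_three,
      if_true, if_false, Fin.sum_univ_four]
    simp (decide := true) [shuffleSign, site_add_assoc, dirVec_sort]
    try ring

theorem shuffleSign_swap_two (ν : Fin 4) (S : Dirs 2) :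
    ν ∉ S.1 → shuffleSign S.1 {ν} = shuffleSign {ν} S.1 := by
  revert ν S; decide

/-- Summation by parts: ∂ takes backward differences and d forward ones, whence the minus sign. The
new index stands last in ∂ and first in d, but moving it past two indices costs no sign. -/
theorem dotForm_latBdry [NeZero N] (q : Form N Λ 3 R) (α : Form N Λ 2 R) :
    dotForm (latBdry q) α = -dotForm q (latD α) := by
  simp only [dotForm, Fintype.sum_prod_type, latBdry, latD, Finset.sum_mul, Finset.mul_sum,
    ← Finset.sum_neg_distrib]
  rw [Finset.sum_comm]
  conv_rhs => rw [Finset.sum_comm]; enter [2, T]; rw [Finset.sum_comm]; enter [2, ν]; rw [Finset.sum_comm]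
  conv_lhs => enter [2, S]; rw [Finset.sum_comm]; enter [2, ν]; rw [Finset.sum_comm]
  conv_lhs => rw [Finset.sum_comm]; enter [2, ν]; rw [Finset.sum_comm]
  conv_rhs => rw [Finset.sum_comm]
  refine Finset.sum_congr rfl fun ν _ => Finset.sum_congr rfl fun T _ =>
    Finset.sum_congr rfl fun S _ => ?_
  by_cases h : ν ∉ S.1 ∧ insert ν S.1 = T.1
  · simp only [h, shuffleSign_swap_two ν S h.1]
    have : ∑ x : Site N Λ, q (x - dirVec N {ν}, T) * α (x, S)
        = ∑ x : Site N Λ, q (x, T) * α (x + dirVec N {ν}, S) := by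
      rw [← sum_shift _ (dirVec N {ν})]
      simp
    simp only [not_false_eq_true, true_and, if_true, sub_mul, mul_sub, Finset.sum_sub_distrib,
      mul_assoc, ← Finset.mul_sum, this, Finset.sum_neg_distrib, mul_left_comm (q _)]
    ring
  · simp [h]

end Leibniz

/-! ### The cup pairing in both orders and the duality of 2-forms -/

section Pairing

variable {N : ℕ} {Λ : LatticeKind} {R : Type} [CommRing R]

/-- The pairing `∑ₓ α ∪ β` (for `b = true`) or `∑ₓ β ∪ α` (for `b = false`). -/
def pairing [NeZero N] (b : Bool) : Form N Λ 2 R →ₗ[R] Form N Λ 2 R →ₗ[R] R :=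
  bif b then cupPairing N Λ R else (cupPairing N Λ R).flip

theorem pairing_true [NeZero N] (α β : Form N Λ 2 R) : pairing true α β = latSum (cup α β) := rfl

theorem pairing_false [NeZero N] (α β : Form N Λ 2 R) : pairing false α β = latSum (cup β α) := rfl

theorem pairing_not [NeZero N] (b : Bool) (α β : Form N Λ 2 R) :
    pairing (!b) α β = pairing b β α := by
  cases b <;> rfl

theorem pairing_latD_left [NeZero N] (b : Bool) (A : Form N Λ 1 R) {α : Form N Λ 2 R}
    (hα : latD α = 0) : pairing b (latD A) α = 0 := by
  cases b
  · rw [pairing_false, latSum_cup_latD, hα]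
    rw [show cup (0 : Form N Λ 3 R) A = 0 from LinearMap.map_zero₂ (cupHom N Λ 3 1 R) A]
    simp [latSum]
  · rw [pairing_true, latSum_latD_cup, hα]
    rw [show cup A (0 : Form N Λ 3 R) = 0 from map_zero (cupHom N Λ 1 3 R A)]
    simp [latSum]

theorem pairing_latD_right [NeZero N] (b : Bool) (A : Form N Λ 1 R) {α : Form N Λ 2 R}
    (hα : latD α = 0) : pairing b α (latD A) = 0 := by
  rw [← pairing_not, pairing_latD_left _ A hα]

/-- The sign `1` for `b = true` and `-1` for `b = false`. -/
def boolSign (R : Type) [CommRing R] (b : Bool) : R := bif b then 1 else -1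

/-- The square contributes the cross terms G ∪ f + f ∪ G, and as G is closed the ∪₁ term contributes
±(G ∪ f - f ∪ G). Together they give twice a single order, G ∪ f for one sign and f ∪ G for the
other; this is the role of the correction in Q and Q̃. -/
theorem latSum_cup_add_cupOne [NeZero N] (b : Bool) {G : Form N Λ 2 R} (hG : latD G = 0)
    (f : Form N Λ 2 R) :
    latSum (cup (G + f) (G + f)) + boolSign R b * latSum (cupOne (G + f) (latD f)) =
      latSum (cup G G) + latSum (cup f f) + 2 * pairing b G f
        + boolSign R b * latSum (cupOne f (latD f)) := by
  have h1 : latSum (cup (G + f) (G + f)) = latSum (cup G G) + latSum (cup G f)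
      + latSum (cup f G) + latSum (cup f f) := by
    simp only [← cupPairing_apply, map_add, LinearMap.add_apply]
    ring
  have h2 : latSum (cupOne (G + f) (latD f))
      = latSum (cupOne G (latD f)) + latSum (cupOne f (latD f)) := by
    simp only [← cupOnePairing_apply, map_add, LinearMap.add_apply]
  rw [h1, h2, latSum_cupOne_latD hG]
  cases b
  · rw [pairing_false]; simp only [boolSign, cond_false]; ring
  · rw [pairing_true]; simp only [boolSign, cond_true]; ring

/-- The dual of a `2`-form with respect to `pairing`. -/
def starForm (b : Bool) (β : Form N Λ 2 R) : Form N Λ 2 R := fun c =>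
  ∑ J : Dirs 2, if Disjoint c.2.1 J.1 then
    (shuffleSign c.2.1 J.1 : R) *
      β (bif b then c.1 + dirVec N c.2.1 else c.1 - dirVec N J.1, J) else 0

theorem shuffleSign_comm_two (I J : Dirs 2) : Disjoint I.1 J.1 →
    shuffleSign I.1 J.1 = shuffleSign J.1 I.1 := by
  revert I J; decide

theorem pairing_eq_dotForm [NeZero N] (b : Bool) (α β : Form N Λ 2 R) :
    pairing b α β = dotForm α (starForm b β) := by
  have hU : ∀ I J : Dirs 2, Disjoint I.1 J.1 ↔ Disjoint I.1 J.1 ∧ I.1 ∪ J.1 = dir0123.1 := by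
    decide
  cases b
  · rw [pairing_false, latSum_apply]
    simp only [cup, dotForm, starForm, cond_false, Fintype.sum_prod_type, ← hU, Finset.mul_sum]
    rw [Finset.sum_comm]
    conv_lhs => enter [2, I]; rw [Finset.sum_comm]
    conv_lhs => rw [Finset.sum_comm]
    conv_rhs => rw [Finset.sum_comm]; enter [2, J]; rw [Finset.sum_comm]
    refine Finset.sum_congr rfl fun J _ => Finset.sum_congr rfl fun I _ => ?_
    by_cases h : Disjoint I.1 J.1
    · simp only [h, h.symm, if_true]
      conv_rhs => rw [← sum_shift _ (dirVec N I.1)]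
      refine Finset.sum_congr rfl fun x _ => ?_
      rw [shuffleSign_comm_two I J h, add_sub_cancel_right]
      ring
    · have h' : ¬ Disjoint J.1 I.1 := fun h' => h h'.symm
      simp [h, h']
  · rw [pairing_true, latSum_apply]
    simp only [cup, dotForm, starForm, cond_true, Fintype.sum_prod_type, ← hU, Finset.mul_sum]
    refine Finset.sum_congr rfl fun x _ => Finset.sum_congr rfl fun I _ =>
      Finset.sum_congr rfl fun J _ => ?_
    split_ifs <;> ring

theorem starForm_apply (b : Bool) (β : Form N Λ 2 R) (x : Site N Λ) (I J : Dirs 2)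
    (h : Disjoint I.1 J.1) : starForm b β (x, I) =
      (shuffleSign I.1 J.1 : R) *
        β (bif b then x + dirVec N I.1 else x - dirVec N J.1, J) := by
  rw [starForm, Finset.sum_eq_single J]
  · simp [h]
  · intro K _ hK
    have : ∀ I J K : Dirs 2, Disjoint I.1 J.1 → K ≠ J → ¬ Disjoint I.1 K.1 := by decide
    simp [this I J K h hK]
  · simp

theorem shuffleSign_mul_self (I J : Finset (Fin 4)) :
    (shuffleSign I J : R) * (shuffleSign I J : R) = 1 := by
  simp [shuffleSign, ← mul_pow]

theorem exists_disjoint (I : Dirs 2) : ∃ J : Dirs 2, Disjoint I.1 J.1 := by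
  revert I; decide

/-- The complementary pair of directions. -/
def complDirs (I : Dirs 2) : Dirs 2 := (exists_disjoint I).choose

theorem disjoint_complDirs (I : Dirs 2) : Disjoint I.1 (complDirs I).1 :=
  (exists_disjoint I).choose_spec

theorem complDirs_eq {I J : Dirs 2} (h : Disjoint I.1 J.1) : complDirs I = J := by
  have : ∀ I J K : Dirs 2, Disjoint I.1 J.1 → Disjoint I.1 K.1 → J = K := by decide
  exact this I _ _ (disjoint_complDirs I) h

theorem complDirs_complDirs (I : Dirs 2) : complDirs (complDirs I) = I :=
  complDirs_eq (disjoint_complDirs I).symm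

/-- Each component of the dual is, up to sign, a translate of the complementary component, so
duality is an isometry. -/
theorem dotForm_starForm [NeZero N] (b : Bool) (β : Form N Λ 2 R) :
    dotForm (starForm b β) (starForm b β) = dotForm β β := by
  have key : ∀ c : Cell N Λ 2, starForm b β c * starForm b β c =
      β (bif b then c.1 + dirVec N c.2.1 else c.1 - dirVec N (complDirs c.2).1, complDirs c.2)
        * β (bif b then c.1 + dirVec N c.2.1 else c.1 - dirVec N (complDirs c.2).1,
          complDirs c.2) := by
    rintro ⟨x, I⟩
    rw [starForm_apply b β x I _ (disjoint_complDirs I), mul_mul_mul_comm, shuffleSign_mul_self,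
      one_mul]
  simp only [dotForm, key]
  rw [Fintype.sum_prod_type, Fintype.sum_prod_type, Finset.sum_comm]
  conv_rhs => rw [Finset.sum_comm]
  refine Fintype.sum_bijective complDirs
    (Function.Involutive.bijective complDirs_complDirs) _ _ fun I => ?_
  cases b
  · simpa [sub_eq_add_neg] using
      sum_shift (fun x : Site N Λ => β (x, complDirs I) * β (x, complDirs I)) (-dirVec N _)
  · simpa using sum_shift (fun x : Site N Λ => β (x, complDirs I) * β (x, complDirs I)) _

/-- A `1`-form whose derivative is the dual of the boundary of the `3`-form `q`. -/
def starThree (b : Bool) (q : Form N Λ 3 R) : Form N Λ 1 R := fun c =>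
  ∑ K : Dirs 3, if Disjoint c.2.1 K.1 then
    -(shuffleSign c.2.1 K.1 : R) *
      q (bif b then c.1 + dirVec N c.2.1 else c.1 - dirVec N K.1, K) else 0

-- Duality exchanges the boundary operator with the exterior derivative. Hence the dual of P_∂ l is
-- exact and can serve as the source in a Gaussian integral over exact forms.
set_option maxHeartbeats 1000000 in
theorem starForm_latBdry (b : Bool) (q : Form N Λ 3 R) :
    starForm b (latBdry q) = latD (starThree b q) := by
  funext ⟨x, I⟩
  cases b
  · rcases dirs_two_cases I with rfl | rfl | rfl | rfl | rfl | rfl <;>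
    · simp (decide := true) only [latD, starForm, starThree, latBdry, sum_dirs_one, sum_dirs_two,
        sum_dirs_three, if_true, if_false, Fin.sum_univ_four]
      simp (decide := true) [shuffleSign, site_add_assoc, dirVec_sort, dirVec_insert]
      try ring_nf
  · rcases dirs_two_cases I with rfl | rfl | rfl | rfl | rfl | rfl <;>
    · simp (decide := true) only [latD, starForm, starThree, latBdry, sum_dirs_one, sum_dirs_two,
        sum_dirs_three, if_true, if_false, Fin.sum_univ_four]
      simp (decide := true) [shuffleSign, site_add_assoc, dirVec_sort, dirVec_insert]
      try ring_nf

end Pairing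

/-! ### Constant 2-forms -/

section Constant

variable {N : ℕ} {Λ : LatticeKind} {R : Type} [CommRing R]

/-- The `2`-form with constant components. -/
def constForm (N : ℕ) (Λ : LatticeKind) (h : Dirs 2 → R) : Form N Λ 2 R := fun c => h c.2

/-- The wedge product of constant `2`-forms. -/
def wedge (a b : Dirs 2 → R) : R :=
  ∑ I : Dirs 2, (shuffleSign I.1 (complDirs I).1 : R) * a I * b (complDirs I)

theorem starForm_constForm (b : Bool) (h : Dirs 2 → R) :
    starForm b (constForm N Λ h) =
      constForm N Λ fun I => (shuffleSign I.1 (complDirs I).1 : R) * h (complDirs I) := by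
  funext ⟨x, I⟩
  rw [starForm_apply b _ x I _ (disjoint_complDirs I)]
  rfl

theorem card_site [NeZero N] : (Fintype.card (Site N Λ) : R) = (N : R) ^ 4 := by
  simp [ZMod.card]

theorem dotForm_constForm_constForm [NeZero N] (a b : Dirs 2 → R) :
    dotForm (constForm N Λ a) (constForm N Λ b) = (N : R) ^ 4 * ∑ I, a I * b I := by
  simp only [dotForm, Fintype.sum_prod_type, constForm, Finset.sum_const, Finset.card_univ,
    nsmul_eq_mul, card_site]

theorem pairing_constForm [NeZero N] (b : Bool) (h k : Dirs 2 → R) :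
    pairing b (constForm N Λ h) (constForm N Λ k) = (N : R) ^ 4 * wedge h k := by
  rw [pairing_eq_dotForm, starForm_constForm, dotForm_constForm_constForm, wedge]
  congr 1
  exact Finset.sum_congr rfl fun I _ => by ring

theorem sum_latD [NeZero N] {r : ℕ} (A : Form N Λ r R) (I : Dirs (r + 1)) :
    ∑ x, latD A (x, I) = 0 := by
  simp only [latD]
  rw [Finset.sum_comm]
  refine Finset.sum_eq_zero fun μ _ => ?_
  rw [Finset.sum_comm]
  refine Finset.sum_eq_zero fun T _ => ?_
  split_ifs
  · rw [← Finset.mul_sum, Finset.sum_sub_distrib,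
      sum_shift (fun x : Site N Λ => A (x, T)), sub_self, mul_zero]
  · simp

theorem dotForm_latD_constForm [NeZero N] (A : Form N Λ 1 R) (h : Dirs 2 → R) :
    dotForm (latD A) (constForm N Λ h) = 0 := by
  simp only [dotForm, Fintype.sum_prod_type, constForm]
  rw [Finset.sum_comm]
  refine Finset.sum_eq_zero fun I _ => ?_
  rw [← Finset.sum_mul, sum_latD, zero_mul]

theorem latD_constForm (h : Dirs 2 → R) : latD (constForm N Λ h) = 0 := by
  funext c
  simp [latD, constForm]

end Constant

/-! ### Translations, within a lattice and between the two lattices -/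

section Translation

variable {N : ℕ} {Λ Λ' : LatticeKind} {R : Type} [CommRing R]

/-- The translate of a form, possibly moved to the other lattice. -/
def translate (Λ' : LatticeKind) {r : ℕ} (v : Fin 4 → ZMod N) (α : Form N Λ r R) :
    Form N Λ' r R := fun c => α (c.1 + v, c.2)

theorem latD_translate {r : ℕ} (v : Fin 4 → ZMod N) (α : Form N Λ r R) :
    latD (translate Λ' v α) = translate Λ' v (latD α) := by
  funext c
  simp only [latD, translate, add_right_comm]

theorem latBdry_translate {r : ℕ} (v : Fin 4 → ZMod N) (α : Form N Λ (r + 1) R) :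
    latBdry (translate Λ' v α) = translate Λ' v (latBdry α) := by
  funext c
  simp only [latBdry, translate, sub_add_eq_add_sub]

theorem cup_translate {p q : ℕ} (v : Fin 4 → ZMod N) (α : Form N Λ p R) (β : Form N Λ q R) :
    cup (translate Λ' v α) (translate Λ' v β) = translate Λ' v (cup α β) := by
  funext c
  simp only [cup, translate, add_right_comm]

theorem interior_translate {r : ℕ} (μ : Fin 4) (v : Fin 4 → ZMod N) (α : Form N Λ (r + 1) R) :
    interior μ (translate Λ' v α) = translate Λ' v (interior μ α) := rfl

theorem cupOne_translate {p q : ℕ} (v : Fin 4 → ZMod N) (α : Form N Λ (p + 1) R)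
    (β : Form N Λ (q + 1) R) :
    cupOne (translate Λ' v α) (translate Λ' v β) = translate Λ' v (cupOne α β) := by
  funext c
  simp only [cupOne_apply, interior_translate, translate, add_right_comm]

theorem latSum_translate [NeZero N] (v : Fin 4 → ZMod N) (α : Form N Λ 4 R) :
    latSum (translate Λ' v α) = latSum α := by
  rw [latSum_apply, latSum_apply]
  exact sum_shift (fun x : Site N Λ => α (x, dir0123)) v

theorem realForm_translate {r : ℕ} (v : Fin 4 → ZMod N) (α : Form N Λ r ℤ) :
    realForm (translate Λ' v α) = translate Λ' v (realForm α) := rfl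

theorem dotForm_translate [NeZero N] {r : ℕ} (v : Fin 4 → ZMod N) (α β : Form N Λ r R) :
    dotForm (translate Λ' v α) (translate Λ' v β) = dotForm α β := by
  simp only [dotForm, Fintype.sum_prod_type]
  rw [Finset.sum_comm]
  conv_rhs => rw [Finset.sum_comm]
  exact Finset.sum_congr rfl fun I _ => sum_shift (fun x : Site N Λ => α (x, I) * β (x, I)) v

theorem latD_translate_eq_zero {r : ℕ} (v : Fin 4 → ZMod N) {α : Form N Λ r R}
    (hα : latD α = 0) : latD (translate Λ' v α) = 0 := by
  rw [latD_translate, hα]; rfl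

/-- By Cartan's formula a unit translation changes a closed form by the derivative of its interior
product; longer translations follow by iteration. General coefficients are kept because averages
need ℝ and periods need ℤ. -/
theorem translate_sub_mem_range [NeZero N] (v : Fin 4 → ZMod N) {α : Form N Λ 2 R} (hα : latD α = 0) :
    translate Λ v α - α ∈ LinearMap.range (latDHom N Λ 1 R) := by
  have step : ∀ (μ : Fin 4) (k : ℕ) (α : Form N Λ 2 R), latD α = 0 →
      translate Λ (k • dirVec N {μ}) α - α ∈ LinearMap.range (latDHom N Λ 1 R) := by
    intro μ k
    induction k with
    | zero =>
      intro α _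
      have : translate Λ (0 • dirVec N {μ}) α = α := by
        funext c; simp [translate]
      rw [this, sub_self]
      exact zero_mem _
    | succ k ih =>
      intro α hα
      have h1 := ih (translate Λ (dirVec N {μ}) α) (latD_translate_eq_zero _ hα)
      have h2 : translate Λ (dirVec N {μ}) α - α ∈ LinearMap.range (latDHom N Λ 1 R) := by
        refine ⟨interior μ α, ?_⟩
        funext c
        have := latD_interior_add μ α c
        rw [hα] at this
        have h0 : interior μ (0 : Form N Λ 3 R) c = 0 := by simp [interior]
        rw [h0, add_zero] at this
        exact this
      have h3 : translate Λ ((k + 1) • dirVec N {μ}) α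
          = translate Λ (k • dirVec N {μ}) (translate Λ (dirVec N {μ}) α) := by
        funext c
        simp only [translate, add_smul, one_smul, add_assoc]
      rw [h3, ← sub_add_sub_cancel]
      exact add_mem h1 h2
  have comp : ∀ v w : Fin 4 → ZMod N,
      (∀ α : Form N Λ 2 R, latD α = 0 →
        translate Λ v α - α ∈ LinearMap.range (latDHom N Λ 1 R)) →
      (∀ α : Form N Λ 2 R, latD α = 0 →
        translate Λ w α - α ∈ LinearMap.range (latDHom N Λ 1 R)) →
      ∀ α : Form N Λ 2 R, latD α = 0 →
        translate Λ (v + w) α - α ∈ LinearMap.range (latDHom N Λ 1 R) := by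
    intro v w h1 h2 α hα
    have h3 : translate Λ (v + w) α = translate Λ v (translate Λ w α) := by
      funext c
      simp only [translate, add_assoc]
    rw [h3, ← sub_add_sub_cancel]
    exact add_mem (h1 _ (latD_translate_eq_zero _ hα)) (h2 α hα)
  -- Natural representatives of the residues make every translation a finite composite of unit
  -- steps.
  have hv : v = (v 0).val • dirVec N {0} + ((v 1).val • dirVec N {1} +
      ((v 2).val • dirVec N {2} + (v 3).val • dirVec N {3})) := by
    funext i
    fin_cases i <;>
    · simp only [Pi.add_apply, Pi.smul_apply, dirVec]
      simp
  rw [hv]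
  exact comp _ _ (step 0 _) (comp _ _ (step 1 _) (comp _ _ (step 2 _) (step 3 _))) α hα

end Translation

/-! ### Averages, periods and the second cohomology of the torus -/

section Cohomology

variable {N : ℕ} [NeZero N] {Λ : LatticeKind}

/-- The average over the lattice of the components of a `2`-form. -/
def average (α : Form N Λ 2 ℝ) : Dirs 2 → ℝ := fun I => (∑ x, α (x, I)) / (N : ℝ) ^ 4

/-- A closed `2`-form is the sum of an exact one and of its average. -/
theorem exists_eq_latD_add_average {α : Form N Λ 2 ℝ} (hα : latD α = 0) :
    ∃ A : Form N Λ 1 ℝ, α = latD A + constForm N Λ (average α) := by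
  have hN : (N : ℝ) ≠ 0 := Nat.cast_ne_zero.2 (NeZero.ne N)
  -- Summed over all translations, the difference is N⁴ times (average - α), and it is still exact;
  -- hence the factor -1/N⁴ in the potential.
  have h1 : ∑ v : Fin 4 → ZMod N, (translate Λ v α - α) ∈ LinearMap.range (latDHom N Λ 1 ℝ) :=
    Submodule.sum_mem _ fun v _ => translate_sub_mem_range v hα
  obtain ⟨A, hA⟩ := h1
  refine ⟨-(1 / (N : ℝ) ^ 4) • A, ?_⟩
  have h2 : latD (-(1 / (N : ℝ) ^ 4) • A) = -(1 / (N : ℝ) ^ 4) • latDHom N Λ 1 ℝ A :=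
    map_smul (latDHom N Λ 1 ℝ) _ A
  rw [h2, hA]
  funext ⟨x, I⟩
  have h3 : ∑ v : Fin 4 → ZMod N, α (x + v, I) = ∑ y, α (y, I) := by
    simpa only [add_comm] using sum_shift (fun y : Site N Λ => α (y, I)) x
  have h4 : (∑ v : Fin 4 → ZMod N, (translate Λ v α - α)) (x, I)
      = ∑ y, α (y, I) - (N : ℝ) ^ 4 * α (x, I) := by
    rw [Finset.sum_apply]
    change ∑ v : Fin 4 → ZMod N, (α (x + v, I) - α (x, I)) = _
    rw [Finset.sum_sub_distrib, h3, Finset.sum_const, Finset.card_univ, nsmul_eq_mul,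
      card_site (Λ := Λ)]
  rw [Pi.add_apply, Pi.smul_apply, h4, constForm, average, smul_eq_mul]
  field_simp
  ring

/-- The lattice plane through the origin spanned by the directions in `I`. -/
def plane (N : ℕ) [NeZero N] (I : Finset (Fin 4)) : Finset (Fin 4 → ZMod N) :=
  Finset.univ.filter fun s => ∀ j, j ∉ I → s j = 0

theorem card_plane (I : Finset (Fin 4)) : (plane N I).card = N ^ I.card := by
  have : plane N I = Fintype.piFinset fun j => if j ∈ I then Finset.univ else {0} := by
    ext s
    simp only [plane, Finset.mem_filter, Finset.mem_univ, true_and, Fintype.mem_piFinset]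
    refine forall_congr' fun j => ?_
    by_cases h : j ∈ I <;> simp [h]
  rw [this, Fintype.card_piFinset]
  have h2 : ∀ j, (if j ∈ I then (Finset.univ : Finset (ZMod N)) else {0}).card
      = if j ∈ I then N else 1 := by
    intro j
    split_ifs
    · simp [ZMod.card]
    · simp
  simp only [h2]
  rw [Finset.prod_ite_mem]
  simp

theorem sum_plane_shift {R : Type} [AddCommMonoid R] (I : Finset (Fin 4)) {i : Fin 4}
    (hi : i ∈ I) (f : (Fin 4 → ZMod N) → R) :
    ∑ s ∈ plane N I, f (s + dirVec N {i}) = ∑ s ∈ plane N I, f s := by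
  refine Finset.sum_bij' (fun s _ => s + dirVec N {i}) (fun s _ => s - dirVec N {i})
    ?_ ?_ (by simp) (by simp) (by simp)
  all_goals
    intro s hs
    simp only [plane, Finset.mem_filter, Finset.mem_univ, true_and] at hs ⊢
    intro j hj
    have : j ≠ i := fun h => hj (h ▸ hi)
    simp [dirVec, hs j hj, this]

theorem sum_plane_latD (A : Form N Λ 1 ℤ) (x : Site N Λ) (I : Dirs 2) :
    ∑ s ∈ plane N I.1, latD A (x + s, I) = 0 := by
  simp only [latD]
  rw [Finset.sum_comm]
  refine Finset.sum_eq_zero fun μ _ => ?_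
  rw [Finset.sum_comm]
  refine Finset.sum_eq_zero fun T _ => ?_
  by_cases h : μ ∉ T.1 ∧ insert μ T.1 = I.1
  · simp only [if_pos h]
    have hμ : μ ∈ I.1 := h.2 ▸ Finset.mem_insert_self μ T.1
    rw [← Finset.mul_sum, Finset.sum_sub_distrib]
    have := sum_plane_shift I.1 hμ (fun s => A (x + s, T))
    simp only [← add_assoc] at this
    rw [this, sub_self, mul_zero]
  · simp [h]

/-- The periods of an integer `2`-form over the coordinate planes through the origin. -/
def period (n : Form N Λ 2 ℤ) : Dirs 2 → ℤ := fun I => ∑ s ∈ plane N I.1, n (s, I)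

/-- A translate of n differs from n by the derivative of an integer 1-form, and such a derivative
sums to zero over a periodic lattice plane. -/
theorem sum_plane_eq_period {n : Form N Λ 2 ℤ} (hn : latD n = 0) (x : Site N Λ) (I : Dirs 2) :
    ∑ s ∈ plane N I.1, n (x + s, I) = period n I := by
  have h : translate Λ x n - n ∈ LinearMap.range (latDHom N Λ 1 ℤ) := translate_sub_mem_range x hn
  obtain ⟨A, hA⟩ := h
  have h1 := sum_plane_latD A 0 I
  have h2 : ∀ s, latD A (0 + s, I) = n (x + s, I) - n (s, I) := by
    intro s
    have := congrFun hA (s, I)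
    rw [zero_add, add_comm x s]
    exact this
  simp only [h2, Finset.sum_sub_distrib] at h1
  exact sub_eq_zero.1 h1

/-- Double counting: each of the N⁴ parallel plane sums equals the period, while each of the N²
displacements within a plane yields the whole lattice sum. -/
theorem sum_eq_period {n : Form N Λ 2 ℤ} (hn : latD n = 0) (I : Dirs 2) :
    ∑ x, n (x, I) = (N : ℤ) ^ 2 * period n I := by
  have h1 : ∑ x : Site N Λ, ∑ s ∈ plane N I.1, n (x + s, I) = (N : ℤ) ^ 4 * period n I := by
    simp [sum_plane_eq_period hn, ZMod.card]
  have h2 : ∑ x : Site N Λ, ∑ s ∈ plane N I.1, n (x + s, I)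
      = (N : ℤ) ^ 2 * ∑ x, n (x, I) := by
    rw [Finset.sum_comm]
    simp only [sum_shift (fun x : Site N Λ => n (x, I)), Finset.sum_const, card_plane, I.2]
    simp
  have hN : ((N : ℤ) ^ 2) ≠ 0 := pow_ne_zero _ (Nat.cast_ne_zero.2 (NeZero.ne N))
  refine mul_left_cancel₀ hN ?_
  rw [← h2, h1]
  ring

theorem average_realForm {n : Form N Λ 2 ℤ} (hn : latD n = 0) (I : Dirs 2) :
    average (realForm n) I = period n I / (N : ℝ) ^ 2 := by
  have hN : (N : ℝ) ≠ 0 := Nat.cast_ne_zero.2 (NeZero.ne N)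
  have h : ∑ x, realForm n (x, I) = (N : ℝ) ^ 2 * period n I := by
    have := sum_eq_period hn I
    simp only [realForm]
    exact_mod_cast this
  rw [average, h]
  field_simp

theorem period_add (n n' : Form N Λ 2 ℤ) : period (n + n') = period n + period n' := by
  funext I
  simp [period, Finset.sum_add_distrib]

/-- The closed `2`-form with prescribed periods that is supported on the coordinate planes
transversal to the ones through the origin. -/
def fluxForm (N : ℕ) [NeZero N] (Λ : LatticeKind) (m : Dirs 2 → ℤ) : Form N Λ 2 ℤ := fun c =>
  if ∀ i ∈ c.2.1, c.1 i = 0 then m c.2 else 0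

/-- A component depends only on the coordinates along its own cell, and d takes differences only in
transversal directions. -/
theorem latD_fluxForm (m : Dirs 2 → ℤ) : latD (fluxForm N Λ m) = 0 := by
  funext c
  rw [latD, Pi.zero_apply]
  refine Finset.sum_eq_zero fun μ _ => Finset.sum_eq_zero fun T _ => ?_
  split_ifs with h
  · have : fluxForm N Λ m (c.1 + dirVec N {μ}, T) = fluxForm N Λ m (c.1, T) := by
      simp only [fluxForm]
      congr 1
      refine propext (forall₂_congr fun i hi => ?_)
      have : i ≠ μ := fun h' => h.1 (h' ▸ hi)
      simp [dirVec, this]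
    rw [this, sub_self, mul_zero]
  · rfl

theorem period_fluxForm (m : Dirs 2 → ℤ) : period (fluxForm N Λ m) = m := by
  funext I
  rw [period, Finset.sum_eq_single 0]
  · simp [fluxForm]
  · intro s hs h0
    simp only [plane, Finset.mem_filter, Finset.mem_univ, true_and] at hs
    refine if_neg fun h => h0 (funext fun i => ?_)
    by_cases hi : i ∈ I.1
    · exact h i hi
    · exact hs i hi
  · intro h
    simp [plane] at h

end Cohomology

/-! ### Invariance and characters of the torus of gauge fields -/

section Torus

/-- The normalized measure `dA / 2π` on `[-π, π)`. -/
def angleMeasure : Measure ℝ :=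
  ENNReal.ofReal (1 / (2 * Real.pi)) • volume.restrict (Set.Ico (-Real.pi) Real.pi)

instance : IsProbabilityMeasure angleMeasure := by
  constructor
  rw [angleMeasure, Measure.smul_apply, Measure.restrict_apply_univ, Real.volume_Ico, smul_eq_mul,
    ← ENNReal.ofReal_mul (by positivity), ENNReal.ofReal_eq_one]
  field_simp
  ring

theorem gaugeMeasure_eq (N : ℕ) [NeZero N] (Λ : LatticeKind) (r : ℕ) :
    gaugeMeasure N Λ r = Measure.pi fun _ => angleMeasure := rfl

instance (N : ℕ) [NeZero N] (Λ : LatticeKind) (r : ℕ) :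
    IsProbabilityMeasure (gaugeMeasure N Λ r) := by
  rw [gaugeMeasure_eq]; infer_instance

theorem angleMeasure_eq_Ioc : angleMeasure =
    ENNReal.ofReal (1 / (2 * Real.pi)) • volume.restrict (Set.Ioc (-Real.pi) Real.pi) := by
  rw [angleMeasure, restrict_Ico_eq_restrict_Ioc]

theorem measurePreserving_neg_angleMeasure :
    MeasurePreserving (fun a : ℝ => -a) angleMeasure angleMeasure := by
  refine ⟨measurable_neg, ?_⟩
  have h := (Measure.measurePreserving_neg (volume : Measure ℝ)).restrict_preimage
    (measurableSet_Ioc (a := -Real.pi) (b := Real.pi))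
  have h2 : (Neg.neg ⁻¹' Set.Ioc (-Real.pi) Real.pi : Set ℝ) = Set.Ico (-Real.pi) Real.pi := by
    ext x
    simp only [Set.mem_preimage, Set.mem_Ioc, Set.mem_Ico]
    constructor <;> rintro ⟨h1, h2⟩ <;> constructor <;> linarith
  rw [h2] at h
  conv_rhs => rw [angleMeasure_eq_Ioc]
  rw [angleMeasure, Measure.map_smul]
  congr 1
  exact h.map_eq

instance : Fact (0 < 2 * Real.pi) := ⟨Real.two_pi_pos⟩

/-- Addition of `b` modulo `2π`, with values in `(-π, π]`. -/
def addMod (b x : ℝ) : ℝ :=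
  (AddCircle.equivIoc (2 * Real.pi) (-Real.pi) ((x + b : ℝ) : AddCircle (2 * Real.pi)) : ℝ)

theorem exists_addMod (b x : ℝ) : ∃ k : ℤ, addMod b x = x + b + 2 * Real.pi * k := by
  have h : ((addMod b x : ℝ) : AddCircle (2 * Real.pi)) = ((x + b : ℝ) : AddCircle _) :=
    AddCircle.coe_equivIoc
  rw [← sub_eq_zero, ← AddCircle.coe_sub, AddCircle.coe_eq_zero_iff] at h
  obtain ⟨k, hk⟩ := h
  refine ⟨k, ?_⟩
  rw [zsmul_eq_mul] at hk
  linarith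

/-- Rotation invariance of the circle, transported through the quotient map and the section with
values in (-π, π]. -/
theorem measurePreserving_addMod (b : ℝ) :
    MeasurePreserving (addMod b) angleMeasure angleMeasure := by
  have hpi : -Real.pi + 2 * Real.pi = Real.pi := by ring
  have h1 := AddCircle.measurePreserving_mk (2 * Real.pi) (-Real.pi)
  have h2 : MeasurePreserving (fun y : AddCircle (2 * Real.pi) => y + (b : AddCircle _))
      volume volume := measurePreserving_add_right _ _
  have h3 := AddCircle.measurePreserving_equivIoc (T := 2 * Real.pi) (a := -Real.pi)
  have h4 : MeasurePreserving (Subtype.val : Set.Ioc (-Real.pi) (-Real.pi + 2 * Real.pi) → ℝ)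
      (Measure.comap Subtype.val volume)
      (volume.restrict (Set.Ioc (-Real.pi) (-Real.pi + 2 * Real.pi))) :=
    ⟨measurable_subtype_coe, map_comap_subtype_coe measurableSet_Ioc _⟩
  have h5 : MeasurePreserving (addMod b) _ _ := h4.comp (h3.comp (h2.comp h1))
  rw [hpi] at h5
  rw [angleMeasure_eq_Ioc]
  exact ⟨h5.measurable, by rw [Measure.map_smul]; congr 1; exact h5.map_eq⟩

variable {ι : Type*} [Fintype ι]

theorem measurePreserving_pi_addMod (B : ι → ℝ) :
    MeasurePreserving (fun A : ι → ℝ => fun i => addMod (B i) (A i))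
      (Measure.pi fun _ => angleMeasure) (Measure.pi fun _ => angleMeasure) :=
  measurePreserving_pi _ _ fun i => measurePreserving_addMod (B i)

/-- A function on the torus has the same integral as its translates. -/
theorem lintegral_add_of_periodic {Ψ : (ι → ℝ) → ENNReal} (hΨ : Measurable Ψ)
    (hper : ∀ (A : ι → ℝ) (k : ι → ℤ), Ψ (fun i => A i + 2 * Real.pi * k i) = Ψ A)
    (B : ι → ℝ) :
    ∫⁻ A, Ψ (A + B) ∂(Measure.pi fun _ => angleMeasure) =
      ∫⁻ A, Ψ A ∂(Measure.pi fun _ => angleMeasure) := by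
  rw [← (measurePreserving_pi_addMod B).lintegral_comp hΨ]
  refine lintegral_congr fun A => ?_
  choose k hk using fun i => exists_addMod (B i) (A i)
  simp only [hk]
  exact (hper (A + B) k).symm

theorem integral_angleMeasure_exp (k : ℤ) :
    ∫ a, Complex.exp (-(Complex.I * (k * a : ℝ))) ∂angleMeasure = if k = 0 then 1 else 0 := by
  split_ifs with h
  · simp [h]
  · rw [angleMeasure_eq_Ioc, integral_smul_measure,
      ← intervalIntegral.integral_of_le (by linarith [Real.pi_pos])]
    have hk : (-(Complex.I * k) : ℂ) ≠ 0 := by simp [h]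
    have h1 : ∀ a : ℝ, Complex.exp (-(Complex.I * (k * a : ℝ)))
        = Complex.exp ((-(Complex.I * k) : ℂ) * a) := by
      intro a; congr 1; push_cast; ring
    simp only [h1]
    rw [integral_exp_mul_complex hk]
    have h2 : Complex.exp (-(Complex.I * k) * (Real.pi : ℝ))
        = Complex.exp (-(Complex.I * k) * ((-Real.pi : ℝ) : ℂ)) := by
      rw [Complex.exp_eq_exp_iff_exists_int]
      exact ⟨-k, by push_cast; ring⟩
    rw [h2, sub_self, zero_div, smul_zero]

theorem integral_pi_angleMeasure_exp (k : ι → ℤ) :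
    ∫ A : ι → ℝ, Complex.exp (-(Complex.I * (∑ i, k i * A i : ℝ)))
      ∂(Measure.pi fun _ => angleMeasure) = if k = 0 then 1 else 0 := by
  have h : ∀ A : ι → ℝ, Complex.exp (-(Complex.I * (∑ i, k i * A i : ℝ)))
      = ∏ i, Complex.exp (-(Complex.I * (k i * A i : ℝ))) := by
    intro A
    rw [← Complex.exp_sum]
    congr 1
    push_cast
    rw [Finset.mul_sum, Finset.sum_neg_distrib]
  simp only [h]
  rw [integral_fintype_prod_eq_prod (fun i a => Complex.exp (-(Complex.I * (k i * a : ℝ))))]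
  simp only [integral_angleMeasure_exp]
  split_ifs with h0
  · simp [h0]
  · obtain ⟨i, hi⟩ := Function.ne_iff.1 h0
    exact Finset.prod_eq_zero (Finset.mem_univ i) (if_neg hi)

end Torus

/-! ### Gaussian summability and interchange of sum and integral -/

section Summation

/-- A finite set of multi-indices lies in a box, and over a box the sum of products is a product of
sums. -/
theorem summable_pi_prod {ι X : Type*} [Fintype ι] {f : X → ℝ} (h0 : ∀ x, 0 ≤ f x)
    (hf : Summable f) : Summable fun n : ι → X => ∏ i, f (n i) := by
  classical
  refine summable_of_sum_le (c := ∏ _i : ι, ∑' x, f x)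
    (fun n => Finset.prod_nonneg fun i _ => h0 _) fun s => ?_
  calc ∑ n ∈ s, ∏ i, f (n i)
      ≤ ∑ n ∈ Fintype.piFinset fun i => s.image fun n => n i, ∏ i, f (n i) := by
        refine Finset.sum_le_sum_of_subset_of_nonneg ?_
          fun n _ _ => Finset.prod_nonneg fun i _ => h0 _
        intro n hn
        rw [Fintype.mem_piFinset]
        exact fun i => Finset.mem_image_of_mem (fun n => n i) hn
    _ = ∏ i, ∑ x ∈ s.image (fun n => n i), f x := by
        rw [Finset.prod_univ_sum]
    _ ≤ ∏ _i : ι, ∑' x, f x :=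
        Finset.prod_le_prod (fun i _ => Finset.sum_nonneg fun x _ => h0 x)
          fun i _ => hf.sum_le_tsum _ fun x _ => h0 x

theorem summable_exp_neg_mul_sq {c : ℝ} (hc : 0 < c) :
    Summable fun k : ℤ => Real.exp (-(c * (k : ℝ) ^ 2)) := by
  have h := summable_pow_mul_jacobiTheta₂_term_bound 0 (T := c / Real.pi) (by positivity) 0
  refine h.congr fun k => ?_
  rw [pow_zero, one_mul]
  congr 1
  field_simp
  ring

theorem summable_exp_neg_mul_sum_sq {ι : Type*} [Fintype ι] {c : ℝ} (hc : 0 < c) :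
    Summable fun n : ι → ℤ => Real.exp (-(c * ∑ i, (n i : ℝ) ^ 2)) := by
  have := summable_pi_prod (ι := ι) (fun k => (Real.exp_pos _).le) (summable_exp_neg_mul_sq hc)
  refine this.congr fun n => ?_
  rw [← Real.exp_sum, Finset.mul_sum, Finset.sum_neg_distrib]

/-- Interchange of an integral over a finite measure with a uniformly summable series. -/
theorem integral_tsum_of_bound {X ι : Type*} [MeasurableSpace X] [Countable ι] {μ : Measure X}
    [IsFiniteMeasure μ] {w : ι → X → ℂ} {b : ι → ℝ} (hw : ∀ i, AEStronglyMeasurable (w i) μ)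
    (hb : ∀ i, ∀ᵐ x ∂μ, ‖w i x‖ ≤ b i) (hs : Summable b) :
    ∫ x, ∑' i, w i x ∂μ = ∑' i, ∫ x, w i x ∂μ := by
  have hint : ∀ i, Integrable (w i) μ := fun i =>
    Integrable.of_bound (hw i) (b i) (hb i)
  refine (integral_tsum_of_summable_integral_norm hint ?_).symm
  refine Summable.of_nonneg_of_le (fun i => integral_nonneg fun x => norm_nonneg _) (fun i => ?_)
    (hs.mul_right (μ.real Set.univ))
  calc ∫ x, ‖w i x‖ ∂μ ≤ ∫ _, b i ∂μ := 
        integral_mono_ae (hint i).norm (integrable_const _) (hb i)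
    _ = b i * μ.real Set.univ := by simp [mul_comm]

end Summation


/-! ### Theta series of a complementary pair of fluxes -/

section Poisson

open Complex in
/-- Poisson summation for a shifted Gaussian. -/
theorem tsum_exp_shifted {a : ℝ} (ha : 0 < a) (w ξ : ℂ) :
    ∑' n : ℤ, exp (-Real.pi * a * (n + w) ^ 2 - 2 * Real.pi * I * ξ * (n + w)) =
      1 / (a : ℂ) ^ (1 / 2 : ℂ) *
        ∑' k : ℤ, exp (-Real.pi / a * (k + ξ) ^ 2 + 2 * Real.pi * I * k * w) := by
  have ha' : (a : ℂ) ≠ 0 := ofReal_ne_zero.2 ha.ne'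
  -- Expanding the square merges w and ξ into the single linear coefficient -aw - iξ. Complex ξ is
  -- allowed because the second summation, in `pairSum_dual`, needs it.
  have h := tsum_exp_neg_quadratic (a := a) (by simpa using ha) (-a * w - I * ξ)
  have h1 : ∀ n : ℤ, exp (-Real.pi * a * (n + w) ^ 2 - 2 * Real.pi * I * ξ * (n + w))
      = exp (-Real.pi * a * w ^ 2 - 2 * Real.pi * I * ξ * w) *
        exp (-Real.pi * a * n ^ 2 + 2 * Real.pi * (-a * w - I * ξ) * n) := by
    intro n
    rw [← exp_add]
    congr 1
    ring
  have h2 : ∀ k : ℤ, exp (-Real.pi / a * (k + ξ) ^ 2 + 2 * Real.pi * I * k * w)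
      = exp (-Real.pi * a * w ^ 2 - 2 * Real.pi * I * ξ * w) *
        exp (-Real.pi / a * (k + I * (-a * w - I * ξ)) ^ 2) := by
    intro k
    rw [← exp_add]
    congr 1
    have hI : I * (-a * w - I * ξ) = ξ - I * a * w := by
      linear_combination (-ξ) * I_sq
    rw [hI]
    field_simp
    linear_combination (a ^ 2 * w ^ 2 : ℂ) * I_sq
  simp only [h1, h2, tsum_mul_left]
  rw [h]
  ring

theorem summable_int_prod_of_le {f : ℤ × ℤ → ℂ} {c C : ℝ} (hc : 0 < c)
    (hf : ∀ p : ℤ × ℤ, ‖f p‖ ≤ Real.exp (C - c * ((p.1 : ℝ) ^ 2 + (p.2 : ℝ) ^ 2))) :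
    Summable f := by
  have h := summable_exp_neg_mul_sq hc
  have h2 : Summable fun p : ℤ × ℤ => Real.exp (-(c * (p.1 : ℝ) ^ 2)) *
      Real.exp (-(c * (p.2 : ℝ) ^ 2)) :=
    h.mul_of_nonneg h (fun _ => (Real.exp_pos _).le) fun _ => (Real.exp_pos _).le
  refine Summable.of_norm_bounded (h2.mul_left (Real.exp C)) fun p => (hf p).trans (le_of_eq ?_)
  rw [← Real.exp_add, ← Real.exp_add]
  congr 1
  ring

theorem sq_half_sub_le (m u : ℝ) : m ^ 2 / 2 - u ^ 2 ≤ (m + u) ^ 2 := by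
  nlinarith [sq_nonneg (m + 2 * u)]

/-- A summand of the theta series for a pair of complementary fluxes. -/
def pairTerm (s β θ Q P a b : ℝ) (p : ℤ × ℤ) : ℂ :=
  Complex.exp (-(2 * Real.pi ^ 2 * β * ((p.1 + P * a) ^ 2 + (p.2 + P * b) ^ 2) : ℝ)
    - Complex.I * (θ * s * ((p.1 + P * a) * (p.2 + P * b)) : ℝ)
    - Complex.I * (2 * Real.pi * s * Q * ((p.1 + P * a) * b + (p.2 + P * b) * a) : ℝ))

theorem norm_exp_sub_I_sub_I (x y z : ℝ) :
    ‖Complex.exp (-(x : ℝ) - Complex.I * (y : ℝ) - Complex.I * (z : ℝ))‖ = Real.exp (-x) := by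
  rw [Complex.norm_exp]
  congr 1
  simp

theorem summable_pairTerm (s : ℝ) {β : ℝ} (hβ : 0 < β) (θ Q P a b : ℝ) :
    Summable (pairTerm s β θ Q P a b) := by
  refine summable_int_prod_of_le (c := Real.pi ^ 2 * β)
    (C := 2 * Real.pi ^ 2 * β * ((P * a) ^ 2 + (P * b) ^ 2)) (by positivity) fun p => ?_
  rw [pairTerm, norm_exp_sub_I_sub_I, Real.exp_le_exp]
  have h1 := sq_half_sub_le p.1 (P * a)
  have h2 := sq_half_sub_le p.2 (P * b)
  have h3 : 0 < 2 * Real.pi ^ 2 * β := by positivity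
  nlinarith [mul_le_mul_of_nonneg_left (add_le_add h1 h2) h3.le]

/-- The theta series for a pair of complementary fluxes. -/
def pairSum (s β θ Q P a b : ℝ) : ℂ := ∑' p, pairTerm s β θ Q P a b p

/-- The summand of the theta series after Poisson summation over the second flux. -/
def mixedTerm (s β θ Q P a b : ℝ) (p : ℤ × ℤ) : ℂ :=
  Complex.exp (-(2 * Real.pi ^ 2 * β * (p.1 + P * a) ^ 2
      + (p.2 + (s * Q * a + θ * s * (p.1 + P * a) / (2 * Real.pi))) ^ 2 / (2 * β) : ℝ)
    - Complex.I * (2 * Real.pi * s * Q * (p.1 + P * a) * b : ℝ)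
    - Complex.I * (-2 * Real.pi * p.2 * (P * b) : ℝ))

theorem summable_mixedTerm (s : ℝ) {β : ℝ} (hβ : 0 < β) (θ Q P a b : ℝ) :
    Summable (mixedTerm s β θ Q P a b) := by
  -- The real exponent is a positive definite form q in the shifted variables, with x² + y² ≤ K q.
  -- The constant K collects x² ≤ q/(2π²β), (y + tx)² ≤ 2βq and y² ≤ 2(y + tx)² + 2t²x².
  set t := θ * s / (2 * Real.pi) with ht
  set K := 1 / (2 * Real.pi ^ 2 * β) + (4 * β + 2 * t ^ 2 / (2 * Real.pi ^ 2 * β)) with hK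
  have hKpos : 0 < K := by positivity
  refine summable_int_prod_of_le (c := 1 / (2 * K))
    (C := ((P * a) ^ 2 + (s * Q * a) ^ 2) / K) (by positivity) fun p => ?_
  rw [mixedTerm, norm_exp_sub_I_sub_I, Real.exp_le_exp]
  set x := (p.1 : ℝ) + P * a with hx
  set y := (p.2 : ℝ) + s * Q * a with hy
  have hz : (p.2 : ℝ) + (s * Q * a + θ * s * x / (2 * Real.pi)) = y + t * x := by
    rw [hy, ht]; ring
  rw [hz]
  set q := 2 * Real.pi ^ 2 * β * x ^ 2 + (y + t * x) ^ 2 / (2 * β) with hq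
  have h1 : x ^ 2 ≤ 1 / (2 * Real.pi ^ 2 * β) * q := by
    rw [hq, div_mul_eq_mul_div, le_div_iff₀ (by positivity)]
    have : 0 ≤ (y + t * x) ^ 2 / (2 * β) := by positivity
    linarith
  have h2 : (y + t * x) ^ 2 ≤ 2 * β * q := by
    rw [← div_le_iff₀' (by positivity), hq]
    have : 0 ≤ 2 * Real.pi ^ 2 * β * x ^ 2 := by positivity
    linarith
  have h3 : y ^ 2 ≤ 2 * (y + t * x) ^ 2 + 2 * t ^ 2 * x ^ 2 := by
    nlinarith [sq_nonneg (y + 2 * t * x)]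
  have h4 : x ^ 2 + y ^ 2 ≤ K * q := by
    have : 2 * t ^ 2 * x ^ 2 ≤ 2 * t ^ 2 * (1 / (2 * Real.pi ^ 2 * β) * q) :=
      mul_le_mul_of_nonneg_left h1 (by positivity)
    have e : K * q = 1 / (2 * Real.pi ^ 2 * β) * q + (2 * (2 * β * q)
        + 2 * t ^ 2 * (1 / (2 * Real.pi ^ 2 * β) * q)) := by rw [hK]; ring
    rw [e]
    linarith
  have h5 := sq_half_sub_le p.1 (P * a)
  have h6 := sq_half_sub_le p.2 (s * Q * a)
  have h7 : ((p.1 : ℝ) ^ 2 + (p.2 : ℝ) ^ 2) / 2 - ((P * a) ^ 2 + (s * Q * a) ^ 2) ≤ K * q := by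
    linarith
  have h8 : (((p.1 : ℝ) ^ 2 + (p.2 : ℝ) ^ 2) / 2 - ((P * a) ^ 2 + (s * Q * a) ^ 2)) / K ≤ q := by
    rwa [div_le_iff₀' hKpos]
  have h9 : (((p.1 : ℝ) ^ 2 + (p.2 : ℝ) ^ 2) / 2 - ((P * a) ^ 2 + (s * Q * a) ^ 2)) / K
      = 1 / (2 * K) * ((p.1 : ℝ) ^ 2 + (p.2 : ℝ) ^ 2)
        - ((P * a) ^ 2 + (s * Q * a) ^ 2) / K := by
    field_simp
  linarith

/-- For a fixed first flux the θ-term is linear in the second. Poisson summation in the second flux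
alone turns this phase into a shift inside a real Gaussian. -/
theorem pairSum_eq_mixed (s : ℝ) {β : ℝ} (hβ : 0 < β) (θ Q P a b : ℝ) :
    pairSum s β θ Q P a b =
      1 / ((2 * Real.pi * β : ℝ) : ℂ) ^ (1 / 2 : ℂ) * ∑' p, mixedTerm s β θ Q P a b p := by
  have hpi : (Real.pi : ℂ) ≠ 0 := Complex.ofReal_ne_zero.2 Real.pi_ne_zero
  have hβ' : (β : ℂ) ≠ 0 := Complex.ofReal_ne_zero.2 hβ.ne'
  rw [pairSum, (summable_pairTerm s hβ θ Q P a b).tsum_prod,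
    (summable_mixedTerm s hβ θ Q P a b).tsum_prod, ← tsum_mul_left]
  refine tsum_congr fun m => ?_
  have h := tsum_exp_shifted (a := 2 * Real.pi * β) (by positivity) (P * b : ℝ)
    (s * Q * a + θ * s * (m + P * a) / (2 * Real.pi) : ℝ)
  set E : ℂ := Complex.exp (-(2 * Real.pi ^ 2 * β * (m + P * a) ^ 2 : ℝ)
    - Complex.I * (2 * Real.pi * s * Q * (m + P * a) * b : ℝ)) with hE
  have h1 : ∀ n : ℤ, pairTerm s β θ Q P a b (m, n) = E *
      Complex.exp (-Real.pi * (2 * Real.pi * β : ℝ) * (n + (P * b : ℝ)) ^ 2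
        - 2 * Real.pi * Complex.I * (s * Q * a + θ * s * (m + P * a) / (2 * Real.pi) : ℝ)
          * (n + (P * b : ℝ))) := by
    intro n
    rw [hE, ← Complex.exp_add, pairTerm]
    congr 1
    push_cast
    field_simp
    ring
  have h2 : ∀ k : ℤ, mixedTerm s β θ Q P a b (m, k) = E *
      Complex.exp (-Real.pi / (2 * Real.pi * β : ℝ) *
        (k + (s * Q * a + θ * s * (m + P * a) / (2 * Real.pi) : ℝ)) ^ 2
        + 2 * Real.pi * Complex.I * k * (P * b : ℝ)) := by
    intro k
    rw [hE, ← Complex.exp_add, mixedTerm]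
    congr 1
    push_cast
    field_simp
    ring
  simp only [h1, h2, tsum_mul_left]
  rw [h]
  ring

/-- With zero charges and shifts, one Poisson summation leaves no phase at all: the series has
positive terms. -/
theorem pairSum_zero_ne_zero (s : ℝ) {β : ℝ} (hβ : 0 < β) (θ : ℝ) :
    pairSum s β θ 0 0 0 0 ≠ 0 := by
  rw [pairSum_eq_mixed s hβ]
  refine mul_ne_zero ?_ ?_
  · refine one_div_ne_zero ?_
    rw [Complex.cpow_ne_zero_iff]
    left
    exact Complex.ofReal_ne_zero.2 (by positivity)
  · have hs := summable_mixedTerm s hβ θ 0 0 0 0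
    have h1 : ∀ p : ℤ × ℤ, mixedTerm s β θ 0 0 0 0 p
        = ((Real.exp (-(2 * Real.pi ^ 2 * β * (p.1 : ℝ) ^ 2
          + (p.2 + θ * s * p.1 / (2 * Real.pi)) ^ 2 / (2 * β))) : ℝ) : ℂ) := by
      intro p
      rw [mixedTerm, Complex.ofReal_exp]
      congr 1
      push_cast
      ring
    have h2 : Summable fun p : ℤ × ℤ => Real.exp (-(2 * Real.pi ^ 2 * β * (p.1 : ℝ) ^ 2
        + (p.2 + θ * s * p.1 / (2 * Real.pi)) ^ 2 / (2 * β))) := by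
      simp only [funext h1] at hs
      exact Complex.summable_ofReal.1 hs
    simp only [h1]
    rw [← Complex.ofReal_tsum, Complex.ofReal_ne_zero]
    exact (h2.tsum_pos (fun p => (Real.exp_pos _).le) (0, 0) (Real.exp_pos _)).ne'

end Poisson

/-! ### Poisson duality of the theta series over all fluxes -/

section Duality

/-- The common denominator of the dual couplings. -/
def couplingNorm (β θ : ℝ) : ℝ := (2 * Real.pi * β) ^ 2 + (θ / (2 * Real.pi)) ^ 2

theorem couplingNorm_pos {β : ℝ} (hβ : 0 < β) (θ : ℝ) : 0 < couplingNorm β θ := by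
  rw [couplingNorm]; positivity

theorem betaDual_eq (β θ : ℝ) : betaDual β θ = β / couplingNorm β θ := rfl

theorem thetaDual_eq (β θ : ℝ) : thetaDual β θ = -θ / couplingNorm β θ := rfl

theorem betaDual_pos {β : ℝ} (hβ : 0 < β) (θ : ℝ) : 0 < betaDual β θ :=
  div_pos hβ (couplingNorm_pos hβ θ)

open Complex in
-- Collects the Gaussian exponents after both summations. The cross term of the square yields the
-- dual angle, and the dual coupling appears in front of both squares.
theorem dual_exponent {β : ℝ} (hβ : 0 < β) (θ : ℝ) {s : ℝ} (hs : s ^ 2 = 1) (y z : ℂ) :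
    -(2 * Real.pi ^ 2 * β / couplingNorm β θ) *
        (z - I * (θ * s / (4 * Real.pi ^ 2 * β)) * y) ^ 2 - y ^ 2 / (2 * β) =
      -(2 * Real.pi ^ 2 * betaDual β θ * (y ^ 2 + z ^ 2)) - I * (thetaDual β θ * s * (y * z)) := by
  have hpi : (Real.pi : ℂ) ≠ 0 := ofReal_ne_zero.2 Real.pi_ne_zero
  have hβ' : (β : ℂ) ≠ 0 := ofReal_ne_zero.2 hβ.ne'
  have hD : (couplingNorm β θ : ℂ) ≠ 0 := ofReal_ne_zero.2 (couplingNorm_pos hβ θ).ne'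
  have hD' : (couplingNorm β θ : ℂ) = (2 * Real.pi * β) ^ 2 + (θ / (2 * Real.pi)) ^ 2 := by
    rw [couplingNorm]; push_cast; ring
  have hs' : (s : ℂ) ^ 2 = 1 := by exact_mod_cast hs
  have h1 : (z - I * (θ * s / (4 * Real.pi ^ 2 * β)) * y) ^ 2
      = z ^ 2 - I * (θ * s / (2 * Real.pi ^ 2 * β)) * (y * z)
        - θ ^ 2 / (4 * Real.pi ^ 2 * β) ^ 2 * y ^ 2 := by
    have : (I * (θ * s / (4 * Real.pi ^ 2 * β)) * y) ^ 2
        = -(θ ^ 2 / (4 * Real.pi ^ 2 * β) ^ 2 * y ^ 2) := by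
      rw [mul_pow, mul_pow, I_sq, div_pow, mul_pow, hs']
      ring
    rw [sub_sq, this]
    field_simp
    ring
  have h2 : y ^ 2 / (2 * β : ℂ) = (couplingNorm β θ : ℂ) / couplingNorm β θ
      * (y ^ 2 / (2 * β)) := by
    rw [div_self hD, one_mul]
  rw [h1, h2, betaDual_eq, thetaDual_eq]
  push_cast
  rw [← sub_eq_zero]
  have h3 : ∀ A B C E : ℂ, A / (couplingNorm β θ : ℂ) + B / couplingNorm β θ
      + C / couplingNorm β θ + E / couplingNorm β θ = (A + B + C + E) / couplingNorm β θ := by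
    intros; ring
  -- The coefficient of y²: the one place where the explicit value of `couplingNorm` matters.
  have h4 : (2 * Real.pi ^ 2 * β) * (θ ^ 2 / (4 * Real.pi ^ 2 * β) ^ 2 * y ^ 2)
      - (couplingNorm β θ : ℂ) * (y ^ 2 / (2 * β)) + 2 * Real.pi ^ 2 * β * y ^ 2 = 0 := by
    rw [hD']
    field_simp
    ring
  have h5 : (2 * Real.pi ^ 2 * β) * (θ * s / (2 * Real.pi ^ 2 * β)) = (θ * s : ℂ) := by
    field_simp
  linear_combination (1 / (couplingNorm β θ : ℂ)) * h4
    + (I * (y * z) / (couplingNorm β θ : ℂ)) * h5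

/-- Poisson summation over both fluxes. -/
theorem pairSum_dual {s : ℤ} (hs : s * s = 1) {β : ℝ} (hβ : 0 < β) (θ Q P a b : ℝ) :
    pairSum s β θ Q P a b =
      1 / ((2 * Real.pi * β : ℝ) : ℂ) ^ (1 / 2 : ℂ) *
        (1 / ((couplingNorm β θ / (2 * Real.pi * β) : ℝ) : ℂ) ^ (1 / 2 : ℂ)) *
        Complex.exp (-(Complex.I * (4 * Real.pi * s * Q * P * a * b : ℝ))) *
        pairSum s (betaDual β θ) (thetaDual β θ) P (-Q) a b := by
  have hpi : (Real.pi : ℂ) ≠ 0 := Complex.ofReal_ne_zero.2 Real.pi_ne_zero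
  have hβ' : (β : ℂ) ≠ 0 := Complex.ofReal_ne_zero.2 hβ.ne'
  have hD := couplingNorm_pos hβ θ
  have hD' : (couplingNorm β θ : ℂ) ≠ 0 := Complex.ofReal_ne_zero.2 hD.ne'
  have hsr : (s : ℝ) ^ 2 = 1 := by rw [sq]; exact_mod_cast hs
  have hsc : (s : ℂ) ^ 2 = 1 := by exact_mod_cast hsr
  rw [pairSum_eq_mixed s hβ]
  suffices hsuff : ∑' p, mixedTerm s β θ Q P a b p =
      1 / ((couplingNorm β θ / (2 * Real.pi * β) : ℝ) : ℂ) ^ (1 / 2 : ℂ) *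
        (Complex.exp (-(Complex.I * (4 * Real.pi * s * Q * P * a * b : ℝ))) *
        pairSum s (betaDual β θ) (thetaDual β θ) P (-Q) a b) by
    rw [hsuff]; ring
  -- The variable conjugate to the second flux is shifted by sQa. Up to the sign -s it is therefore
  -- the first dual flux, whose shift is -Qa; hence the reindexing, and the exchange of the two sums
  -- below.
  let e : ℤ ≃ ℤ := ⟨fun k => -s * k, fun k => -s * k,
    fun k => by linear_combination k * hs, fun k => by linear_combination k * hs⟩
  have hsw : Summable fun c : ℤ × ℤ => mixedTerm s β θ Q P a b (Equiv.prodComm ℤ ℤ c) :=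
    (Equiv.prodComm ℤ ℤ).summable_iff.2 (summable_mixedTerm s hβ θ Q P a b)
  rw [← (Equiv.prodComm ℤ ℤ).tsum_eq, hsw.tsum_prod, ← e.tsum_eq, pairSum,
    (summable_pairTerm s (betaDual_pos hβ θ) (thetaDual β θ) P (-Q) a b).tsum_prod,
    ← tsum_mul_left, ← tsum_mul_left]
  refine tsum_congr fun k => ?_
  set y : ℝ := (e k : ℤ) + s * Q * a with hy
  have hek : ((e k : ℤ) : ℝ) = -s * k := by simp [e]
  have h := tsum_exp_shifted (a := couplingNorm β θ / (2 * Real.pi * β)) (by positivity)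
    (P * a : ℝ) (s * Q * b - Complex.I * (θ * s / (4 * Real.pi ^ 2 * β)) * y)
  set E : ℂ := Complex.exp (-(y ^ 2 / (2 * β) : ℝ)
    + Complex.I * (2 * Real.pi * (e k) * (P * b) : ℝ)) with hE
  have h1 : ∀ m : ℤ, mixedTerm s β θ Q P a b (m, e k) = E *
      Complex.exp (-Real.pi * (couplingNorm β θ / (2 * Real.pi * β) : ℝ) * (m + (P * a : ℝ)) ^ 2
        - 2 * Real.pi * Complex.I *
          (s * Q * b - Complex.I * (θ * s / (4 * Real.pi ^ 2 * β)) * y)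
          * (m + (P * a : ℝ))) := by
    intro m
    rw [hE, ← Complex.exp_add, mixedTerm]
    congr 1
    have : (e k : ℝ) + (s * Q * a + θ * s * (m + P * a) / (2 * Real.pi))
        = y + θ * s * (m + P * a) / (2 * Real.pi) := by rw [hy]; ring
    simp only [this]
    generalize y = y
    rw [couplingNorm]
    push_cast
    field_simp
    linear_combination (-4 * θ ^ 2 * (m + P * a) ^ 2 : ℂ) * hsc
      - (16 * Real.pi * y * (m + P * a) * θ * s : ℂ) * Complex.I_sq
  have h2 : ∀ j : ℤ, Complex.exp (-(Complex.I * (4 * Real.pi * s * Q * P * a * b : ℝ))) *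
      pairTerm s (betaDual β θ) (thetaDual β θ) P (-Q) a b (k, j) = E *
      Complex.exp (-Real.pi / (couplingNorm β θ / (2 * Real.pi * β) : ℝ) *
        ((e j : ℤ) + (s * Q * b - Complex.I * (θ * s / (4 * Real.pi ^ 2 * β)) * y)) ^ 2
        + 2 * Real.pi * Complex.I * (e j : ℤ) * (P * a : ℝ)) := by
    intro j
    have hej : ((e j : ℤ) : ℝ) = -s * j := by simp [e]
    have hejc : ((e j : ℤ) : ℂ) = -s * j := by simp [e]
    have hekc : ((e k : ℤ) : ℂ) = -s * k := by simp [e]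
    have hyk : (y : ℂ) = -s * (k - Q * a) := by
      rw [hy]; push_cast; rw [hekc]; ring
    have hz : ((e j : ℤ) : ℂ) + (s * Q * b - Complex.I * (θ * s / (4 * Real.pi ^ 2 * β)) * y)
        = -s * (j - Q * b) - Complex.I * (θ * s / (4 * Real.pi ^ 2 * β)) * y := by
      rw [hejc]; ring
    have hc : (-Real.pi / (couplingNorm β θ / (2 * Real.pi * β) : ℝ) : ℂ)
        = -(2 * Real.pi ^ 2 * β / couplingNorm β θ) := by
      push_cast
      field_simp
    have hx := dual_exponent hβ θ hsr y (-s * (j - Q * b))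
    rw [hE, ← Complex.exp_add, pairTerm, ← Complex.exp_add, hz, hc]
    congr 1
    push_cast at hx ⊢
    rw [hejc, hekc]
    have hx' := eq_add_of_sub_eq hx
    rw [hx', hyk]
    linear_combination (2 * Real.pi ^ 2 * betaDual β θ * ((k - Q * a) ^ 2 + (j - Q * b) ^ 2)
      + Complex.I * (thetaDual β θ * s * ((k - Q * a) * (j - Q * b))) : ℂ) * hsc
  rw [← tsum_mul_left (a := Complex.exp _)]
  simp only [h2]
  have h3 : ∀ m : ℤ, mixedTerm s β θ Q P a b (Equiv.prodComm ℤ ℤ (e k, m))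
      = mixedTerm s β θ Q P a b (m, e k) := fun m => rfl
  simp only [h3, h1, tsum_mul_left]
  rw [h, ← e.tsum_eq]
  ring

/-- The six fluxes, grouped in complementary pairs. -/
def fluxEquiv (X : Type*) : (Dirs 2 → X) ≃ (X × X) × ((X × X) × (X × X)) where
  toFun m := ((m dir01, m dir23), ((m dir02, m dir13), (m dir03, m dir12)))
  invFun p I := if I = dir01 then p.1.1 else if I = dir23 then p.1.2 else
    if I = dir02 then p.2.1.1 else if I = dir13 then p.2.1.2 else
    if I = dir03 then p.2.2.1 else p.2.2.2
  left_inv m := by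
    funext I
    rcases dirs_two_cases I with rfl | rfl | rfl | rfl | rfl | rfl <;> simp (decide := true)
  right_inv p := by
    simp (decide := true)

theorem wedge_eq {R : Type} [CommRing R] (a b : Dirs 2 → R) :
    wedge a b = (a dir01 * b dir23 + a dir23 * b dir01) - (a dir02 * b dir13 + a dir13 * b dir02)
      + (a dir03 * b dir12 + a dir12 * b dir03) := by
  rw [wedge, sum_dirs_two]
  rw [complDirs_eq (I := dir01) (J := dir23) (by decide),
    complDirs_eq (I := dir02) (J := dir13) (by decide),
    complDirs_eq (I := dir03) (J := dir12) (by decide),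
    complDirs_eq (I := dir12) (J := dir03) (by decide),
    complDirs_eq (I := dir13) (J := dir02) (by decide),
    complDirs_eq (I := dir23) (J := dir01) (by decide)]
  simp (decide := true) [shuffleSign]
  ring

/-- The fluxes of `n = m + P η`. -/
def shiftedFlux (P : ℝ) (η : Dirs 2 → ℝ) (m : Dirs 2 → ℤ) : Dirs 2 → ℝ := fun I => m I + P * η I

/-- A summand of the theta series over all fluxes. -/
def fluxTerm (β θ Q P : ℝ) (η : Dirs 2 → ℝ) (m : Dirs 2 → ℤ) : ℂ :=
  Complex.exp (-(2 * Real.pi ^ 2 * β *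
        ∑ I, shiftedFlux P η m I * shiftedFlux P η m I : ℝ)
    - Complex.I * (θ / 2 * wedge (shiftedFlux P η m) (shiftedFlux P η m) : ℝ)
    - Complex.I * (2 * Real.pi * Q * wedge (shiftedFlux P η m) η : ℝ))

/-- The theta series over all fluxes. -/
def fluxSum (β θ Q P : ℝ) (η : Dirs 2 → ℝ) : ℂ := ∑' m, fluxTerm β θ Q P η m

theorem fluxTerm_eq (β θ Q P : ℝ) (η : Dirs 2 → ℝ) (m : Dirs 2 → ℤ) :
    fluxTerm β θ Q P η m = pairTerm 1 β θ Q P (η dir01) (η dir23) (m dir01, m dir23) *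
      (pairTerm (-1) β θ Q P (η dir02) (η dir13) (m dir02, m dir13) *
        pairTerm 1 β θ Q P (η dir03) (η dir12) (m dir03, m dir12)) := by
  simp only [fluxTerm, pairTerm, ← Complex.exp_add, wedge_eq, sum_dirs_two, shiftedFlux]
  congr 1
  push_cast
  ring

/-- The wedge form is an orthogonal sum of three hyperbolic planes with signs 1, -1, 1, so the
absolutely convergent series factorizes. -/
theorem fluxSum_eq {β : ℝ} (hβ : 0 < β) (θ Q P : ℝ) (η : Dirs 2 → ℝ) :
    fluxSum β θ Q P η = pairSum 1 β θ Q P (η dir01) (η dir23) *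
      (pairSum (-1) β θ Q P (η dir02) (η dir13) * pairSum 1 β θ Q P (η dir03) (η dir12)) := by
  have h1 := (summable_pairTerm 1 hβ θ Q P (η dir01) (η dir23)).norm
  have h2 := (summable_pairTerm (-1) hβ θ Q P (η dir02) (η dir13)).norm
  have h3 := (summable_pairTerm 1 hβ θ Q P (η dir03) (η dir12)).norm
  simp only [pairSum]
  rw [tsum_mul_tsum_of_summable_norm h2 h3, tsum_mul_tsum_of_summable_norm h1 (h2.mul_norm h3),
    ← (fluxEquiv ℤ).tsum_eq, fluxSum]
  exact tsum_congr fun m => fluxTerm_eq β θ Q P η m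

theorem fluxSum_zero_ne_zero {β : ℝ} (hβ : 0 < β) (θ : ℝ) : fluxSum β θ 0 0 0 ≠ 0 := by
  rw [fluxSum_eq hβ]
  exact mul_ne_zero (pairSum_zero_ne_zero _ hβ θ)
    (mul_ne_zero (pairSum_zero_ne_zero _ hβ θ) (pairSum_zero_ne_zero _ hβ θ))

/-- Poisson summation over all fluxes. -/
theorem exists_fluxSum_dual {β : ℝ} (hβ : 0 < β) (θ : ℝ) :
    ∃ C : ℂ, ∀ (Q P : ℝ) (η : Dirs 2 → ℝ), fluxSum β θ Q P η =
      C * Complex.exp (-(Complex.I * (2 * Real.pi * Q * P * wedge η η : ℝ))) *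
        fluxSum (betaDual β θ) (thetaDual β θ) P (-Q) η := by
  -- The prefactor of `pairSum_dual` is the same for all three pairs and independent of charges and
  -- fluxes, which is why it can be chosen before them.
  refine ⟨(1 / ((2 * Real.pi * β : ℝ) : ℂ) ^ (1 / 2 : ℂ) *
        (1 / ((couplingNorm β θ / (2 * Real.pi * β) : ℝ) : ℂ) ^ (1 / 2 : ℂ))) ^ 3,
    fun Q P η => ?_⟩
  have e1 := pairSum_dual (s := 1) (by norm_num) hβ θ Q P (η dir01) (η dir23)
  have e2 := pairSum_dual (s := -1) (by norm_num) hβ θ Q P (η dir02) (η dir13)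
  have e3 := pairSum_dual (s := 1) (by norm_num) hβ θ Q P (η dir03) (η dir12)
  simp only [Int.cast_one, Int.cast_neg] at e1 e2 e3
  rw [fluxSum_eq hβ, fluxSum_eq (betaDual_pos hβ θ), e1, e2, e3]
  have h : Complex.exp (-(Complex.I * (2 * Real.pi * Q * P * wedge η η : ℝ)))
      = Complex.exp (-(Complex.I * (4 * Real.pi * 1 * Q * P * η dir01 * η dir23 : ℝ))) *
        Complex.exp (-(Complex.I * (4 * Real.pi * -1 * Q * P * η dir02 * η dir13 : ℝ))) *
        Complex.exp (-(Complex.I * (4 * Real.pi * 1 * Q * P * η dir03 * η dir12 : ℝ))) := by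
    rw [← Complex.exp_add, ← Complex.exp_add, wedge_eq]
    congr 1
    push_cast
    ring
  rw [h]
  ring

end Duality

/-! ### Gaussian Fourier transform for an invariant measure -/

section Haar

variable {V : Type*} [NormedAddCommGroup V] [InnerProductSpace ℝ V] [FiniteDimensional ℝ V]
  [MeasurableSpace V] [BorelSpace V]

/-- The Fourier transform of a Gaussian with respect to a translation invariant measure. -/
theorem exists_integral_gauss (μ : Measure V) [μ.IsAddLeftInvariant] [IsFiniteMeasureOnCompacts μ]
    (hμ : μ ≠ 0) {β : ℝ} (hβ : 0 < β) :
    ∃ C : ℂ, C ≠ 0 ∧ ∀ (κ : ℝ) (j : V),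
      ∫ v, Complex.exp (-(β / 2 * ‖v‖ ^ 2 : ℝ) - Complex.I * (κ * inner ℝ v j : ℝ)) ∂μ =
        C * Complex.exp (-(κ ^ 2 / (2 * β) * ‖j‖ ^ 2 : ℝ)) := by
  -- Uniqueness of Haar measure leaves only a scale unknown, and the scale is nonzero because μ is.
  have hs := μ.isAddLeftInvariant_eq_smul (volume : Measure V)
  set s := μ.addHaarScalarFactor (volume : Measure V) with hsdef
  have hs0 : s ≠ 0 := by
    intro h
    rw [h, zero_smul] at hs
    exact hμ hs
  have hpi : (Real.pi : ℂ) ≠ 0 := Complex.ofReal_ne_zero.2 Real.pi_ne_zero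
  have hβ' : (β : ℂ) ≠ 0 := Complex.ofReal_ne_zero.2 hβ.ne'
  refine ⟨(s : ℝ) * (Real.pi / (β / 2 : ℝ)) ^ (Module.finrank ℝ V / 2 : ℂ), ?_, fun κ j => ?_⟩
  · refine mul_ne_zero (by exact_mod_cast hs0) ?_
    have hb : (Real.pi / (β / 2 : ℝ) : ℂ) ≠ 0 :=
      div_ne_zero hpi (Complex.ofReal_ne_zero.2 (by positivity))
    rw [Complex.cpow_def_of_ne_zero hb]
    exact Complex.exp_ne_zero _
  · have h := GaussianFourier.integral_cexp_neg_mul_sq_norm_add (V := V) (b := (β / 2 : ℝ))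
      (by simpa using hβ) (-(Complex.I * κ)) j
    rw [hs, integral_smul_nnreal_measure]
    have h1 : ∀ v : V, Complex.exp (-(β / 2 * ‖v‖ ^ 2 : ℝ) - Complex.I * (κ * inner ℝ v j : ℝ))
        = Complex.exp (-((β / 2 : ℝ) : ℂ) * ‖v‖ ^ 2 + -(Complex.I * κ) * (inner ℝ j v : ℝ)) := by
      intro v
      rw [real_inner_comm]
      congr 1
      push_cast
      ring
    simp only [h1]
    rw [h, NNReal.smul_def, Complex.real_smul, mul_assoc]
    congr 3
    push_cast
    rw [neg_sq, mul_pow, Complex.I_sq]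
    field_simp
    ring

end Haar

/-! ### The translation invariant measure on exact forms -/

section ExactForms

variable {N : ℕ} [NeZero N] {Λ : LatticeKind}

/-- The space of the exact real `2`-forms. -/
def exactSpace (N : ℕ) [NeZero N] (Λ : LatticeKind) :
    Submodule ℝ (EuclideanSpace ℝ (Cell N Λ 2)) :=
  LinearMap.range ((WithLp.linearEquiv 2 ℝ (Form N Λ 2 ℝ)).symm.toLinearMap ∘ₗ latDHom N Λ 1 ℝ)

/-- The exterior derivative as a map onto the exact forms. -/
def exactMap (N : ℕ) [NeZero N] (Λ : LatticeKind) : Form N Λ 1 ℝ →ₗ[ℝ] exactSpace N Λ :=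
  LinearMap.rangeRestrict _

theorem exactMap_apply (A : Form N Λ 1 ℝ) :
    ((exactMap N Λ A : exactSpace N Λ) : EuclideanSpace ℝ (Cell N Λ 2)) =
      WithLp.toLp 2 (latD A) := rfl

theorem exactMap_surjective : Function.Surjective (exactMap N Λ) :=
  LinearMap.surjective_rangeRestrict _

theorem measurable_exactMap : Measurable (exactMap N Λ) :=
  (LinearMap.continuous_of_finiteDimensional _).measurable

theorem inner_toLp (α β : Form N Λ 2 ℝ) :
    inner ℝ (WithLp.toLp 2 α : EuclideanSpace ℝ (Cell N Λ 2)) (WithLp.toLp 2 β) =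
      dotForm α β := by
  rw [PiLp.inner_apply]
  exact Finset.sum_congr rfl fun c _ => mul_comm _ _

/-- The integer `2`-forms that are exact as real forms. -/
def exactInt (N : ℕ) [NeZero N] (Λ : LatticeKind) : AddSubgroup (Form N Λ 2 ℤ) where
  carrier := {n | ∃ A : Form N Λ 1 ℝ, realForm n = latD A}
  zero_mem' := ⟨0, by
    rw [show latD (0 : Form N Λ 1 ℝ) = 0 from map_zero (latDHom N Λ 1 ℝ)]
    funext c; simp [realForm]⟩
  add_mem' := by
    rintro a b ⟨A, hA⟩ ⟨B, hB⟩
    exact ⟨A + B, by rw [realForm_add, hA, hB]; exact (map_add (latDHom N Λ 1 ℝ) A B).symm⟩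
  neg_mem' := by
    rintro a ⟨A, hA⟩
    exact ⟨-A, by rw [realForm_neg, hA]; exact (map_neg (latDHom N Λ 1 ℝ) A).symm⟩

theorem latD_mem_exactInt (k : Form N Λ 1 ℤ) : latD k ∈ exactInt N Λ :=
  ⟨realForm k, (realForm_latD k).symm⟩

/-- A potential of an exact integer form. -/
def potential (n : exactInt N Λ) : Form N Λ 1 ℝ := n.2.choose

theorem realForm_eq_latD_potential (n : exactInt N Λ) :
    realForm (n : Form N Λ 2 ℤ) = latD (potential n) := n.2.choose_spec

/-- The exact part of a field strength. -/
def exactField (n : exactInt N Λ) (A : Form N Λ 1 ℝ) : exactSpace N Λ :=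
  exactMap N Λ (A + (2 * Real.pi) • potential n)

theorem exactField_apply (n : exactInt N Λ) (A : Form N Λ 1 ℝ) :
    ((exactField n A : exactSpace N Λ) : EuclideanSpace ℝ (Cell N Λ 2)) =
      WithLp.toLp 2 (fieldStrength A n) := by
  rw [exactField, exactMap_apply, fieldStrength, realForm_eq_latD_potential]
  congr 1
  change latDHom N Λ 1 ℝ _ = latDHom N Λ 1 ℝ _ + _ • latDHom N Λ 1 ℝ _
  rw [map_add, map_smul]

theorem measurable_exactField (n : exactInt N Λ) : Measurable (exactField n) :=
  measurable_exactMap.comp (measurable_id.add_const _)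

theorem exactField_add (n : exactInt N Λ) (A B : Form N Λ 1 ℝ) :
    exactField n (A + B) = exactMap N Λ B + exactField n A := by
  rw [exactField, exactField, ← map_add]
  congr 1
  abel

/-- The distribution of the exact fields. -/
def exactMeasure (N : ℕ) [NeZero N] (Λ : LatticeKind) : Measure (exactSpace N Λ) :=
  Measure.sum fun n : exactInt N Λ => (gaugeMeasure N Λ 1).map (exactField n)

theorem lintegral_exactMeasure {f : exactSpace N Λ → ENNReal} (hf : Measurable f) :
    ∫⁻ E, f E ∂(exactMeasure N Λ) =
      ∫⁻ A, ∑' n : exactInt N Λ, f (exactField n A) ∂(gaugeMeasure N Λ 1) := by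
  have h := lintegral_tsum (μ := gaugeMeasure N Λ 1) (f := fun n A => f (exactField n A))
    fun n : exactInt N Λ => (hf.comp (measurable_exactField n)).aemeasurable
  rw [exactMeasure, lintegral_sum_measure, h]
  exact tsum_congr fun n => lintegral_map hf (measurable_exactField n)

/-- A large gauge shift of A by 2πk is absorbed into n as dk; summed over n, functions of the exact
field become periodic in A. -/
theorem exactField_add_two_pi (n : exactInt N Λ) (A : Form N Λ 1 ℝ) (k : Form N Λ 1 ℤ) :
    exactField n (fun c => A c + 2 * Real.pi * k c) =
      exactField (n + ⟨latD k, latD_mem_exactInt k⟩) A := by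
  apply Subtype.ext
  rw [exactField_apply, exactField_apply]
  congr 1
  have h1 : (fun c => A c + 2 * Real.pi * k c) = A + (2 * Real.pi) • realForm k := rfl
  have h2 : latD (A + (2 * Real.pi) • realForm k) = latD A + (2 * Real.pi) • latD (realForm k) := by
    change latDHom N Λ 1 ℝ _ = latDHom N Λ 1 ℝ _ + _ • latDHom N Λ 1 ℝ _
    rw [map_add, map_smul]
  rw [fieldStrength, fieldStrength, h1, h2, AddSubgroup.coe_add, realForm_add, realForm_latD,
    smul_add]
  abel

/-- Translating by dB amounts to replacing A by A + B. After the sum over n the integrand is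
periodic in A, and the torus measure does not see B. Lower integrals avoid any integrability
condition. -/
instance : (exactMeasure N Λ).IsAddLeftInvariant := by
  refine ⟨fun e => ?_⟩
  obtain ⟨B, rfl⟩ := exactMap_surjective e
  refine Measure.ext_of_lintegral _ fun f hf => ?_
  have h := lintegral_exactMeasure (hf.comp (measurable_const_add (exactMap N Λ B)))
  simp only [Function.comp_def, ← exactField_add] at h
  rw [lintegral_map hf (measurable_const_add _), h, lintegral_exactMeasure hf]
  exact lintegral_add_of_periodic
    (Ψ := fun A => ∑' n : exactInt N Λ, f (exactField n A))
    (Measurable.tsum fun n => hf.comp (measurable_exactField n))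
    (fun A k => by
      simp only [exactField_add_two_pi]
      exact (Equiv.addRight (⟨latD k, latD_mem_exactInt k⟩ : exactInt N Λ)).tsum_eq
        fun n => f (exactField n A)) B

theorem exactMeasure_ne_zero : exactMeasure N Λ ≠ 0 := by
  intro h
  have h1 : exactMeasure N Λ Set.univ = 0 := by rw [h]; rfl
  rw [exactMeasure, Measure.sum_apply _ MeasurableSet.univ, ENNReal.tsum_eq_zero] at h1
  have h2 := h1 0
  rw [Measure.map_apply (measurable_exactField 0) MeasurableSet.univ] at h2
  simp at h2

end ExactForms

/-! ### Uniform bounds and the Gaussian integral over exact fields -/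

section Bounds

variable {N : ℕ} [NeZero N] {Λ : LatticeKind}

theorem ae_abs_le_pi (r : ℕ) : ∀ᵐ A ∂(gaugeMeasure N Λ r), ∀ c, |A c| ≤ Real.pi := by
  rw [gaugeMeasure_eq, ae_all_iff]
  intro c
  have h : ∀ᵐ a ∂angleMeasure, |a| ≤ Real.pi := by
    rw [angleMeasure]
    refine Measure.ae_smul_measure ?_ _
    rw [ae_restrict_iff' measurableSet_Ico]
    exact Filter.Eventually.of_forall fun a ha => abs_le.2 ⟨ha.1, ha.2.le⟩
  exact (measurePreserving_eval (fun _ : Cell N Λ r => angleMeasure) c).quasiMeasurePreserving.ae h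

theorem continuous_latD {r : ℕ} : Continuous (latD : Form N Λ r ℝ → Form N Λ (r + 1) ℝ) :=
  (latDHom N Λ r ℝ).continuous_of_finiteDimensional

theorem exists_dotForm_le (b : Form N Λ 2 ℝ) : ∃ C, ∀ A : Form N Λ 1 ℝ, (∀ c, |A c| ≤ Real.pi) →
    dotForm (latD A + b) (latD A + b) ≤ C := by
  have hcont : Continuous fun A : Form N Λ 1 ℝ => dotForm (latD A + b) (latD A + b) := by
    have h := (continuous_latD (N := N) (Λ := Λ) (r := 1)).add_const b
    simp only [dotForm]
    exact continuous_finsetSum _ fun c _ =>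
      ((continuous_apply c).comp h).mul ((continuous_apply c).comp h)
  obtain ⟨C, hC⟩ := (isCompact_Icc (a := fun _ : Cell N Λ 1 => -Real.pi)
    (b := fun _ => Real.pi)).bddAbove_image hcont.continuousOn
  refine ⟨C, fun A hA => hC ⟨A, ⟨fun c => (abs_le.1 (hA c)).1, fun c => (abs_le.1 (hA c)).2⟩, rfl⟩⟩

/-- Uniform Gaussian bound for the weights. -/
theorem exists_weight_bound {β : ℝ} (hβ : 0 < β) (b : Form N Λ 2 ℝ) :
    ∃ g : Form N Λ 2 ℤ → ℝ, Summable g ∧ ∀ A : Form N Λ 1 ℝ, (∀ c, |A c| ≤ Real.pi) → ∀ n,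
      Real.exp (-(β / 2 * dotForm (fieldStrength A n + b) (fieldStrength A n + b))) ≤ g n := by
  obtain ⟨C, hC⟩ := exists_dotForm_le b
  refine ⟨fun n => Real.exp (β / 2 * C) * Real.exp (-(β * Real.pi ^ 2 * ∑ c, (n c : ℝ) ^ 2)),
    (summable_exp_neg_mul_sum_sq (by positivity)).mul_left _, fun A hA n => ?_⟩
  beta_reduce
  rw [← Real.exp_add, Real.exp_le_exp]
  -- Half of the decay in n survives by (m + u)² ≥ m²/2 - u² with m = 2πn; the remainder is bounded
  -- on the compact box of gauge fields.
  have h1 : 2 * Real.pi ^ 2 * ∑ c, (n c : ℝ) ^ 2 - dotForm (latD A + b) (latD A + b)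
      ≤ dotForm (fieldStrength A n + b) (fieldStrength A n + b) := by
    rw [dotForm, dotForm, Finset.mul_sum, ← Finset.sum_sub_distrib]
    refine Finset.sum_le_sum fun c _ => ?_
    simp only [fieldStrength, realForm, Pi.add_apply, Pi.smul_apply, smul_eq_mul]
    nlinarith [sq_half_sub_le (2 * Real.pi * n c) (latD A c + b c)]
  nlinarith [hC A hA]

theorem norm_sq_exactField (n : exactInt N Λ) (A : Form N Λ 1 ℝ) :
    ‖exactField n A‖ ^ 2 = dotForm (fieldStrength A n) (fieldStrength A n) := by
  rw [← real_inner_self_eq_norm_sq, Submodule.coe_inner, exactField_apply, inner_toLp]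

theorem lintegral_exp_exactMeasure {β : ℝ} (hβ : 0 < β) :
    ∫⁻ E, ENNReal.ofReal (Real.exp (-(β / 2 * ‖E‖ ^ 2))) ∂(exactMeasure N Λ) < ⊤ := by
  have hmeas : Measurable fun E : exactSpace N Λ =>
      ENNReal.ofReal (Real.exp (-(β / 2 * ‖E‖ ^ 2))) := by fun_prop
  obtain ⟨g, hg, hle⟩ := exists_weight_bound (N := N) (Λ := Λ) hβ 0
  rw [lintegral_exactMeasure hmeas]
  have hg0 : ∀ n, 0 ≤ g n := fun n =>
    (Real.exp_pos _).le.trans (hle 0 (fun c => by simpa using Real.pi_pos.le) n)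
  have hgs : Summable fun n : exactInt N Λ => g n := hg.subtype _
  calc ∫⁻ A, ∑' n : exactInt N Λ, ENNReal.ofReal (Real.exp (-(β / 2 * ‖exactField n A‖ ^ 2)))
        ∂(gaugeMeasure N Λ 1)
      ≤ ∫⁻ _, ∑' n : exactInt N Λ, ENNReal.ofReal (g n) ∂(gaugeMeasure N Λ 1) := by
        refine lintegral_mono_ae ?_
        filter_upwards [ae_abs_le_pi (N := N) (Λ := Λ) 1] with A hA
        refine ENNReal.tsum_le_tsum fun n => ENNReal.ofReal_le_ofReal ?_
        rw [norm_sq_exactField]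
        simpa using hle A hA n
    _ = ENNReal.ofReal (∑' n : exactInt N Λ, g n) := by
        rw [lintegral_const, measure_univ, mul_one,
          ENNReal.ofReal_tsum_of_nonneg (f := fun n : exactInt N Λ => g n)
            (fun n => hg0 n) hgs]
    _ < ⊤ := ENNReal.ofReal_lt_top

/-- The Gaussian is bounded below on a compact set and has finite total integral. -/
instance : IsFiniteMeasureOnCompacts (exactMeasure N Λ) := by
  refine ⟨fun K hK => ?_⟩
  obtain ⟨R, hR⟩ := hK.isBounded.exists_norm_le
  have h := lintegral_exp_exactMeasure (N := N) (Λ := Λ) (β := 2) two_pos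
  have hpos : ENNReal.ofReal (Real.exp (-(R ^ 2))) ≠ 0 := by
    simp [Real.exp_pos]
  have hle : ENNReal.ofReal (Real.exp (-(R ^ 2))) * exactMeasure N Λ K < ⊤ := by
    refine lt_of_le_of_lt ?_ h
    rw [← setLIntegral_const]
    refine (setLIntegral_mono' hK.measurableSet fun E hE => ENNReal.ofReal_le_ofReal ?_).trans
      (setLIntegral_le_lintegral _ _)
    rw [Real.exp_le_exp]
    have := pow_le_pow_left₀ (norm_nonneg E) (hR E hE) 2
    linarith
  rw [ENNReal.mul_lt_top_iff] at hle
  rcases hle with h1 | h1 | h1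
  · exact h1.2
  · exact absurd h1 hpos
  · rw [h1]; exact ENNReal.zero_lt_top

/-- A Gaussian weight with a linear phase. -/
def gaussPhase (β κ : ℝ) (j E : Form N Λ 2 ℝ) : ℂ :=
  Complex.exp (-(β / 2 * dotForm E E : ℝ) - Complex.I * (κ * dotForm E j : ℝ))

theorem fieldStrength_add_latD (n : exactInt N Λ) (A B : Form N Λ 1 ℝ) :
    (WithLp.toLp 2 (fieldStrength A n + latD B) : EuclideanSpace ℝ (Cell N Λ 2)) =
      ((exactMap N Λ B + exactField n A : exactSpace N Λ) :
        EuclideanSpace ℝ (Cell N Λ 2)) := by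
  rw [Submodule.coe_add, exactField_apply, exactMap_apply, add_comm]
  rfl

/-- The sum of a Gaussian weight over all exact fields. -/
theorem exists_tsum_integral_gaussPhase {β : ℝ} (hβ : 0 < β) :
    ∃ C : ℂ, C ≠ 0 ∧ ∀ (κ : ℝ) (k B : Form N Λ 1 ℝ),
      ∑' n : exactInt N Λ, ∫ A, gaussPhase β κ (latD k) (fieldStrength A n + latD B)
        ∂(gaugeMeasure N Λ 1) =
      C * Complex.exp (-(κ ^ 2 / (2 * β) * dotForm (latD k) (latD k) : ℝ)) := by
  obtain ⟨C, hC, h⟩ := exists_integral_gauss (exactMeasure N Λ) exactMeasure_ne_zero hβ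
  refine ⟨C, hC, fun κ k B => ?_⟩
  have hk := h κ (exactMap N Λ k)
  set φ : exactSpace N Λ → ℂ := fun v => Complex.exp (-(β / 2 * ‖v‖ ^ 2 : ℝ)
    - Complex.I * (κ * inner ℝ v (exactMap N Λ k) : ℝ)) with hφ
  have hcont : Continuous φ := by fun_prop
  have hφint : Integrable φ (exactMeasure N Λ) := by
    refine ⟨hcont.aestronglyMeasurable, ?_⟩
    rw [hasFiniteIntegral_iff_norm]
    refine lt_of_eq_of_lt (lintegral_congr fun v => ?_) (lintegral_exp_exactMeasure hβ)
    have := norm_exp_sub_I_sub_I (β / 2 * ‖v‖ ^ 2) (κ * inner ℝ v (exactMap N Λ k)) 0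
    simp only [Complex.ofReal_zero, mul_zero, sub_zero] at this
    rw [hφ]
    simp only [this]
  have hsh : Integrable (fun E => φ (exactMap N Λ B + E)) (exactMeasure N Λ) :=
    hφint.comp_add_left _
  -- Translation invariance removes B, and with it the dependence of the exact part on the fluxes.
  have h1 : ∫ E, φ (exactMap N Λ B + E) ∂(exactMeasure N Λ) = ∫ E, φ E ∂(exactMeasure N Λ) :=
    integral_add_left_eq_self _ _
  have h2 : ∫ E, φ (exactMap N Λ B + E) ∂(exactMeasure N Λ) =
      ∑' n : exactInt N Λ, ∫ A, φ (exactMap N Λ B + exactField n A) ∂(gaugeMeasure N Λ 1) := by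
    have h3 := integral_sum_measure hsh
    rw [exactMeasure, h3]
    refine tsum_congr fun n => ?_
    rw [integral_map (measurable_exactField n).aemeasurable]
    exact (hcont.comp (continuous_const.add continuous_id)).aestronglyMeasurable
  have h4 : ∀ (n : exactInt N Λ) (A : Form N Λ 1 ℝ),
      gaussPhase β κ (latD k) (fieldStrength A n + latD B)
        = φ (exactMap N Λ B + exactField n A) := by
    intro n A
    rw [gaussPhase, hφ]
    simp only
    rw [← real_inner_self_eq_norm_sq, Submodule.coe_inner, Submodule.coe_inner,
      ← fieldStrength_add_latD, exactMap_apply, inner_toLp, inner_toLp]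
  simp only [h4]
  rw [← h2, h1, hk, ← real_inner_self_eq_norm_sq, Submodule.coe_inner, exactMap_apply, inner_toLp]

end Bounds


/-! ### The coexact projection, fluxes of the closed part and parity of the Pontryagin square -/

section Projection

variable {N : ℕ} {Λ Λ' : LatticeKind}

theorem span_range_latBdry_le : Submodule.span ℝ (Set.range fun q : Form N Λ 3 ℝ =>
      (WithLp.toLp 2 (latBdry q) : EuclideanSpace ℝ (Cell N Λ 2))) ≤
    LinearMap.range ((WithLp.linearEquiv 2 ℝ (Form N Λ 2 ℝ)).symm.toLinearMap ∘ₗ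
      latBdryHom N Λ 2 ℝ) := by
  rw [Submodule.span_le]
  rintro _ ⟨q, rfl⟩
  exact ⟨q, rfl⟩

variable [NeZero N]

theorem exists_projBdry_eq (α : Form N Λ 2 ℝ) : ∃ q, projBdry α = latBdry q := by
  have h := Submodule.starProjection_apply_mem (Submodule.span ℝ (Set.range fun q : Form N Λ 3 ℝ =>
      (WithLp.toLp 2 (latBdry q) : EuclideanSpace ℝ (Cell N Λ 2)))) (WithLp.toLp 2 α)
  obtain ⟨q, hq⟩ := span_range_latBdry_le h
  exact ⟨q, (congrArg WithLp.ofLp hq).symm⟩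

theorem eq_zero_of_dotForm {r : ℕ} {α : Form N Λ r ℝ} (h : ∀ β, dotForm β α = 0) : α = 0 := by
  have h1 := h α
  rw [dotForm, Finset.sum_eq_zero_iff_of_nonneg fun c _ => mul_self_nonneg _] at h1
  funext c
  exact mul_self_eq_zero.1 (h1 c (Finset.mem_univ c))

theorem latD_sub_projBdry (α : Form N Λ 2 ℝ) : latD (α - projBdry α) = 0 := by
  refine eq_zero_of_dotForm fun q => ?_
  rw [← neg_eq_zero, ← dotForm_latBdry, ← inner_toLp]
  have h := Submodule.sub_starProjection_mem_orthogonal (K := Submodule.span ℝ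
    (Set.range fun q : Form N Λ 3 ℝ =>
      (WithLp.toLp 2 (latBdry q) : EuclideanSpace ℝ (Cell N Λ 2)))) (WithLp.toLp 2 α)
  exact (Submodule.mem_orthogonal _ _).1 h _ (Submodule.subset_span ⟨q, rfl⟩)

/-- The difference of two candidates is both a boundary and closed, hence orthogonal to itself. This
characterization makes the projection commute with translations. -/
theorem projBdry_eq_of_latD {α : Form N Λ 2 ℝ} (q : Form N Λ 3 ℝ)
    (h : latD (α - latBdry q) = 0) : projBdry α = latBdry q := by
  obtain ⟨q', hq'⟩ := exists_projBdry_eq α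
  have h1 := latD_sub_projBdry α
  rw [hq'] at h1 ⊢
  have h2 : latD (latBdry q' - latBdry q) = 0 := by
    have : latBdry q' - latBdry q = (α - latBdry q) - (α - latBdry q') := by abel
    rw [this]
    change latDHom N Λ 2 ℝ _ = 0
    rw [map_sub]
    change latD _ - latD _ = 0
    rw [h, h1, sub_zero]
  have h3 : latBdry (q' - q) = latBdry q' - latBdry q := map_sub (latBdryHom N Λ 2 ℝ) q' q
  have h4 : dotForm (latBdry q' - latBdry q) (latBdry q' - latBdry q) = 0 := by
    nth_rewrite 1 [← h3]
    rw [dotForm_latBdry, h2]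
    simp [dotForm]
  rw [dotForm, Finset.sum_eq_zero_iff_of_nonneg fun c _ => mul_self_nonneg _] at h4
  funext c
  exact sub_eq_zero.1 (mul_self_eq_zero.1 (h4 c (Finset.mem_univ c)))

theorem projBdry_translate (v : Fin 4 → ZMod N) (α : Form N Λ 2 ℝ) :
    projBdry (translate Λ' v α) = translate Λ' v (projBdry α) := by
  obtain ⟨q, hq⟩ := exists_projBdry_eq α
  have h : latD (translate Λ' v (α - projBdry α)) = 0 := by
    rw [latD_translate, latD_sub_projBdry]
    rfl
  have h2 : translate Λ' v (α - projBdry α) =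
      translate Λ' v α - latBdry (translate Λ' v q) := by
    rw [hq, latBdry_translate]
    rfl
  rw [h2] at h
  rw [projBdry_eq_of_latD _ h, latBdry_translate, hq]

/-- The closed part of an integer form. -/
def closedPart (ℓ : Form N Λ 2 ℤ) : Form N Λ 2 ℝ := realForm ℓ - projBdry (realForm ℓ)

theorem latD_closedPart (ℓ : Form N Λ 2 ℤ) : latD (closedPart ℓ) = 0 := latD_sub_projBdry _

/-- The fluxes of the closed part of an integer form. -/
def fluxOf (ℓ : Form N Λ 2 ℤ) : Dirs 2 → ℝ := fun I => (N : ℝ) ^ 2 * average (closedPart ℓ) I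

theorem uNumber_translate (v : Fin 4 → ZMod N) (ℓ : Form N Λ 2 ℤ) :
    uNumber (translate Λ' v ℓ) = uNumber ℓ := by
  rw [uNumber, realForm_translate, projBdry_translate, latD_translate, cupOne_translate,
    latSum_translate, uNumber]

theorem closedPart_translate (v : Fin 4 → ZMod N) (ℓ : Form N Λ 2 ℤ) :
    closedPart (translate Λ' v ℓ) = translate Λ' v (closedPart ℓ) := by
  rw [closedPart, realForm_translate, projBdry_translate]
  rfl

theorem fluxOf_translate (v : Fin 4 → ZMod N) (ℓ : Form N Λ 2 ℤ) :
    fluxOf (translate Λ' v ℓ) = fluxOf ℓ := by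
  funext I
  rw [fluxOf, closedPart_translate, fluxOf, average, average]
  congr 2
  exact sum_shift (fun x : Site N Λ => closedPart ℓ (x, I)) v

theorem pairing_translate (b : Bool) (v : Fin 4 → ZMod N) (α β : Form N Λ 2 ℝ) :
    pairing b (translate Λ' v α) (translate Λ' v β) = pairing b α β := by
  cases b
  · rw [pairing_false, pairing_false, cup_translate, latSum_translate]
  · rw [pairing_true, pairing_true, cup_translate, latSum_translate]

theorem pontryagin_translate (v : Fin 4 → ZMod N) (ℓ : Form N Λ 2 ℤ) :
    pontryagin (translate Λ' v ℓ) = pontryagin ℓ := by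
  rw [pontryagin, latD_translate, cup_translate, cupOne_translate]
  exact latSum_translate v (cup ℓ ℓ + cupOne ℓ (latD ℓ))

theorem exists_star_projBdry (b : Bool) (α : Form N Λ 2 ℝ) :
    ∃ k, starForm b (projBdry α) = latD k := by
  obtain ⟨q, hq⟩ := exists_projBdry_eq α
  exact ⟨_, by rw [hq, starForm_latBdry]⟩

theorem dotForm_projBdry_of_latD (α : Form N Λ 2 ℝ) {G : Form N Λ 2 ℝ} (hG : latD G = 0) :
    dotForm (projBdry α) G = 0 := by
  obtain ⟨q, hq⟩ := exists_projBdry_eq α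
  rw [hq, dotForm_latBdry, hG]
  simp [dotForm]

/-- The dual of a boundary is exact, and boundaries are orthogonal to closed forms. -/
theorem pairing_projBdry_projBdry (b : Bool) (α : Form N Λ 2 ℝ) :
    pairing b (projBdry α) (projBdry α) = 0 := by
  obtain ⟨k, hk⟩ := exists_star_projBdry b α
  rw [pairing_eq_dotForm, hk, dotForm_projBdry_of_latD α (latD_latD_one k)]

theorem pairing_constForm_projBdry (b : Bool) (h : Dirs 2 → ℝ) (α : Form N Λ 2 ℝ) :
    pairing b (constForm N Λ h) (projBdry α) = 0 := by
  obtain ⟨k, hk⟩ := exists_star_projBdry b α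
  rw [pairing_eq_dotForm, hk, dotForm_comm, dotForm_latD_constForm]

theorem pairing_realForm (b : Bool) (α β : Form N Λ 2 ℤ) :
    pairing b (realForm α) (realForm β) = ((pairing b α β : ℤ) : ℝ) := by
  cases b
  · rw [pairing_false, pairing_false, realForm_cup, latSum_realForm]
  · rw [pairing_true, pairing_true, realForm_cup, latSum_realForm]

/-- The closed part is the sum of an exact form and a constant one. -/
theorem exists_closedPart_eq (ℓ : Form N Λ 2 ℤ) : ∃ A : Form N Λ 1 ℝ,
    closedPart ℓ = latD A + constForm N Λ fun I => fluxOf ℓ I / (N : ℝ) ^ 2 := by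
  have hN : (N : ℝ) ≠ 0 := Nat.cast_ne_zero.2 (NeZero.ne N)
  obtain ⟨A, hA⟩ := exists_eq_latD_add_average (latD_closedPart ℓ)
  refine ⟨A, hA.trans ?_⟩
  congr 2
  funext I
  rw [fluxOf]
  field_simp

theorem exists_realForm_eq {n : Form N Λ 2 ℤ} (hn : latD n = 0) : ∃ A : Form N Λ 1 ℝ,
    realForm n = latD A + constForm N Λ fun I => (period n I : ℝ) / (N : ℝ) ^ 2 := by
  have h : latD (realForm n) = 0 := by
    rw [realForm_latD, hn]; funext c; simp [realForm]
  obtain ⟨A, hA⟩ := exists_eq_latD_add_average h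
  refine ⟨A, hA.trans ?_⟩
  congr 2
  funext I
  exact average_realForm hn I

/-- Between closed forms the pairing is cohomological, so the exact parts drop out; the volume N⁴
cancels the two factors N⁻². -/
theorem pairing_exact_add_const (b : Bool) (A B : Form N Λ 1 ℝ) (h k : Dirs 2 → ℝ) :
    pairing b (latD A + constForm N Λ fun I => h I / (N : ℝ) ^ 2)
      (latD B + constForm N Λ fun I => k I / (N : ℝ) ^ 2) = wedge h k := by
  have hN : (N : ℝ) ≠ 0 := Nat.cast_ne_zero.2 (NeZero.ne N)
  simp only [map_add, LinearMap.add_apply]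
  rw [pairing_latD_left b A (latD_latD_one B), pairing_latD_left b A (latD_constForm _),
    pairing_latD_right b B (latD_constForm _), pairing_constForm]
  simp only [wedge]
  rw [Finset.mul_sum]
  simp only [zero_add]
  refine Finset.sum_congr rfl fun I _ => ?_
  field_simp

/-- The self-pairing depends on the integer periods only, and the intersection form of the 4-torus
is a sum of hyperbolic planes. -/
theorem even_latSum_cup {n : Form N Λ 2 ℤ} (hn : latD n = 0) : Even (latSum (cup n n)) := by
  obtain ⟨A, hA⟩ := exists_realForm_eq hn
  have h := pairing_exact_add_const true A A (fun I => (period n I : ℝ)) fun I => period n I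
  rw [← hA, pairing_realForm, pairing_true] at h
  have h2 : latSum (cup n n) = wedge (period n) (period n) := by
    have : (wedge (fun I => (period n I : ℝ)) fun I => (period n I : ℝ))
        = ((wedge (period n) (period n) : ℤ) : ℝ) := by
      simp [wedge]
    rw [this] at h
    exact_mod_cast h
  rw [h2, wedge_eq]
  refine ⟨period n dir01 * period n dir23 - period n dir02 * period n dir13
    + period n dir03 * period n dir12, by ring⟩

/-- For closed n the cross terms ℓ ∪ n + n ∪ ℓ + n ∪₁ dℓ sum to twice n ∪ ℓ, and n ∪ n sums to an
even number. -/
theorem pontryagin_add {n : Form N Λ 2 ℤ} (hn : latD n = 0) (q : ℤ) (ℓ : Form N Λ 2 ℤ) :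
    ∃ z : ℤ, pontryagin (q • ℓ + n) = q ^ 2 * pontryagin ℓ + 2 * z := by
  obtain ⟨y, hy⟩ := even_latSum_cup hn
  refine ⟨q * latSum (cup n ℓ) + y, ?_⟩
  have hd : latD (q • ℓ + n) = q • latD ℓ := by
    change latDHom N Λ 2 ℤ _ = q • latDHom N Λ 2 ℤ _
    rw [map_add, map_smul]
    change _ + latD n = _
    rw [hn, add_zero]
  have hs : ∀ α : Form N Λ 2 ℤ, pontryagin α =
      cupPairing N Λ ℤ α α + cupOnePairing N Λ ℤ α (latD α) := fun α =>
    map_add (latSumHom N Λ ℤ) _ _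
  rw [hs, hs, hd]
  have h1 := latSum_cupOne_latD hn ℓ
  simp only [← cupPairing_apply, ← cupOnePairing_apply] at h1 hy ⊢
  simp only [map_add, LinearMap.add_apply, map_smul, LinearMap.smul_apply, smul_eq_mul]
  rw [h1, hy]
  ring

end Projection


/-! ### Factorization of the weight into contour, flux and exact parts -/

section Splitting

variable {N : ℕ} {Λ : LatticeKind}

/-- The closed part of a field strength with given fluxes. -/
def closedField (A : Form N Λ 1 ℝ) (x : Dirs 2 → ℝ) : Form N Λ 2 ℝ :=
  latD A + constForm N Λ fun I => 2 * Real.pi * x I / (N : ℝ) ^ 2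

theorem latD_closedField (A : Form N Λ 1 ℝ) (x : Dirs 2 → ℝ) : latD (closedField A x) = 0 := by
  have h : latD (closedField A x) = latD (latD A) + latD (constForm N Λ fun I =>
    2 * Real.pi * x I / (N : ℝ) ^ 2) := map_add (latDHom N Λ 2 ℝ) _ _
  rw [h, latD_latD_one, latD_constForm, add_zero]

variable [NeZero N]

/-- The topological charge of `W` (for `b = true`) or of `W̃` (for `b = false`). -/
def charge (b : Bool) (A : Form N Λ 1 ℝ) (n : Form N Λ 2 ℤ) : ℝ :=
  1 / (8 * Real.pi ^ 2) * latSum (cup (fieldStrength A n) (fieldStrength A n)) +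
    boolSign ℝ b * (1 / (4 * Real.pi) *
      latSum (cupOne (fieldStrength A n) (latD (realForm n))))

/-- The weight that remains after the integration over the magnetic gauge field. -/
def coreWeight (b : Bool) (β θ : ℝ) (p qe : ℤ) (ℓ : Form N Λ 2 ℤ)
    (A : Form N Λ 1 ℝ) (n : Form N Λ 2 ℤ) : ℂ :=
  Complex.exp (-(β / 2 * dotForm (fieldStrength A n) (fieldStrength A n) : ℝ)
    - Complex.I * (θ * charge b A n : ℝ) - Complex.I * (p * Real.pi * pontryagin n : ℝ)
    - Complex.I * (qe * pairing b (latD A) (realForm ℓ) : ℝ))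

theorem dotForm_closedField_add (A : Form N Λ 1 ℝ) (x : Dirs 2 → ℝ) (s : ℝ) (α : Form N Λ 2 ℝ) :
    dotForm (closedField A x + s • projBdry α) (closedField A x + s • projBdry α) =
      dotForm (latD A) (latD A) + 4 * Real.pi ^ 2 * ∑ I, x I * x I
        + s ^ 2 * dotForm (projBdry α) (projBdry α) := by
  have hN : (N : ℝ) ≠ 0 := Nat.cast_ne_zero.2 (NeZero.ne N)
  have h1 := dotForm_projBdry_of_latD α (latD_closedField A x)
  have h2 := dotForm_latD_constForm A fun I => 2 * Real.pi * x I / (N : ℝ) ^ 2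
  have h3 := dotForm_constForm_constForm (N := N) (Λ := Λ)
    (fun I => 2 * Real.pi * x I / (N : ℝ) ^ 2) fun I => 2 * Real.pi * x I / (N : ℝ) ^ 2
  have h4 : (N : ℝ) ^ 4 * ∑ I, 2 * Real.pi * x I / (N : ℝ) ^ 2 *
      (2 * Real.pi * x I / (N : ℝ) ^ 2) = 4 * Real.pi ^ 2 * ∑ I, x I * x I := by
    rw [Finset.mul_sum, Finset.mul_sum]
    refine Finset.sum_congr rfl fun I _ => ?_
    field_simp
    ring
  have h5 := dotForm_comm (projBdry α) (closedField A x)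
  have h6 := dotForm_comm (latD A) (constForm N Λ fun I => 2 * Real.pi * x I / (N : ℝ) ^ 2)
  have h7 : dotForm (closedField A x) (closedField A x) =
      dotForm (latD A) (latD A) + 4 * Real.pi ^ 2 * ∑ I, x I * x I := by
    rw [← h4, ← h3, closedField]
    simp only [← dotHom_apply, map_add, LinearMap.add_apply] at h2 h6 ⊢
    rw [← h6, h2]
    ring
  rw [← h7]
  simp only [← dotHom_apply, map_add, LinearMap.add_apply, map_smul, LinearMap.smul_apply,
    smul_eq_mul] at h1 h5 ⊢
  rw [← h5, h1]
  ring

theorem wedge_two_pi (x y : Dirs 2 → ℝ) :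
    wedge (fun I => 2 * Real.pi * x I) y = 2 * Real.pi * wedge x y := by
  rw [wedge_eq, wedge_eq]; ring

theorem wedge_two_pi_two_pi (x : Dirs 2 → ℝ) :
    wedge (fun I => 2 * Real.pi * x I) (fun I => 2 * Real.pi * x I)
      = 4 * Real.pi ^ 2 * wedge x x := by
  rw [wedge_eq, wedge_eq]; ring

theorem pairing_closedField_projBdry (b : Bool) (A : Form N Λ 1 ℝ) (x : Dirs 2 → ℝ)
    (α : Form N Λ 2 ℝ) :
    pairing b (closedField A x) (projBdry α) = dotForm (latD A) (starForm b (projBdry α)) := by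
  rw [closedField, map_add, LinearMap.add_apply, pairing_constForm_projBdry, add_zero,
    pairing_eq_dotForm]

theorem pairing_closedField_realForm (b : Bool) (A : Form N Λ 1 ℝ) (x : Dirs 2 → ℝ)
    (ℓ : Form N Λ 2 ℤ) :
    pairing b (closedField A x) (realForm ℓ) = 2 * Real.pi * wedge x (fluxOf ℓ) +
      dotForm (latD A) (starForm b (projBdry (realForm ℓ))) := by
  have h1 : realForm ℓ = closedPart ℓ + projBdry (realForm ℓ) := by
    rw [closedPart, sub_add_cancel]
  obtain ⟨B, hB⟩ := exists_closedPart_eq ℓ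
  have h2 : pairing b (closedField A x) (closedPart ℓ) = 2 * Real.pi * wedge x (fluxOf ℓ) := by
    rw [hB, closedField, pairing_exact_add_const, wedge_two_pi]
  conv_lhs => rw [h1]
  rw [map_add, h2, pairing_closedField_projBdry]

/-- Since l and P_∂ l have the same derivative, 2π dn = df with f = 2πq P_∂ l, and
`latSum_cup_add_cupOne` applies. The self-pairing of f vanishes, and constant forms do not pair with
f, so only dA' couples to it. -/
theorem charge_eq (b : Bool) {A : Form N Λ 1 ℝ} {n : Form N Λ 2 ℤ} {ℓ : Form N Λ 2 ℤ} {q : ℤ}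
    (hn : latD n = q • latD ℓ) {A' : Form N Λ 1 ℝ} {x : Dirs 2 → ℝ}
    (hF : fieldStrength A n = closedField A' x + (2 * Real.pi * q) • projBdry (realForm ℓ)) :
    charge b A n = wedge x x / 2
      + q / (2 * Real.pi) * dotForm (latD A') (starForm b (projBdry (realForm ℓ)))
      + boolSign ℝ b * q ^ 2 * uNumber ℓ / 2 := by
  have hpi := Real.pi_ne_zero
  set P := projBdry (realForm ℓ) with hP
  set f := (2 * Real.pi * q) • P with hf
  have hd : latD (realForm ℓ) = latD P := by
    have h := latD_sub_projBdry (realForm ℓ)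
    rw [show latD (realForm ℓ - projBdry (realForm ℓ)) = latD (realForm ℓ) - latD P from
      map_sub (latDHom N Λ 2 ℝ) _ _] at h
    exact sub_eq_zero.1 h
  have hdf : latD f = (2 * Real.pi * q) • latD P := map_smul (latDHom N Λ 2 ℝ) _ _
  have hdn : (2 * Real.pi) • latD (realForm n) = latD f := by
    rw [realForm_latD, hn, realForm_smul, ← realForm_latD, hd, hdf, smul_smul]
  have h0 : 2 * Real.pi * latSum (cupOne (fieldStrength A n) (latD (realForm n)))
      = latSum (cupOne (fieldStrength A n) (latD f)) := by
    rw [← hdn, ← cupOnePairing_apply, ← cupOnePairing_apply, map_smul, smul_eq_mul]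
  have h1 := latSum_cup_add_cupOne b (latD_closedField A' x) f
  rw [← hF, ← h0] at h1
  have h2 : latSum (cup (closedField A' x) (closedField A' x)) = 4 * Real.pi ^ 2 * wedge x x := by
    rw [← pairing_true, closedField, pairing_exact_add_const, wedge_two_pi_two_pi]
  have h3 : latSum (cup f f) = 0 := by
    rw [← pairing_true, hf]
    simp only [map_smul, LinearMap.smul_apply]
    rw [hP, pairing_projBdry_projBdry]
    simp
  have h4 : pairing b (closedField A' x) f = 2 * Real.pi * q * dotForm (latD A') (starForm b P) := by
    rw [hf, map_smul, smul_eq_mul, hP, pairing_closedField_projBdry]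
  have h5 : latSum (cupOne f (latD f)) = (2 * Real.pi * q) ^ 2 * uNumber ℓ := by
    rw [hdf, hf, uNumber, ← hP, ← cupOnePairing_apply, ← cupOnePairing_apply]
    simp only [map_smul, LinearMap.smul_apply, smul_eq_mul]
    ring
  rw [h2, h3, h4, h5] at h1
  rw [charge]
  field_simp
  linear_combination 8 * h1

theorem exists_fieldStrength_eq (ℓ : Form N Λ 2 ℤ) (q : ℤ) (m : Dirs 2 → ℤ) :
    ∃ B : Form N Λ 1 ℝ, ∀ (A : Form N Λ 1 ℝ) (n : exactInt N Λ),
      fieldStrength A (q • ℓ + (fluxForm N Λ m + n)) =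
        closedField (A + (2 * Real.pi) • potential n + B) (shiftedFlux q (fluxOf ℓ) m)
          + (2 * Real.pi * q) • projBdry (realForm ℓ) := by
  obtain ⟨a, ha⟩ := exists_closedPart_eq ℓ
  obtain ⟨a', ha'⟩ := exists_realForm_eq (latD_fluxForm (N := N) (Λ := Λ) m)
  rw [period_fluxForm] at ha'
  -- B collects the potentials of the exact parts of q times the closed part of ℓ and of the flux
  -- form; it depends on neither A nor n.
  refine ⟨(2 * Real.pi * q) • a + (2 * Real.pi) • a', fun A n => ?_⟩
  have h1 : realForm ℓ = closedPart ℓ + projBdry (realForm ℓ) := by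
    rw [closedPart, sub_add_cancel]
  have h2 : latD (A + (2 * Real.pi) • potential n + ((2 * Real.pi * q) • a + (2 * Real.pi) • a'))
      = latD A + (2 * Real.pi) • latD (potential n) + ((2 * Real.pi * q) • latD a
        + (2 * Real.pi) • latD a') := by
    change latDHom N Λ 1 ℝ _ = latDHom N Λ 1 ℝ _ + _ • latDHom N Λ 1 ℝ _ +
      (_ • latDHom N Λ 1 ℝ _ + _ • latDHom N Λ 1 ℝ _)
    simp only [map_add, map_smul]
  rw [fieldStrength, closedField, h2, realForm_add, realForm_add, realForm_smul, ha',
    realForm_eq_latD_potential]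
  conv_lhs => rw [h1, ha]
  funext c
  simp only [Pi.add_apply, Pi.smul_apply, smul_eq_mul, constForm, shiftedFlux]
  ring

theorem fieldStrength_add_latD_eq (A B : Form N Λ 1 ℝ) (n : exactInt N Λ) :
    fieldStrength A n + latD B = latD (A + (2 * Real.pi) • potential n + B) := by
  rw [fieldStrength, realForm_eq_latD_potential]
  change latDHom N Λ 1 ℝ _ + _ • latDHom N Λ 1 ℝ _ + latDHom N Λ 1 ℝ _ = latDHom N Λ 1 ℝ _
  simp only [map_add, map_smul]

/-- The factor of the weights that depends on the contour only. -/
def contourFactor (b : Bool) (β θ : ℝ) (p qe q : ℤ) (ℓ : Form N Λ 2 ℤ) : ℂ :=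
  Complex.exp (-(2 * Real.pi ^ 2 * β * q ^ 2 *
        dotForm (projBdry (realForm ℓ)) (projBdry (realForm ℓ)) : ℝ)
    - Complex.I * (θ * (boolSign ℝ b * q ^ 2 * uNumber ℓ / 2) : ℝ)
    - Complex.I * (p * Real.pi * (q ^ 2 * pontryagin ℓ) : ℝ)
    + Complex.I * (2 * Real.pi * qe * q * pairing b (closedPart ℓ) (realForm ℓ) : ℝ))

theorem exp_sub_int_mul_two_pi (z : ℂ) (k : ℤ) :
    Complex.exp (z - Complex.I * (2 * Real.pi * k)) = Complex.exp z := by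
  rw [Complex.exp_sub, show Complex.I * (2 * Real.pi * k) = k * (2 * Real.pi * Complex.I) by ring,
    Complex.exp_int_mul_two_pi_mul_I, div_one]

theorem latD_eq_zero_of_mem_exactInt {n : Form N Λ 2 ℤ} (hn : n ∈ exactInt N Λ) : latD n = 0 := by
  obtain ⟨A, hA⟩ := hn
  refine realForm_injective ?_
  rw [← realForm_latD, hA, latD_latD_one]
  funext c; simp [realForm]

/-- The field dA' couples to dk both through the electric charge and through θ (the Witten effect),
which adds θq/(2π) to the charge. -/
theorem exists_coreWeight_eq (b : Bool) (β θ : ℝ) (p qe q : ℤ) (ℓ : Form N Λ 2 ℤ)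
    (m : Dirs 2 → ℤ) {k : Form N Λ 1 ℝ} (hk : starForm b (projBdry (realForm ℓ)) = latD k) :
    ∃ B : Form N Λ 1 ℝ, ∀ (A : Form N Λ 1 ℝ) (n : exactInt N Λ),
      coreWeight b β θ p qe ℓ A (q • ℓ + (fluxForm N Λ m + n)) =
        contourFactor b β θ p qe q ℓ * fluxTerm β θ qe q (fluxOf ℓ) m *
          gaussPhase β (qe + θ * q / (2 * Real.pi)) (latD k) (fieldStrength A n + latD B) := by
  obtain ⟨B, hB⟩ := exists_fieldStrength_eq ℓ q m
  refine ⟨B, fun A n => ?_⟩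
  have hpi := Real.pi_ne_zero
  have hF := hB A n
  set n' : Form N Λ 2 ℤ := fluxForm N Λ m + n with hn'
  set A' := A + (2 * Real.pi) • potential n + B with hA'
  set x := shiftedFlux q (fluxOf ℓ) m with hx
  have hexact := latD_eq_zero_of_mem_exactInt n.2
  have hn0 : latD n' = 0 := by
    rw [hn', show latD (fluxForm N Λ m + (n : Form N Λ 2 ℤ)) = latD (fluxForm N Λ m) + latD
      (n : Form N Λ 2 ℤ) from map_add (latDHom N Λ 2 ℤ) _ _, latD_fluxForm, hexact, add_zero]
  have hd : latD (q • ℓ + n') = q • latD ℓ := by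
    rw [show latD (q • ℓ + n') = q • latD ℓ + latD n' by
      change latDHom N Λ 2 ℤ _ = q • latDHom N Λ 2 ℤ _ + latDHom N Λ 2 ℤ _
      rw [map_add, map_smul], hn0, add_zero]
  obtain ⟨z, hz⟩ := pontryagin_add hn0 q ℓ
  have hch := charge_eq b hd hF
  have hdot := dotForm_closedField_add A' x (2 * Real.pi * q) (realForm ℓ)
  have hdA : latD A = closedField A' x - (2 * Real.pi * q) • closedPart ℓ
      - (2 * Real.pi) • realForm n' := by
    have h1 : latD A = fieldStrength A (q • ℓ + n') - (2 * Real.pi) • realForm (q • ℓ + n') := by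
      rw [fieldStrength, add_sub_cancel_right]
    rw [h1, hF, realForm_add, realForm_smul, closedPart]
    funext c
    simp only [Pi.add_apply, Pi.sub_apply, Pi.smul_apply, smul_eq_mul]
    ring
  have hpair : pairing b (latD A) (realForm ℓ) = 2 * Real.pi * wedge x (fluxOf ℓ)
      + dotForm (latD A') (latD k) - 2 * Real.pi * q * pairing b (closedPart ℓ) (realForm ℓ)
      - 2 * Real.pi * ((pairing b n' ℓ : ℤ) : ℝ) := by
    rw [hdA]
    simp only [map_sub, map_smul, LinearMap.sub_apply, LinearMap.smul_apply, smul_eq_mul]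
    rw [pairing_closedField_realForm, pairing_realForm, hk]
  rw [coreWeight, gaussPhase, fieldStrength_add_latD_eq, ← hA', contourFactor, fluxTerm, ← hx,
    ← Complex.exp_add, ← Complex.exp_add, hch, hpair, hF, hdot, hz, hk]
  -- Two phases are multiples of 2πi: the electric pairing of the integer forms n' and ℓ, and the
  -- even change of the Pontryagin square.
  rw [← exp_sub_int_mul_two_pi _ (qe * pairing b n' ℓ - p * z)]
  congr 1
  push_cast
  field_simp
  ring

end Splitting


/-! ### Linearity of the exterior derivative -/

section Linearity

variable {N : ℕ} {Λ : LatticeKind} {R : Type} [CommRing R] {r : ℕ}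

theorem latD_add (α β : Form N Λ r R) : latD (α + β) = latD α + latD β :=
  map_add (latDHom N Λ r R) _ _

theorem latD_sub (α β : Form N Λ r R) : latD (α - β) = latD α - latD β :=
  map_sub (latDHom N Λ r R) _ _

theorem latD_smul (q : R) (α : Form N Λ r R) : latD (q • α) = q • latD α :=
  map_smul (latDHom N Λ r R) _ _

end Linearity

/-! ### Integration over the magnetic field and evaluation of the path integral -/

section Evaluation

variable {N : ℕ} [NeZero N] {Λ : LatticeKind}

theorem pathIntegrable_of_norm {β : ℝ} (hβ : 0 < β)
    {w : Form N Λ 1 ℝ → Form N Λ 3 ℝ → Form N Λ 2 ℤ → ℂ}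
    (hc : ∀ n, Continuous fun q : Form N Λ 1 ℝ × Form N Λ 3 ℝ => w q.1 q.2 n)
    (hw : ∀ A Am n, ‖w A Am n‖ =
      Real.exp (-(β / 2 * dotForm (fieldStrength A n) (fieldStrength A n)))) :
    PathIntegrable w := by
  obtain ⟨g, hg, hle⟩ := exists_weight_bound (N := N) (Λ := Λ) hβ 0
  have hgi : Integrable g (Measure.count : Measure (Form N Λ 2 ℤ)) :=
    integrable_count_iff.2 hg.norm
  have hgs : Integrable (fun q : (Form N Λ 1 ℝ × Form N Λ 3 ℝ) × Form N Λ 2 ℤ => g q.2)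
      (((gaugeMeasure N Λ 1).prod (gaugeMeasure N Λ 3)).prod Measure.count) :=
    hgi.comp_snd _
  refine hgs.mono' ?_ ?_
  · exact (measurable_from_prod_countable_left fun n => (hc n).measurable).aestronglyMeasurable
  · have h := (Measure.quasiMeasurePreserving_fst (μ := gaugeMeasure N Λ 1)
      (ν := gaugeMeasure N Λ 3)).ae (ae_abs_le_pi (N := N) (Λ := Λ) 1)
    have h2 := (Measure.quasiMeasurePreserving_fst
      (μ := (gaugeMeasure N Λ 1).prod (gaugeMeasure N Λ 3))
      (ν := (Measure.count : Measure (Form N Λ 2 ℤ)))).ae h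
    filter_upwards [h2] with q hq
    rw [hw]
    simpa using hle q.1.1 hq q.2

/-- A weight whose dependence on the magnetic gauge field is that of a current `j`. -/
def magneticWeight (w : Form N Λ 1 ℝ → Form N Λ 2 ℤ → ℂ) (j : Form N Λ 3 ℤ)
    (Ae : Form N Λ 1 ℝ) (Am : Form N Λ 3 ℝ) (n : Form N Λ 2 ℤ) : ℂ :=
  w Ae n * Complex.exp (-(Complex.I * (∑ c, (latD n - j) c * Am c : ℝ)))

theorem norm_exp_neg_I_mul (x : ℝ) : ‖Complex.exp (-(Complex.I * (x : ℝ)))‖ = 1 := by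
  rw [Complex.norm_exp]; simp

/-- The integration over the magnetic gauge field imposes `dn = j`. -/
theorem pathIntegral_magneticWeight {β : ℝ} (hβ : 0 < β)
    {w : Form N Λ 1 ℝ → Form N Λ 2 ℤ → ℂ} (hc : ∀ n, Continuous fun A => w A n)
    (hw : ∀ A n, ‖w A n‖ =
      Real.exp (-(β / 2 * dotForm (fieldStrength A n) (fieldStrength A n))))
    (j : Form N Λ 3 ℤ) :
    pathIntegral (magneticWeight w j) =
      ∑' n : {n : Form N Λ 2 ℤ // latD n = j}, ∫ A, w A n ∂(gaugeMeasure N Λ 1) := by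
  obtain ⟨g, hg, hle⟩ := exists_weight_bound (N := N) (Λ := Λ) hβ 0
  simp only [add_zero] at hle
  -- Orthogonality of the characters of the torus produces the indicator of dn = j.
  have hint : ∀ n : Form N Λ 2 ℤ,
      ∫ Am, Complex.exp (-(Complex.I * (∑ c, (latD n - j) c * Am c : ℝ))) ∂(gaugeMeasure N Λ 3)
        = if latD n - j = 0 then 1 else 0 := fun n =>
    integral_pi_angleMeasure_exp (latD n - j)
  have h1 : ∀ᵐ A ∂(gaugeMeasure N Λ 1),
      ∫ Am, ∑' n, magneticWeight w j A Am n ∂(gaugeMeasure N Λ 3) =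
        ∑' n, w A n * if latD n - j = 0 then 1 else 0 := by
    filter_upwards [ae_abs_le_pi (N := N) (Λ := Λ) 1] with A hA
    rw [integral_tsum_of_bound (b := g)]
    · refine tsum_congr fun n => ?_
      simp only [magneticWeight]
      rw [integral_const_mul, hint]
    · intro n
      refine Continuous.aestronglyMeasurable ?_
      simp only [magneticWeight]
      fun_prop
    · intro n
      refine Filter.Eventually.of_forall fun Am => ?_
      rw [magneticWeight, norm_mul, norm_exp_neg_I_mul, mul_one, hw]
      exact hle A hA n
    · exact hg
  rw [pathIntegral, integral_congr_ae h1, integral_tsum_of_bound (b := g)]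
  · rw [show (∑' n : {n : Form N Λ 2 ℤ // latD n = j}, ∫ A, w A n ∂(gaugeMeasure N Λ 1))
      = ∑' n : ({n | latD n = j} : Set (Form N Λ 2 ℤ)), ∫ A, w A n ∂(gaugeMeasure N Λ 1) from rfl,
      tsum_subtype {n : Form N Λ 2 ℤ | latD n = j} fun n => ∫ A, w A n ∂(gaugeMeasure N Λ 1)]
    refine tsum_congr fun n => ?_
    rw [integral_mul_const]
    by_cases h : latD n = j
    · simp [h]
    · simp [h, sub_eq_zero]
  · intro n
    exact ((hc n).mul continuous_const).aestronglyMeasurable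
  · intro n
    filter_upwards [ae_abs_le_pi (N := N) (Λ := Λ) 1] with A hA
    refine le_trans ?_ (hle A hA n)
    rw [norm_mul, hw]
    split_ifs <;> simp [Real.exp_nonneg]
  · exact hg

theorem period_eq_zero_of_mem_exactInt {n : Form N Λ 2 ℤ} (hn : n ∈ exactInt N Λ) :
    period n = 0 := by
  have hd := latD_eq_zero_of_mem_exactInt hn
  obtain ⟨A, hA⟩ := hn
  funext I
  have h1 := sum_eq_period hd I
  have h2 : ((∑ x, n (x, I) : ℤ) : ℝ) = 0 := by
    rw [← sum_latD A I, ← hA]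
    simp [realForm]
  have h3 : ∑ x, n (x, I) = 0 := by exact_mod_cast h2
  rw [h3] at h1
  have hN : ((N : ℤ) ^ 2) ≠ 0 := pow_ne_zero _ (Nat.cast_ne_zero.2 (NeZero.ne N))
  exact (mul_eq_zero.1 h1.symm).resolve_left hN

theorem mem_exactInt_of_period {n : Form N Λ 2 ℤ} (hn : latD n = 0) (hp : period n = 0) :
    n ∈ exactInt N Λ := by
  obtain ⟨A, hA⟩ := exists_realForm_eq hn
  refine ⟨A, hA.trans ?_⟩
  funext c
  simp [hp, constForm]

/-- The integer forms with a given derivative, by their fluxes and an exact form. -/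
def fluxDecomposition (q : ℤ) (ℓ : Form N Λ 2 ℤ) :
    (Dirs 2 → ℤ) × exactInt N Λ ≃ {n : Form N Λ 2 ℤ // latD n = q • latD ℓ} where
  toFun a := ⟨q • ℓ + (fluxForm N Λ a.1 + a.2), by
    rw [latD_add, latD_add, latD_fluxForm, latD_eq_zero_of_mem_exactInt a.2.2,
      latD_smul, add_zero, add_zero]⟩
  invFun n := (period (n.1 - q • ℓ),
    ⟨n.1 - q • ℓ - fluxForm N Λ (period (n.1 - q • ℓ)), mem_exactInt_of_period
      (by rw [latD_sub, latD_sub, latD_smul, n.2, latD_fluxForm, sub_self, sub_zero])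
      (by
        have h := period_add (n.1 - q • ℓ - fluxForm N Λ (period (n.1 - q • ℓ)))
          (fluxForm N Λ (period (n.1 - q • ℓ)))
        rw [sub_add_cancel, period_fluxForm] at h
        exact left_eq_add.1 (h.trans (add_comm _ _)))⟩)
  left_inv := by
    rintro ⟨m, n⟩
    have h : period (q • ℓ + (fluxForm N Λ m + (n : Form N Λ 2 ℤ)) - q • ℓ) = m := by
      rw [add_sub_cancel_left, period_add, period_fluxForm,
        period_eq_zero_of_mem_exactInt n.2, add_zero]
    refine Prod.ext h (Subtype.ext ?_)
    change q • ℓ + (fluxForm N Λ m + (n : Form N Λ 2 ℤ)) - q • ℓ -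
      fluxForm N Λ (period (q • ℓ + (fluxForm N Λ m + (n : Form N Λ 2 ℤ)) - q • ℓ)) = n
    rw [h]
    abel
  right_inv := by
    rintro ⟨n, hn⟩
    refine Subtype.ext ?_
    change q • ℓ + (fluxForm N Λ (period (n - q • ℓ)) +
      (n - q • ℓ - fluxForm N Λ (period (n - q • ℓ)))) = n
    abel

theorem continuous_fieldStrength (n : Form N Λ 2 ℤ) :
    Continuous fun A : Form N Λ 1 ℝ => fieldStrength A n :=
  continuous_latD.add_const _

theorem continuous_dotForm {r : ℕ} {X : Type*} [TopologicalSpace X] {f g : X → Form N Λ r ℝ}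
    (hf : Continuous f) (hg : Continuous g) : Continuous fun x => dotForm (f x) (g x) := by
  simp only [dotForm]
  exact continuous_finsetSum _ fun c _ =>
    ((continuous_apply c).comp hf).mul ((continuous_apply c).comp hg)

theorem continuous_charge (b : Bool) (n : Form N Λ 2 ℤ) :
    Continuous fun A : Form N Λ 1 ℝ => charge b A n := by
  have hF := continuous_fieldStrength (N := N) (Λ := Λ) n
  have h1 : ∀ A : Form N Λ 1 ℝ, latSum (cup (fieldStrength A n) (fieldStrength A n))
      = dotForm (fieldStrength A n) (starForm true (fieldStrength A n)) := fun A => by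
    rw [← pairing_true, pairing_eq_dotForm]
  have h2 : Continuous fun A : Form N Λ 1 ℝ =>
      latSum (cupOne (fieldStrength A n) (latD (realForm n))) :=
    (LinearMap.continuous_of_finiteDimensional
      ((cupOnePairing N Λ ℝ).flip (latD (realForm n)))).comp hF
  have h3 : Continuous fun β : Form N Λ 2 ℝ => starForm true β := by
    refine continuous_pi fun c => ?_
    simp only [starForm]
    refine continuous_finsetSum _ fun J _ => ?_
    split_ifs <;> fun_prop
  simp only [charge, h1]
  exact (continuous_const.mul (continuous_dotForm hF (h3.comp hF))).add
    (continuous_const.mul (continuous_const.mul h2))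

theorem continuous_coreWeight (b : Bool) (β θ : ℝ) (p qe : ℤ) (ℓ n : Form N Λ 2 ℤ) :
    Continuous fun A => coreWeight b β θ p qe ℓ A n := by
  have h1 := continuous_dotForm (continuous_fieldStrength (N := N) (Λ := Λ) n)
    (continuous_fieldStrength (N := N) (Λ := Λ) n)
  have h2 := continuous_charge (N := N) (Λ := Λ) b n
  have h3 : Continuous fun A : Form N Λ 1 ℝ => pairing b (latD A) (realForm ℓ) := by
    simp only [pairing_eq_dotForm]
    exact continuous_dotForm continuous_latD continuous_const
  simp only [coreWeight]
  fun_prop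

theorem norm_coreWeight (b : Bool) (β θ : ℝ) (p qe : ℤ) (ℓ n : Form N Λ 2 ℤ)
    (A : Form N Λ 1 ℝ) : ‖coreWeight b β θ p qe ℓ A n‖ =
      Real.exp (-(β / 2 * dotForm (fieldStrength A n) (fieldStrength A n))) := by
  rw [coreWeight, Complex.norm_exp]
  congr 1
  simp

/-- Evaluation of the path integral of a core weight. -/
theorem exists_pathIntegral_coreWeight {β : ℝ} (hβ : 0 < β) :
    ∃ C : ℂ, C ≠ 0 ∧ ∀ (b : Bool) (θ : ℝ) (p qe q : ℤ) (ℓ : Form N Λ 2 ℤ),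
      pathIntegral (magneticWeight (coreWeight b β θ p qe ℓ) (q • latD ℓ)) =
        C * Complex.exp (-((qe + θ * q / (2 * Real.pi)) ^ 2 / (2 * β) *
            dotForm (projBdry (realForm ℓ)) (projBdry (realForm ℓ)) : ℝ)) *
          contourFactor b β θ p qe q ℓ * fluxSum β θ qe q (fluxOf ℓ) := by
  obtain ⟨C, hC, hgauss⟩ := exists_tsum_integral_gaussPhase (N := N) (Λ := Λ) hβ
  refine ⟨C, hC, fun b θ p qe q ℓ => ?_⟩
  obtain ⟨k, hk⟩ := exists_star_projBdry b (realForm ℓ)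
  obtain ⟨g, hg, hle⟩ := exists_weight_bound (N := N) (Λ := Λ) hβ 0
  simp only [add_zero] at hle
  have hbound : ∀ n, ‖∫ A, coreWeight b β θ p qe ℓ A n ∂(gaugeMeasure N Λ 1)‖ ≤ g n := by
    intro n
    refine (norm_integral_le_of_norm_le_const (C := g n) ?_).trans (by simp)
    filter_upwards [ae_abs_le_pi (N := N) (Λ := Λ) 1] with A hA
    rw [norm_coreWeight]
    exact hle A hA n
  have hsum : Summable fun n => ∫ A, coreWeight b β θ p qe ℓ A n ∂(gaugeMeasure N Λ 1) :=
    Summable.of_norm_bounded hg hbound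
  have hsum' : Summable fun a : (Dirs 2 → ℤ) × exactInt N Λ =>
      ∫ A, coreWeight b β θ p qe ℓ A (fluxDecomposition q ℓ a) ∂(gaugeMeasure N Λ 1) :=
    hsum.comp_injective (Subtype.val_injective.comp (fluxDecomposition q ℓ).injective)
  rw [pathIntegral_magneticWeight hβ (fun n => continuous_coreWeight b β θ p qe ℓ n)
    (fun A n => norm_coreWeight b β θ p qe ℓ n A), ← (fluxDecomposition q ℓ).tsum_eq,
    hsum'.tsum_prod, fluxSum, ← tsum_mul_left]
  refine tsum_congr fun m => ?_
  obtain ⟨B, hB⟩ := exists_coreWeight_eq b β θ p qe q ℓ m hk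
  have h1 : ∀ (n : exactInt N Λ) (A : Form N Λ 1 ℝ),
      coreWeight b β θ p qe ℓ A (fluxDecomposition q ℓ (m, n)) =
        contourFactor b β θ p qe q ℓ * fluxTerm β θ qe q (fluxOf ℓ) m *
          gaussPhase β (qe + θ * q / (2 * Real.pi)) (latD k) (fieldStrength A n + latD B) :=
    fun n A => hB A n
  simp only [h1]
  simp only [integral_const_mul, tsum_mul_left]
  -- The Gaussian factor contains |dk|², the norm of the dual of P_∂ ℓ; since duality is an isometry
  -- it no longer depends on b.
  rw [hgauss, ← hk, dotForm_starForm]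
  ring

end Evaluation


/-! ### Poincaré duality between the loop and its surface form -/

section Currents

variable {N : ℕ} {Λ : LatticeKind} {R : Type} [CommRing R]

theorem sum_dirs_one_disjoint (J : Dirs 3) (c : R) :
    ∑ I : Dirs 1, (if Disjoint I.1 J.1 then c else 0) = c := by
  have h : ∀ J : Dirs 3,
      (Finset.univ.filter fun I : Dirs 1 => Disjoint I.1 J.1).card = 1 := by decide
  rw [← Finset.sum_filter, Finset.sum_const, h J, one_smul]

theorem sum_dirs_three_disjoint (I : Dirs 1) (c : R) :
    ∑ J : Dirs 3, (if Disjoint I.1 J.1 then c else 0) = c := by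
  have h : ∀ I : Dirs 1,
      (Finset.univ.filter fun J : Dirs 3 => Disjoint I.1 J.1).card = 1 := by decide
  rw [← Finset.sum_filter, Finset.sum_const, h I, one_smul]

theorem shuffleSign_one_three (I : Dirs 1) (J : Dirs 3) : Disjoint I.1 J.1 →
    shuffleSign J.1 I.1 = -shuffleSign I.1 J.1 := by
  revert I J; decide

theorem disjoint_and_union_one_three (I : Dirs 1) (J : Dirs 3) :
    (Disjoint I.1 J.1 ∧ I.1 ∪ J.1 = {0, 1, 2, 3}) ↔ Disjoint I.1 J.1 := by
  revert I J; decide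

theorem disjoint_and_union_three_one (I : Dirs 1) (J : Dirs 3) :
    (Disjoint J.1 I.1 ∧ J.1 ∪ I.1 = {0, 1, 2, 3}) ↔ Disjoint I.1 J.1 := by
  revert I J; decide

theorem latSum_cup_one_three [NeZero N] (t : Form N Λ 1 R) (a : Form N Λ 3 R) :
    latSum (cup t a) = ∑ x, ∑ I : Dirs 1, ∑ J : Dirs 3, if Disjoint I.1 J.1 then
      (shuffleSign I.1 J.1 : R) * t (x, I) * a (x + dirVec N I.1, J) else 0 := by
  rw [latSum_apply]
  simp only [cup, disjoint_and_union_one_three]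

theorem latSum_cup_three_one [NeZero N] (a : Form N Λ 3 R) (t : Form N Λ 1 R) :
    latSum (cup a t) = ∑ x, ∑ J : Dirs 3, ∑ I : Dirs 1, if Disjoint I.1 J.1 then
      -((shuffleSign I.1 J.1 : R) * a (x, J) * t (x + dirVec N J.1, I)) else 0 := by
  rw [latSum_apply]
  simp only [cup, disjoint_and_union_three_one]
  refine Finset.sum_congr rfl fun x _ => Finset.sum_congr rfl fun J _ =>
    Finset.sum_congr rfl fun I _ => ?_
  split_ifs with h
  · rw [shuffleSign_one_three I J h]
    push_cast
    ring
  · rfl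

theorem latSum_cup_current [NeZero N] {t : Form N Λ 1 R} {j : Form N Λ 3 R}
    (h : ∀ x (I : Dirs 1) (J : Dirs 3), Disjoint I.1 J.1 →
      (shuffleSign I.1 J.1 : R) * j (x + dirVec N I.1, J) = -t (x, I)) (a : Form N Λ 3 R) :
    latSum (cup t a) = -dotForm j a := by
  have h1 : ∀ x (I : Dirs 1) (J : Dirs 3), (if Disjoint I.1 J.1 then
      (shuffleSign I.1 J.1 : R) * t (x, I) * a (x + dirVec N I.1, J) else 0) =
      if Disjoint I.1 J.1 then -(j (x + dirVec N I.1, J) * a (x + dirVec N I.1, J)) else 0 := by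
    intro x I J
    split_ifs with hd
    · have h2 : t (x, I) = -((shuffleSign I.1 J.1 : R) * j (x + dirVec N I.1, J)) := by
        rw [h x I J hd, neg_neg]
      rw [h2]
      linear_combination -(j (x + dirVec N I.1, J) * a (x + dirVec N I.1, J)) *
        shuffleSign_mul_self (R := R) I.1 J.1
    · rfl
  rw [latSum_cup_one_three]
  simp only [h1]
  rw [dotForm, Fintype.sum_prod_type, ← Finset.sum_neg_distrib, Finset.sum_comm]
  have h3 : ∀ I : Dirs 1, ∑ x : Site N Λ, ∑ J : Dirs 3, (if Disjoint I.1 J.1 then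
      -(j (x + dirVec N I.1, J) * a (x + dirVec N I.1, J)) else 0) =
      ∑ x : Site N Λ, ∑ J : Dirs 3, if Disjoint I.1 J.1 then -(j (x, J) * a (x, J)) else 0 :=
    fun I => sum_shift (fun x : Site N Λ => ∑ J : Dirs 3,
      if Disjoint I.1 J.1 then -(j (x, J) * a (x, J)) else 0) (dirVec N I.1)
  simp only [h3]
  rw [Finset.sum_comm]
  refine Finset.sum_congr rfl fun x _ => ?_
  rw [Finset.sum_comm, ← Finset.sum_neg_distrib]
  exact Finset.sum_congr rfl fun J _ => sum_dirs_one_disjoint J _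

theorem dotForm_current [NeZero N] {t : Form N Λ 1 R} {j : Form N Λ 3 R}
    (h : ∀ x (I : Dirs 1) (J : Dirs 3), Disjoint I.1 J.1 →
      (shuffleSign I.1 J.1 : R) * j (x + dirVec N I.1, J) = -t (x, I)) (A : Form N Λ 1 R) :
    dotForm t A = -latSum (cup A j) := by
  rw [latSum_cup_one_three, dotForm, Fintype.sum_prod_type, ← Finset.sum_neg_distrib]
  refine Finset.sum_congr rfl fun x _ => ?_
  rw [← Finset.sum_neg_distrib]
  refine Finset.sum_congr rfl fun I _ => ?_
  rw [← Finset.sum_neg_distrib, ← sum_dirs_three_disjoint I (t (x, I) * A (x, I))]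
  refine Finset.sum_congr rfl fun J _ => ?_
  split_ifs with hd
  · linear_combination (A (x, I)) * h x I J hd
  · simp

theorem latSum_cup_dual_current [NeZero N] {t : Form N Λ 1 R} {j : Form N Λ 3 R}
    (h : ∀ x (I : Dirs 1) (J : Dirs 3), Disjoint I.1 J.1 →
      (shuffleSign I.1 J.1 : R) * j (x, J) = -t (x + dirVec N J.1, I)) (a : Form N Λ 3 R) :
    latSum (cup a t) = dotForm j a := by
  rw [latSum_cup_three_one, dotForm, Fintype.sum_prod_type]
  refine Finset.sum_congr rfl fun x _ => Finset.sum_congr rfl fun J _ => ?_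
  rw [← sum_dirs_one_disjoint J (j (x, J) * a (x, J))]
  refine Finset.sum_congr rfl fun I _ => ?_
  split_ifs with hd
  · linear_combination -((shuffleSign I.1 J.1 : R) * a (x, J)) * h x I J hd
      + j (x, J) * a (x, J) * shuffleSign_mul_self (R := R) I.1 J.1
  · rfl

theorem dotForm_dual_current [NeZero N] {t : Form N Λ 1 R} {j : Form N Λ 3 R}
    (h : ∀ x (I : Dirs 1) (J : Dirs 3), Disjoint I.1 J.1 →
      (shuffleSign I.1 J.1 : R) * j (x, J) = -t (x + dirVec N J.1, I)) (A : Form N Λ 1 R) :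
    dotForm t A = latSum (cup j A) := by
  have h1 : ∀ x (J : Dirs 3) (I : Dirs 1), (if Disjoint I.1 J.1 then
      -((shuffleSign I.1 J.1 : R) * j (x, J) * A (x + dirVec N J.1, I)) else 0) =
      if Disjoint I.1 J.1 then t (x + dirVec N J.1, I) * A (x + dirVec N J.1, I) else 0 := by
    intro x J I
    split_ifs with hd
    · rw [h x I J hd]; ring
    · rfl
  rw [latSum_cup_three_one]
  simp only [h1]
  conv_rhs => rw [Finset.sum_comm]
  have h3 : ∀ J : Dirs 3, ∑ x : Site N Λ, ∑ I : Dirs 1, (if Disjoint I.1 J.1 then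
      t (x + dirVec N J.1, I) * A (x + dirVec N J.1, I) else 0) =
      ∑ x : Site N Λ, ∑ I : Dirs 1, if Disjoint I.1 J.1 then t (x, I) * A (x, I) else 0 :=
    fun J => sum_shift (fun x : Site N Λ => ∑ I : Dirs 1,
      if Disjoint I.1 J.1 then t (x, I) * A (x, I) else 0) (dirVec N J.1)
  simp only [h3]
  conv_rhs => rw [Finset.sum_comm]
  rw [dotForm, Fintype.sum_prod_type]
  refine Finset.sum_congr rfl fun x _ => ?_
  conv_rhs => rw [Finset.sum_comm]
  exact Finset.sum_congr rfl fun I _ => (sum_dirs_three_disjoint I _).symm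

theorem IsSurfaceForm.real {γ : Contour N Λ} {l : Form N Λ 2 ℤ} (h : IsSurfaceForm γ l)
    (x : Site N Λ) (I : Dirs 1) (J : Dirs 3) (hd : Disjoint I.1 J.1) :
    (shuffleSign I.1 J.1 : ℝ) * realForm (latD l) (x + dirVec N I.1, J) =
      -realForm γ.tangent (x, I) := by
  have := h x I J hd
  simp only [realForm]
  exact_mod_cast this

/-- The surface form on the dual lattice. -/
def dualSurface (l : Form N .primal 2 ℤ) : Form N .dual 2 ℤ :=
  translate .dual (dirVec N Finset.univ) l

/-- The displacements along I and J add up to ŝ, the translation in `dualSurface`, so the condition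
at the far end of the link becomes one at the near corner of the cube. This is the form needed when
the loop stands on the right of the cup product. -/
theorem IsSurfaceForm.dual {γ : Contour N .primal} {l : Form N .primal 2 ℤ}
    (h : IsSurfaceForm γ l) (x : Site N .dual) (I : Dirs 1) (J : Dirs 3)
    (hd : Disjoint I.1 J.1) :
    (shuffleSign I.1 J.1 : ℝ) * realForm (latD (dualSurface l)) (x, J) =
      -realForm γ.toDual.tangent (x + dirVec N J.1, I) := by
  have h1 := h.real (x + dirVec N J.1) I J hd
  have h2 : J.1 ∪ I.1 = Finset.univ := by
    have : ∀ (I : Dirs 1) (J : Dirs 3), Disjoint I.1 J.1 → J.1 ∪ I.1 = Finset.univ := by decide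
    exact this I J hd
  rw [add_assoc, dirVec_add_of_disjoint N hd.symm, h2] at h1
  rw [dualSurface, latD_translate]
  exact h1

end Currents

/-! ### The loop weights and the partition function in a common form -/

section Weights

variable {N : ℕ} [NeZero N] {Λ : LatticeKind}

theorem topCharge_eq (A : Form N Λ 1 ℝ) (n : Form N Λ 2 ℤ) : topCharge A n = charge true A n := by
  simp [topCharge, charge, boolSign]

theorem topChargeDual_eq (A : Form N Λ 1 ℝ) (n : Form N Λ 2 ℤ) :
    topChargeDual A n = charge false A n := by
  simp [topChargeDual, charge, boolSign, sub_eq_add_neg]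

theorem topChargeZero_eq (A : Form N Λ 1 ℝ) (n : Form N Λ 2 ℤ) :
    topChargeZero A n = (charge true A n + charge false A n) / 2 := by
  simp [topChargeZero, charge, boolSign]
  ring

theorem dotForm_latBdry_fieldStrength (Am : Form N Λ 3 ℝ) (A : Form N Λ 1 ℝ)
    (n : Form N Λ 2 ℤ) : 1 / (2 * Real.pi) * dotForm (latBdry Am) (fieldStrength A n) =
      -dotForm (realForm (latD n)) Am := by
  have hpi := Real.pi_ne_zero
  rw [dotForm_latBdry, fieldStrength, latD_add, latD_latD_one, latD_smul, zero_add, realForm_latD,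
    dotForm_comm, ← dotHom_apply, ← dotHom_apply, map_smul, LinearMap.smul_apply, smul_eq_mul]
  field_simp

theorem sum_sub_smul (n : Form N Λ 2 ℤ) (q : ℤ) (ℓ : Form N Λ 2 ℤ) (Am : Form N Λ 3 ℝ) :
    ∑ c, (((latD n - q • latD ℓ) c : ℤ) : ℝ) * Am c =
      dotForm (realForm (latD n)) Am - q * dotForm (realForm (latD ℓ)) Am := by
  rw [dotForm, dotForm, Finset.mul_sum, ← Finset.sum_sub_distrib]
  refine Finset.sum_congr rfl fun c _ => ?_
  simp only [Pi.sub_apply, Pi.smul_apply, smul_eq_mul, realForm]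
  push_cast
  ring

/-- The loop pairs with A as -∑ A ∪ dl = -∑ dA ∪ l, and with A^m through dl, which shifts the
magnetic constraint. -/
theorem dyonicWeight_eq {γ : Contour N Λ} {l : Form N Λ 2 ℤ} (h : IsSurfaceForm γ l)
    (β θ : ℝ) (p qe qm : ℤ) :
    dyonicWeight β θ p qe qm γ = magneticWeight (coreWeight true β θ p qe l) (qm • latD l) := by
  funext A Am n
  have h1 := latSum_cup_current h.real Am
  have h2 := dotForm_current h.real A
  rw [← realForm_latD, ← latSum_latD_cup, ← pairing_true] at h2
  rw [dyonicWeight, magneticWeight, coreWeight, dotForm_latBdry_fieldStrength, sum_sub_smul,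
    topCharge_eq, h1, h2, ← Complex.exp_add, ← Complex.exp_add]
  congr 1
  push_cast
  ring

/-- Here integration by parts gives ∑ dl ∪ A = -∑ l ∪ dA, the opposite order, matching the opposite
sign in Q̃. -/
theorem dualDyonicWeight_eq {γ : Contour N .primal} {l : Form N .primal 2 ℤ}
    (h : IsSurfaceForm γ l) (β θ : ℝ) (p qe qm : ℤ) :
    dualDyonicWeight β θ p qe qm γ.toDual =
      magneticWeight (coreWeight false β θ p qe (dualSurface l)) (qm • latD (dualSurface l)) := by
  funext A Am n
  have h1 := latSum_cup_dual_current h.dual Am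
  have h2 := dotForm_dual_current h.dual A
  rw [← realForm_latD, ← neg_eq_iff_eq_neg.2 (latSum_cup_latD A (realForm (dualSurface l))),
    ← pairing_false] at h2
  rw [dualDyonicWeight, magneticWeight, coreWeight, dotForm_latBdry_fieldStrength, sum_sub_smul,
    topChargeDual_eq, h1, h2, ← Complex.exp_add, ← Complex.exp_add]
  congr 1
  push_cast
  ring

/-- The weight of the partition function without its magnetic phase. -/
def vacuumWeight (β θ : ℝ) (A : Form N Λ 1 ℝ) (n : Form N Λ 2 ℤ) : ℂ :=
  Complex.exp (-(β / 2 * dotForm (fieldStrength A n) (fieldStrength A n) : ℝ)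
    - Complex.I * (θ * topChargeZero A n : ℝ))

theorem partitionWeight_eq (β θ : ℝ) :
    partitionWeight (N := N) (Λ := Λ) β θ = magneticWeight (vacuumWeight β θ) 0 := by
  funext A Am n
  have h := sum_sub_smul n 0 n Am
  rw [zero_smul] at h
  rw [partitionWeight, magneticWeight, vacuumWeight, dotForm_latBdry_fieldStrength, h,
    ← Complex.exp_add]
  congr 1
  push_cast
  ring

/-- Once dn = 0 is imposed, the ∪₁ correction vanishes and Q₀ may be replaced by Q. -/
theorem vacuumWeight_eq (β θ : ℝ) (A : Form N Λ 1 ℝ) {n : Form N Λ 2 ℤ} (hn : latD n = 0) :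
    vacuumWeight β θ A n = coreWeight true β θ 0 0 0 A n := by
  have h : latSum (cupOne (fieldStrength A n) (latD (realForm n))) = 0 := by
    rw [realForm_latD, hn, show realForm (0 : Form N Λ 3 ℤ) = 0 by funext c; simp [realForm],
      ← cupOnePairing_apply, map_zero]
  rw [vacuumWeight, coreWeight, topChargeZero, charge, h]
  congr 1
  push_cast
  ring

theorem continuous_vacuumWeight (β θ : ℝ) (n : Form N Λ 2 ℤ) :
    Continuous fun A => vacuumWeight β θ A n := by
  have h1 := continuous_dotForm (continuous_fieldStrength (N := N) (Λ := Λ) n)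
    (continuous_fieldStrength (N := N) (Λ := Λ) n)
  have h2 := continuous_charge (N := N) (Λ := Λ) true n
  have h3 := continuous_charge (N := N) (Λ := Λ) false n
  simp only [vacuumWeight, topChargeZero_eq]
  fun_prop

theorem norm_vacuumWeight (β θ : ℝ) (n : Form N Λ 2 ℤ) (A : Form N Λ 1 ℝ) :
    ‖vacuumWeight β θ A n‖ =
      Real.exp (-(β / 2 * dotForm (fieldStrength A n) (fieldStrength A n))) := by
  rw [vacuumWeight, Complex.norm_exp]
  congr 1
  simp

theorem fluxSum_zero_zero (β θ : ℝ) (η : Dirs 2 → ℝ) : fluxSum β θ 0 0 η = fluxSum β θ 0 0 0 := by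
  have h : ∀ (η : Dirs 2 → ℝ) m, shiftedFlux 0 η m = fun I => (m I : ℝ) := fun η m => by
    funext I; simp [shiftedFlux]
  simp [fluxSum, fluxTerm, h]

theorem partitionFunction_eq (β θ : ℝ) (hβ : 0 < β) : partitionFunction N Λ β θ =
    pathIntegral (magneticWeight (coreWeight true β θ 0 0 0)
      ((0 : ℤ) • latD (0 : Form N Λ 2 ℤ))) := by
  rw [partitionFunction, partitionWeight_eq,
    pathIntegral_magneticWeight hβ (continuous_vacuumWeight β θ) (fun A n =>
      norm_vacuumWeight β θ n A),
    pathIntegral_magneticWeight hβ (fun n => continuous_coreWeight true β θ 0 0 0 n)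
    (fun A n => norm_coreWeight true β θ 0 0 0 n A), zero_smul]
  exact tsum_congr fun n => by simp only [vacuumWeight_eq β θ _ n.2]

/-- The expectation values in terms of theta series. -/
theorem pathIntegral_coreWeight_div {β : ℝ} (hβ : 0 < β) (b : Bool) (θ : ℝ) (p qe q : ℤ)
    (ℓ : Form N Λ 2 ℤ) :
    partitionFunction N Λ β θ ≠ 0 ∧
      pathIntegral (magneticWeight (coreWeight b β θ p qe ℓ) (q • latD ℓ)) /
        partitionFunction N Λ β θ =
      Complex.exp (-((qe + θ * q / (2 * Real.pi)) ^ 2 / (2 * β) *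
          dotForm (projBdry (realForm ℓ)) (projBdry (realForm ℓ)) : ℝ)) *
        contourFactor b β θ p qe q ℓ * fluxSum β θ qe q (fluxOf ℓ) / fluxSum β θ 0 0 0 := by
  obtain ⟨C, hC, h⟩ := exists_pathIntegral_coreWeight (N := N) (Λ := Λ) hβ
  have h0 : partitionFunction N Λ β θ = C * fluxSum β θ 0 0 0 := by
    rw [partitionFunction_eq β θ hβ, h]
    simp only [contourFactor, Int.cast_zero, fluxSum_zero_zero]
    simp
  have hS := fluxSum_zero_ne_zero hβ θ
  refine ⟨by rw [h0]; exact mul_ne_zero hC hS, ?_⟩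
  rw [h, h0]
  field_simp

end Weights


/-! ### Absolute convergence and nonvanishing of the partition function -/

section Convergence

variable {N : ℕ} [NeZero N] {Λ : LatticeKind}

theorem continuous_latBdry : Continuous (latBdry : Form N Λ 3 ℝ → Form N Λ 2 ℝ) :=
  (latBdryHom N Λ 2 ℝ).continuous_of_finiteDimensional

theorem continuous_latSum_cup_right (t : Form N Λ 1 ℝ) :
    Continuous fun a : Form N Λ 3 ℝ => latSum (cup t a) :=
  LinearMap.continuous_of_finiteDimensional
    (latSumHom N Λ ℝ ∘ₗ cupHom N Λ 1 3 ℝ t)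

theorem continuous_latSum_cup_left (t : Form N Λ 1 ℝ) :
    Continuous fun a : Form N Λ 3 ℝ => latSum (cup a t) :=
  LinearMap.continuous_of_finiteDimensional
    (latSumHom N Λ ℝ ∘ₗ (cupHom N Λ 3 1 ℝ).flip t)

theorem pathIntegrable_dyonicWeight {β : ℝ} (hβ : 0 < β) (θ : ℝ) (p qe qm : ℤ)
    (γ : Contour N Λ) : PathIntegrable (dyonicWeight β θ p qe qm γ) := by
  refine pathIntegrable_of_norm hβ (fun n => ?_) fun A Am n => ?_
  · have hF := (continuous_fieldStrength (N := N) (Λ := Λ) n).comp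
      (continuous_fst (Y := Form N Λ 3 ℝ))
    have h1 := continuous_dotForm hF hF
    have h2 := (continuous_charge (N := N) (Λ := Λ) true n).comp
      (continuous_fst (Y := Form N Λ 3 ℝ))
    have h3 := continuous_dotForm (continuous_latBdry.comp
      (continuous_snd (X := Form N Λ 1 ℝ) (Y := Form N Λ 3 ℝ))) hF
    have h4 := continuous_dotForm (continuous_const (y := realForm γ.tangent))
      (continuous_fst (X := Form N Λ 1 ℝ) (Y := Form N Λ 3 ℝ))
    have h5 := (continuous_latSum_cup_right (realForm γ.tangent)).comp
      (continuous_snd (X := Form N Λ 1 ℝ))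
    simp only [Function.comp_def] at h1 h2 h3 h5
    simp only [dyonicWeight, topCharge_eq]
    fun_prop
  · rw [dyonicWeight, ← Complex.exp_add, Complex.norm_exp]
    congr 1
    simp

theorem pathIntegrable_dualDyonicWeight {β : ℝ} (hβ : 0 < β) (θ : ℝ) (p qe qm : ℤ)
    (γ : Contour N Λ) : PathIntegrable (dualDyonicWeight β θ p qe qm γ) := by
  refine pathIntegrable_of_norm hβ (fun n => ?_) fun A Am n => ?_
  · have hF := (continuous_fieldStrength (N := N) (Λ := Λ) n).comp
      (continuous_fst (Y := Form N Λ 3 ℝ))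
    have h1 := continuous_dotForm hF hF
    have h2 := (continuous_charge (N := N) (Λ := Λ) false n).comp
      (continuous_fst (Y := Form N Λ 3 ℝ))
    have h3 := continuous_dotForm (continuous_latBdry.comp
      (continuous_snd (X := Form N Λ 1 ℝ) (Y := Form N Λ 3 ℝ))) hF
    have h4 := continuous_dotForm (continuous_const (y := realForm γ.tangent))
      (continuous_fst (X := Form N Λ 1 ℝ) (Y := Form N Λ 3 ℝ))
    have h5 := (continuous_latSum_cup_left (realForm γ.tangent)).comp
      (continuous_snd (X := Form N Λ 1 ℝ))
    simp only [Function.comp_def] at h1 h2 h3 h5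
    simp only [dualDyonicWeight, topChargeDual_eq]
    fun_prop
  · rw [dualDyonicWeight, ← Complex.exp_add, Complex.norm_exp]
    congr 1
    simp

theorem pathIntegrable_partitionWeight {β : ℝ} (hβ : 0 < β) (θ : ℝ) :
    PathIntegrable (partitionWeight (N := N) (Λ := Λ) β θ) := by
  refine pathIntegrable_of_norm hβ (fun n => ?_) fun A Am n => ?_
  · have h1 := (continuous_vacuumWeight (N := N) (Λ := Λ) β θ n).comp
      (continuous_fst (Y := Form N Λ 3 ℝ))
    simp only [Function.comp_def] at h1
    simp only [partitionWeight_eq, magneticWeight]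
    fun_prop
  · rw [partitionWeight_eq, magneticWeight, norm_mul, norm_exp_neg_I_mul, norm_vacuumWeight,
      mul_one]

theorem partitionFunction_ne_zero {β : ℝ} (hβ : 0 < β) (θ : ℝ) :
    partitionFunction N Λ β θ ≠ 0 :=
  (pathIntegral_coreWeight_div hβ true θ 0 0 0 0).1

end Convergence

/-! ### Charge conjugation -/

section ChargeConjugation

variable {N : ℕ} {Λ : LatticeKind}

theorem fieldStrength_neg (A : Form N Λ 1 ℝ) (n : Form N Λ 2 ℤ) :
    fieldStrength (-A) (-n) = -fieldStrength A n := by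
  have h : latD (-A) = -latD A := map_neg (latDHom N Λ 1 ℝ) A
  rw [fieldStrength, fieldStrength, realForm_neg, h, smul_neg, neg_add]

theorem latBdry_neg (q : Form N Λ 3 ℝ) : latBdry (-q) = -latBdry q :=
  map_neg (latBdryHom N Λ 2 ℝ) q

variable [NeZero N]

theorem measurePreserving_neg_gaugeMeasure (r : ℕ) :
    MeasurePreserving (MeasurableEquiv.neg (Form N Λ r ℝ)) (gaugeMeasure N Λ r)
      (gaugeMeasure N Λ r) :=
  measurePreserving_pi (fun _ => angleMeasure) (fun _ => angleMeasure) fun _ =>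
    measurePreserving_neg_angleMeasure

theorem pathIntegral_neg (w : Form N Λ 1 ℝ → Form N Λ 3 ℝ → Form N Λ 2 ℤ → ℂ) :
    pathIntegral (fun A Am n => w (-A) (-Am) (-n)) = pathIntegral w := by
  rw [pathIntegral, pathIntegral]
  rw [← (measurePreserving_neg_gaugeMeasure (N := N) (Λ := Λ) 1).integral_comp'
    fun A => ∫ Am, ∑' n, w A Am n ∂(gaugeMeasure N Λ 3)]
  refine integral_congr_ae (Filter.Eventually.of_forall fun A => ?_)
  beta_reduce
  rw [← (measurePreserving_neg_gaugeMeasure (N := N) (Λ := Λ) 3).integral_comp'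
    fun Am => ∑' n, w (MeasurableEquiv.neg (Form N Λ 1 ℝ) A) Am n]
  refine integral_congr_ae (Filter.Eventually.of_forall fun Am => ?_)
  exact (Equiv.neg (Form N Λ 2 ℤ)).tsum_eq fun n => w (-A) (-Am) n

theorem dotForm_neg_neg {r : ℕ} (α β : Form N Λ r ℝ) : dotForm (-α) (-β) = dotForm α β := by
  simp [dotForm]

theorem pontryagin_neg (n : Form N Λ 2 ℤ) : pontryagin (-n) = pontryagin n := by
  have hs : ∀ α : Form N Λ 2 ℤ, pontryagin α =
      cupPairing N Λ ℤ α α + cupOnePairing N Λ ℤ α (latD α) := fun α =>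
    map_add (latSumHom N Λ ℤ) _ _
  have h : latD (-n) = -latD n := map_neg (latDHom N Λ 2 ℤ) n
  rw [hs, hs, h]
  simp only [map_neg, LinearMap.neg_apply, neg_neg]

theorem topCharge_neg (A : Form N Λ 1 ℝ) (n : Form N Λ 2 ℤ) :
    topCharge (-A) (-n) = topCharge A n := by
  have h : latD (-realForm n) = -latD (realForm n) := map_neg (latDHom N Λ 2 ℝ) _
  rw [topCharge, topCharge, fieldStrength_neg, realForm_neg, h]
  simp only [← cupPairing_apply, ← cupOnePairing_apply, map_neg, LinearMap.neg_apply, neg_neg]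

theorem dyonicWeight_neg (β θ : ℝ) (p qe qm : ℤ) (γ : Contour N Λ) (A : Form N Λ 1 ℝ)
    (Am : Form N Λ 3 ℝ) (n : Form N Λ 2 ℤ) :
    dyonicWeight β θ p qe qm γ (-A) (-Am) (-n) = dyonicWeight β θ p (-qe) (-qm) γ A Am n := by
  have h1 : dotForm (realForm γ.tangent) (-A) = -dotForm (realForm γ.tangent) A :=
    map_neg (dotHom N Λ 1 ℝ (realForm γ.tangent)) A
  have h2 : latSum (cup (realForm γ.tangent) (-Am)) = -latSum (cup (realForm γ.tangent) Am) :=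
    map_neg (latSumHom N Λ ℝ ∘ₗ cupHom N Λ 1 3 ℝ (realForm γ.tangent)) Am
  rw [dyonicWeight, dyonicWeight, fieldStrength_neg, topCharge_neg, latBdry_neg, pontryagin_neg,
    dotForm_neg_neg, dotForm_neg_neg, h1, h2]
  congr 2
  push_cast
  ring

theorem dyonicEV_neg (β θ : ℝ) (p qe qm : ℤ) (γ : Contour N Λ) :
    dyonicEV β θ p qe qm γ = dyonicEV β θ p (-qe) (-qm) γ := by
  rw [dyonicEV, dyonicEV, ← pathIntegral_neg (dyonicWeight β θ p qe qm γ)]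
  simp only [dyonicWeight_neg]

end ChargeConjugation

/-! ### Comparison of the two closed forms -/

section Duality

variable {N : ℕ} [NeZero N] {Λ : LatticeKind}

/-- With ℓ = c + P, both sides contain c ∪ P + P ∪ c and twice the self-pairing of c, while P ∪ P
sums to zero. Modulo the integer ∑ ℓ ∪ ℓ, this ties the electric phases of the two loops to the
phase from Poisson summation. -/
theorem pairing_closedPart_add (ℓ : Form N Λ 2 ℤ) :
    pairing true (closedPart ℓ) (realForm ℓ) + pairing false (closedPart ℓ) (realForm ℓ) =
      ((latSum (cup ℓ ℓ) : ℤ) : ℝ) + wedge (fluxOf ℓ) (fluxOf ℓ) := by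
  obtain ⟨B, hB⟩ := exists_closedPart_eq ℓ
  have hc : ∀ b, pairing b (closedPart ℓ) (closedPart ℓ) = wedge (fluxOf ℓ) (fluxOf ℓ) := by
    intro b
    rw [hB, pairing_exact_add_const]
  have h1 : realForm ℓ = closedPart ℓ + projBdry (realForm ℓ) := by
    rw [closedPart, sub_add_cancel]
  have h2 : ((latSum (cup ℓ ℓ) : ℤ) : ℝ) = pairing true (realForm ℓ) (realForm ℓ) := by
    rw [pairing_realForm]; rfl
  have h3 := pairing_projBdry_projBdry true (realForm ℓ)
  have h4 := pairing_not true (closedPart ℓ) (projBdry (realForm ℓ))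
  rw [Bool.not_true] at h4
  rw [h2]
  set P := projBdry (realForm ℓ)
  set c := closedPart ℓ
  rw [h1]
  simp only [map_add, LinearMap.add_apply]
  rw [hc, hc, h3, h4]
  ring

/-- The coefficient of |P_∂ l|², electric plus magnetic, is invariant under passing to the dual
couplings and replacing the charges (a, b) by (b, -a). -/
theorem coupling_identity {β : ℝ} (hβ : 0 < β) (θ a b : ℝ) :
    (a + θ * b / (2 * Real.pi)) ^ 2 / (2 * β) + 2 * Real.pi ^ 2 * β * b ^ 2 =
      (b + thetaDual β θ * -a / (2 * Real.pi)) ^ 2 / (2 * betaDual β θ)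
        + 2 * Real.pi ^ 2 * betaDual β θ * a ^ 2 := by
  have hpi := Real.pi_ne_zero
  have hD := (couplingNorm_pos hβ θ).ne'
  have hD' : couplingNorm β θ = (2 * Real.pi * β) ^ 2 + (θ / (2 * Real.pi)) ^ 2 := rfl
  rw [thetaDual_eq, betaDual_eq]
  have h : 4 * Real.pi ^ 2 * couplingNorm β θ = (4 * Real.pi ^ 2 * β) ^ 2 + θ ^ 2 := by
    rw [hD']; field_simp; ring
  set D := couplingNorm β θ
  field_simp
  linear_combination (a ^ 2 - b ^ 2 * D) * h

/-- The Gaussian and contour factors of the two expectation values. -/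
theorem contourFactor_dual {β : ℝ} (hβ : 0 < β) (θ : ℝ) (p qe qm : ℤ) (l : Form N .primal 2 ℤ) :
    Complex.exp (-((qe + θ * qm / (2 * Real.pi)) ^ 2 / (2 * β) *
          dotForm (projBdry (realForm l)) (projBdry (realForm l)) : ℝ)) *
        contourFactor true β θ p qe qm l *
        Complex.exp (-(Complex.I * (2 * Real.pi * qe * qm * wedge (fluxOf l) (fluxOf l) : ℝ))) =
      Complex.exp (-((qm + thetaDual β θ * (-qe : ℤ) / (2 * Real.pi)) ^ 2 / (2 * betaDual β θ) *
          dotForm (projBdry (realForm (dualSurface l)))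
            (projBdry (realForm (dualSurface l))) : ℝ)) *
        contourFactor false (betaDual β θ) (thetaDual β θ) p qm (-qe) (dualSurface l) *
        Complex.exp (
          - Complex.I * θ * uNumber l * (1 / 2) * (qm : ℂ) ^ 2
          - Complex.I * thetaDual β θ * uNumber l * (1 / 2) * (qe : ℂ) ^ 2
          - Complex.I * p * Real.pi * (pontryagin l : ℤ) * ((qm : ℂ) ^ 2 + (qe : ℂ) ^ 2)) := by
  have h1 := coupling_identity hβ θ qe qm
  have h2 := pairing_closedPart_add l
  simp only [contourFactor, dualSurface, closedPart_translate, realForm_translate,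
    projBdry_translate, dotForm_translate, uNumber_translate, pontryagin_translate,
    pairing_translate, ← Complex.exp_add]
  -- The first integer comes from `pairing_closedPart_add`. The second arises because the Pontryagin
  -- phase with q_e² occurs twice on the right, in the dual contour factor and in the explicit one,
  -- and not on the left.
  rw [← exp_sub_int_mul_two_pi (_ + _ + _)
    (qe * qm * latSum (cup l l) + p * qe ^ 2 * pontryagin l)]
  congr 1
  have h1' : (((qe : ℝ) + θ * qm / (2 * Real.pi)) ^ 2 / (2 * β) + 2 * Real.pi ^ 2 * β * qm ^ 2 : ℂ)
      = (qm + thetaDual β θ * -qe / (2 * Real.pi)) ^ 2 / (2 * betaDual β θ)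
        + 2 * Real.pi ^ 2 * betaDual β θ * qe ^ 2 := by exact_mod_cast h1
  have h2' := congrArg (fun x : ℝ => (x : ℂ)) h2
  simp only [boolSign, cond_true, cond_false]
  push_cast at h1' h2' ⊢
  linear_combination -((dotForm (projBdry (realForm l)) (projBdry (realForm l)) : ℝ) : ℂ) * h1'
    + 2 * Complex.I * Real.pi * qe * qm * h2'

theorem dyonicEV_eq {β : ℝ} (hβ : 0 < β) (θ : ℝ) (p qe qm : ℤ) {γ : Contour N .primal}
    {l : Form N .primal 2 ℤ} (hl : IsSurfaceForm γ l) :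
    dyonicEV β θ p qe qm γ =
      dualDyonicEV (betaDual β θ) (thetaDual β θ) p qm (-qe) γ.toDual *
        Complex.exp (
          - Complex.I * θ * uNumber l * (1 / 2) * (qm : ℂ) ^ 2
          - Complex.I * thetaDual β θ * uNumber l * (1 / 2) * (qe : ℂ) ^ 2
          - Complex.I * p * Real.pi * (pontryagin l : ℤ) * ((qm : ℂ) ^ 2 + (qe : ℂ) ^ 2)) := by
  have hβ' := betaDual_pos hβ θ
  obtain ⟨D, hD⟩ := exists_fluxSum_dual hβ θ
  have h0 := hD 0 0 0
  have hS := fluxSum_zero_ne_zero hβ θ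
  have hS' := fluxSum_zero_ne_zero hβ' (thetaDual β θ)
  have h1 := hD qe qm (fluxOf l)
  have hflux : fluxOf (dualSurface l) = fluxOf l := fluxOf_translate _ _
  simp only [mul_zero, zero_mul, Complex.ofReal_zero, neg_zero, Complex.exp_zero, mul_one] at h0
  -- The duality constant is nonzero because the theta series at zero charge is.
  have hD0 : D ≠ 0 := by
    rintro rfl
    exact hS (by rw [h0, zero_mul])
  rw [dyonicEV, dualDyonicEV, dyonicWeight_eq hl, dualDyonicWeight_eq hl,
    (pathIntegral_coreWeight_div hβ true θ p qe qm l).2,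
    (pathIntegral_coreWeight_div hβ' false (thetaDual β θ) p qm (-qe) (dualSurface l)).2,
    h0, h1, hflux]
  have h2 := contourFactor_dual hβ θ p qe qm l
  rw [Int.cast_neg] at h2 ⊢
  have h3 : ∀ a b c d e S₀ S : ℂ, S₀ ≠ 0 → a * b * c = d * e →
      a * b * (D * c * S) / (D * S₀) = d * S / S₀ * e := by
    intro a b c d e S₀ S hS₀ h
    rw [div_mul_eq_mul_div, div_eq_div_iff (mul_ne_zero hD0 hS₀) hS₀]
    linear_combination D * S * S₀ * h
  exact h3 _ _ _ _ _ _ _ hS' h2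

end Duality

end LatticeMaxwell
end

theorem mainTheorem4 (N : ℕ) [NeZero N] (β θ : ℝ) (hβ : 0 < β) (p qe qm : ℤ)
    (γ : Contour N .primal) :
    EVDefined β θ (dyonicWeight β θ p qe qm γ) ∧
    EVDefined (betaDual β θ) (thetaDual β θ)
      (dualDyonicWeight (betaDual β θ) (thetaDual β θ) p qm (-qe) γ.toDual) ∧
    (∀ l : Form N .primal 2 ℤ, IsSurfaceForm γ l →
      dyonicEV β θ p qe qm γ =
        dualDyonicEV (betaDual β θ) (thetaDual β θ) p qm (-qe) γ.toDual *
          Complex.exp (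
            - Complex.I * θ * uNumber l * (1 / 2) * (qm : ℂ) ^ 2
            - Complex.I * thetaDual β θ * uNumber l * (1 / 2) * (qe : ℂ) ^ 2
            - Complex.I * p * Real.pi * (pontryagin l : ℤ) * ((qm : ℂ) ^ 2 + (qe : ℂ) ^ 2))) ∧
    dyonicEV β θ p qe qm γ = dyonicEV β θ p (-qe) (-qm) γ := by
  refine ⟨⟨pathIntegrable_dyonicWeight hβ θ p qe qm γ, pathIntegrable_partitionWeight hβ θ,
    partitionFunction_ne_zero hβ θ⟩, ?_, fun l hl => dyonicEV_eq hβ θ p qe qm hl,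
    dyonicEV_neg β θ p qe qm γ⟩
  have hβ' := betaDual_pos hβ θ
  exact ⟨pathIntegrable_dualDyonicWeight hβ' _ p qm (-qe) γ.toDual,
    pathIntegrable_partitionWeight hβ' _, partitionFunction_ne_zero hβ' _⟩
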